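/- Let $\mathsf{PSL}_2(\mathbb{Z}) = \langle a,b \mid a^2=b^3=1\rangle$, where $a$ and $b$ are the classes of $\begin{pmatrix}0&-1\\1&0\end{pmatrix}$ and $\begin{pmatrix}0&-1\\1&1\end{pmatrix}$. A word over $\{a,b,b^{-1}\}$ is *normal* if it has length at most $1$ or alternates the letter $a$ with letters from $\{b,b^{-1}\}$; every element of $\mathsf{PSL}_2(\mathbb{Z})$ is represented by a unique normal word. The *Schreier graph* of a subgroup $H$ has the cosets $Hg$ as vertices, an undirected $a$-edge between $Hg$ and $Hga$, and a directed $b$-edge from $Hg$ to $Hgb$ (read as $b^{-1}$ when travelled backward). The *Stallings graph* $\Gamma(H)$ is the subgraph of the Schreier graph spanned by the loops at the vertex $H$ labeled by the normal words that represent elements of $H$. The *size* of a finitely generated subgroup $H$ is the number of vertices of $\Gamma(H)$. A graph of this kind with a root is *reduced* if its $a$-edges and its $b$-edges form partial injective maps on the vertex set (the $a$-edges being undirected), any two consecutive $b$-edges $v_1\to v_2\to v_3$ are completed by a $b$-edge $v_3\to v_1$, and every vertex except possibly the root is adjacent to an $a$-edge and to a $b$-edge. The subgroup $H$ is *cyclically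 reduced* if $\Gamma(H)$ is reduced when rooted at any one of its vertices and every vertex is adjacent to both an $a$-edge and a $b$-edge (the last requirement matters only if $\Gamma(H)$ has a single vertex). An element of $\mathsf{PSL}_2(\mathbb{Z})$ is *parabolic* if it is a conjugate of a nontrivial power of $ab$, and a subgroup is *non-parabolic* if it contains no parabolic element. Let $0<\alpha<\frac16$. For every $n\ge 1$ the set of finitely generated subgroups of $\mathsf{PSL}_2(\mathbb{Z})$ of size $n$ and the set of cyclically reduced ones among them are finite and nonempty. As $n\to\infty$, the probability that a uniformly random finitely generated subgroup of $\mathsf{PSL}_2(\mathbb{Z})$ of size $n$ is non-parabolic is $\mathcal{O}(n^{-\alpha})$, and the probability that a uniformly random cyclically reduced finitely generated subgroup of size $n$ is non-parabolic is $\mathcal{O}(n^{-\alpha})$. The implied constants may depend on $\alpha$. -/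

import Mathlib

open scoped MatrixGroups

namespace ModularSubgroups

/-- The modular group `PSL₂(ℤ) = SL₂(ℤ) / {±1}`. -/
abbrev PSL2Z : Type := PSL(2, ℤ)

/-- The generator `a` of order `2`: the class of `S = [[0, -1], [1, 0]]`. -/
def genA : PSL2Z := QuotientGroup.mk ModularGroup.S

/-- The generator `b` of order `3`: the class of `S * T = [[0, -1], [1, 1]]`, so that
`PSL₂(ℤ) = ⟨a, b ∣ a² = b³ = 1⟩`. -/
def genB : PSL2Z := QuotientGroup.mk (ModularGroup.S * ModularGroup.T)

theorem mk_neg_one : (QuotientGroup.mk (-1 : SL(2, ℤ)) : PSL2Z) = 1 := by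
  rw [QuotientGroup.eq_one_iff, Subgroup.mem_center_iff]
  intro g
  simp

theorem genA_sq : genA ^ 2 = 1 := by
  rw [genA, ← QuotientGroup.mk_pow, ← mk_neg_one,
    show ModularGroup.S ^ 2 = (-1 : SL(2, ℤ)) by decide]

theorem genB_cube : genB ^ 3 = 1 := by
  rw [genB, ← QuotientGroup.mk_pow, ← mk_neg_one,
    show (ModularGroup.S * ModularGroup.T) ^ 3 = (-1 : SL(2, ℤ)) by decide]

/-- A parabolic element: a conjugate of a nontrivial power of `ab`. -/
def IsParabolic (g : PSL2Z) : Prop :=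
  ∃ k : ℤ, (genA * genB) ^ k ≠ 1 ∧ IsConj ((genA * genB) ^ k) g

/-- A subgroup is non-parabolic if it contains no parabolic element. -/
def NonParabolic (H : Subgroup PSL2Z) : Prop :=
  ∀ g ∈ H, ¬ IsParabolic g

/-! ### Words and normal (geodesic) representatives -/

/-- The alphabet `{a, b, b⁻¹}`. -/
inductive Letter : Type
  | a : Letter
  | b : Letter
  | bInv : Letter

/-- The element of `PSL₂(ℤ)` represented by a letter. -/
def Letter.val : Letter → PSL2Z
  | Letter.a => genA
  | Letter.b => genB
  | Letter.bInv => genB⁻¹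

/-- The element of `PSL₂(ℤ)` represented by a word. -/
def wordVal (w : List Letter) : PSL2Z := (w.map Letter.val).prod

/-- Normal (geodesic) words: the words of length at most `1` and the words in which the letter `a`
alternates with letters from `{b, b⁻¹}`, i.e. of any two consecutive letters exactly one is `a`. -/
def IsNormalWord (w : List Letter) : Prop :=
  w.IsChain (fun x y => x = Letter.a ↔ y ≠ Letter.a)

/-! ### Edge-labeled graphs -/

/-- A graph on a set of vertices with undirected `a`-edges and directed `b`-edges. -/
structure ABGraph (V : Type*) where
  verts : Set V
  aEdge : V → V → Prop
  bEdge : V → V → Prop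
  aEdge_symm : ∀ x y, aEdge x y → aEdge y x
  aEdge_mem : ∀ x y, aEdge x y → x ∈ verts ∧ y ∈ verts
  bEdge_mem : ∀ x y, bEdge x y → x ∈ verts ∧ y ∈ verts

namespace ABGraph

variable {V : Type*}

/-- The vertex `v` is adjacent to an `a`-edge and to a `b`-edge (loops count). -/
def HasBothEdges (Γ : ABGraph V) (v : V) : Prop :=
  (∃ y, Γ.aEdge v y) ∧ (∃ y, Γ.bEdge v y ∨ Γ.bEdge y v)

/-- The graph rooted at `v₀` is `PSL₂(ℤ)`-reduced: the `a`-edges and the `b`-edges form partial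
injective maps (and `a`-edges are undirected, so that distinct `a`-edges share no vertex),
two consecutive `b`-edges close up to a `b`-triangle, and every vertex except maybe the
root is adjacent to an `a`- and to a `b`-edge. (The graphs to which this is applied below are
Stallings graphs, which are connected by construction.) -/
structure IsReducedAt (Γ : ABGraph V) (v₀ : V) : Prop where
  root_mem : v₀ ∈ Γ.verts
  a_fun : ∀ x y z, Γ.aEdge x y → Γ.aEdge x z → y = z
  b_fun : ∀ x y z, Γ.bEdge x y → Γ.bEdge x z → y = z
  b_inj : ∀ x y z, Γ.bEdge x z → Γ.bEdge y z → x = y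
  b_triangle : ∀ x y z, Γ.bEdge x y → Γ.bEdge y z → Γ.bEdge z x
  both_edges : ∀ v ∈ Γ.verts, v ≠ v₀ → Γ.HasBothEdges v

/-- The graph is `PSL₂(ℤ)`-cyclically reduced: it is `PSL₂(ℤ)`-reduced when rooted at any of its
vertices. The second clause follows from the first as soon as there are two vertices; for
one vertex it leaves only the graph with an `a`-loop and a `b`-loop. -/
def IsCyclicallyReduced (Γ : ABGraph V) : Prop :=
  (∀ v ∈ Γ.verts, Γ.IsReducedAt v) ∧ ∀ v ∈ Γ.verts, Γ.HasBothEdges v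

end ABGraph

/-! ### Stallings graphs -/

/-- The vertices of the Schreier graph of `H`: the cosets `Hg`. -/
abbrev Coset (H : Subgroup PSL2Z) : Type := Quotient (QuotientGroup.rightRel H)

/-- The coset `Hg`. -/
def coset (H : Subgroup PSL2Z) (g : PSL2Z) : Coset H := Quotient.mk (QuotientGroup.rightRel H) g

/-- The normal representatives of the elements of `H`. In the Schreier graph of `H` they label
loops at the vertex `H`; such a loop is at the vertex `Hu` after reading the prefix `u`. -/
def normalLoops (H : Subgroup PSL2Z) : Set (List Letter) :=
  {w | IsNormalWord w ∧ wordVal w ∈ H}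

/-- Some loop at `H` labeled by a normal representative of an element of `H` steps from the
vertex `x` to the vertex `y` of the Schreier graph while reading the letter `l`. -/
def Traverses (H : Subgroup PSL2Z) (x : Coset H) (l : Letter) (y : Coset H) : Prop :=
  ∃ w ∈ normalLoops H, ∃ u : List Letter, (u ++ [l]) <+: w ∧
    x = coset H (wordVal u) ∧ y = coset H (wordVal (u ++ [l]))

/-- The vertices visited by the loops at `H` labeled by normal representatives of elements
of `H`. -/
def visited (H : Subgroup PSL2Z) : Set (Coset H) :=
  {x | ∃ w ∈ normalLoops H, ∃ u : List Letter, u <+: w ∧ x = coset H (wordVal u)}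

theorem Traverses.mem {H : Subgroup PSL2Z} {x y : Coset H} {l : Letter} (h : Traverses H x l y) :
    x ∈ visited H ∧ y ∈ visited H := by
  obtain ⟨w, hw, u, hu, hx, hy⟩ := h
  exact ⟨⟨w, hw, u, (List.prefix_append u [l]).trans hu, hx⟩, ⟨w, hw, u ++ [l], hu, hy⟩⟩

/-- The Stallings graph of `H`: the fragment of the Schreier graph of `H` spanned by the loops at
the vertex `H` reading the normal representatives of the elements of `H`. Reading `b⁻¹` means
travelling backward along a `b`-edge. The root is the vertex `coset H 1`. -/
def stallings (H : Subgroup PSL2Z) : ABGraph (Coset H) where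
  verts := visited H
  aEdge x y := Traverses H x Letter.a y ∨ Traverses H y Letter.a x
  bEdge x y := Traverses H x Letter.b y ∨ Traverses H y Letter.bInv x
  aEdge_symm _ _ h := h.symm
  aEdge_mem _ _ h := h.elim (fun h => h.mem) (fun h => h.mem.symm)
  bEdge_mem _ _ h := h.elim (fun h => h.mem) (fun h => h.mem.symm)

/-- The finitely generated subgroups of size `n`, i.e. whose Stallings graph has `n` vertices. -/
def subgroupsOfSize (n : ℕ) : Set (Subgroup PSL2Z) :=
  {H | H.FG ∧ (stallings H).verts.encard = n}

/-- The cyclically reduced subgroups of size `n`. -/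
def cyclicallyReducedSubgroupsOfSize (n : ℕ) : Set (Subgroup PSL2Z) :=
  {H | H ∈ subgroupsOfSize n ∧ (stallings H).IsCyclicallyReduced}

/-- The probability that a uniformly random element of the finite nonempty set `S` of subgroups
has the property `P`. -/
noncomputable def uniformProb (S : Set (Subgroup PSL2Z)) (P : Subgroup PSL2Z → Prop) : ℝ :=
  ({H | H ∈ S ∧ P H}.ncard : ℝ) / (S.ncard : ℝ)

end ModularSubgroups

/-! A labeling of the vertices of Γ(H) turns H into a root, an involution τ (the `a`-edges), a
`b`-structure R and two flags recording which edges are missing at the root. H and the labeling are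
recovered from these data (`Represents.sigma_eq`), so counting subgroups of size n amounts, up to
the factor n!, to counting pairs (τ, R). Conversely, each connected pair with a chosen root comes
from a cyclically reduced subgroup (`IsConn.exists_subgroup`). Write I_n and B_n for the numbers of
involutions and of `b`-structures.

A closed path reading a power of `ab` in Γ(H) puts a parabolic element into H. For non-parabolic H,
following τ and then R away from the root therefore never cycles. Fix R, undefined at k points. If R
has an edge z → x, then τ x = z closes a cycle; fixing x or pairing it with another point reduces to
fewer points. This gives N(m+2) ≤ N(m+1) + m N(m), against I(m+2) = I(m+1) + (m+1) I(m), and hence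
N(m) = O((k/m)^β) I(m) for every β < 1/2 (`card_noCycle_le`, `noCycleBound_le_rpow`).

The components of R are loops, isolated edges and triangles, and R is undefined exactly at the ends
of isolated edges. Their mean number is O(n^(2/3)), by factorial moments of the number of loops
(`descFactorial_two_mul_numB_le`). With β = 3α this yields the factor (n^(2/3)/n)^(3α) = n^(-α),
which explains the range α < 1/6.

Finally at least half of all pairs are connected for large n (`eventually_card_isConn_ge`). The
cyclically reduced subgroups thus already number at least n I_n B_n / (2 n!), and this lower bound
serves as denominator for both probabilities. -/

namespace ModularSubgroups

/-! ### Letters and words -/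

namespace Letter

/-- Whether the letter is `a`. -/
def isA : Letter → Bool
  | a => true
  | b => false
  | bInv => false

/-- The formal inverse of a letter. -/
def inv : Letter → Letter
  | a => a
  | b => bInv
  | bInv => b

theorem isA_iff (l : Letter) : l.isA = true ↔ l = a := by cases l <;> simp [isA]

theorem isA_inv (l : Letter) : l.inv.isA = l.isA := by cases l <;> rfl

end Letter

theorem genA_mul_self : genA * genA = 1 := by rw [← sq, genA_sq]

theorem genA_inv : genA⁻¹ = genA := inv_eq_of_mul_eq_one_left genA_mul_self

theorem genB_mul_self : genB * genB = genB⁻¹ := by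
  rw [eq_inv_iff_mul_eq_one, ← genB_cube, pow_succ, sq]

theorem genB_inv_mul_self : genB⁻¹ * genB⁻¹ = genB := by
  rw [← mul_inv_rev, genB_mul_self, inv_inv]

theorem Letter.val_inv (l : Letter) : l.inv.val = l.val⁻¹ := by
  cases l <;> simp [Letter.inv, Letter.val, genA_inv]

theorem wordVal_nil : wordVal [] = 1 := rfl

theorem wordVal_cons (l : Letter) (w : List Letter) : wordVal (l :: w) = l.val * wordVal w := by
  simp [wordVal]

theorem wordVal_append (u v : List Letter) : wordVal (u ++ v) = wordVal u * wordVal v := by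
  simp [wordVal]

theorem wordVal_singleton (l : Letter) : wordVal [l] = l.val := by simp [wordVal]

/-- The formal inverse of a word. -/
def wordInv (w : List Letter) : List Letter := (w.map Letter.inv).reverse

theorem wordInv_nil : wordInv [] = [] := rfl

theorem wordInv_cons (l : Letter) (w : List Letter) : wordInv (l :: w) = wordInv w ++ [l.inv] := by
  simp [wordInv]

theorem wordInv_append (u v : List Letter) : wordInv (u ++ v) = wordInv v ++ wordInv u := by
  simp [wordInv]

theorem wordVal_wordInv (w : List Letter) : wordVal (wordInv w) = (wordVal w)⁻¹ := by
  induction w with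
  | nil => simp [wordInv_nil, wordVal_nil]
  | cons l w ih =>
    rw [wordInv_cons, wordVal_append, wordVal_cons l w, ih, wordVal_singleton, Letter.val_inv,
      mul_inv_rev]

/-- `IsAlt t w` says that `w` alternates `a` with letters from `{b, b⁻¹}`, its first letter
being `a` if and only if `t` is true. -/
def IsAlt : Bool → List Letter → Prop
  | _, [] => True
  | t, l :: w => l.isA = t ∧ IsAlt (!t) w

/-- The type of the letter that may follow a word alternating from type `t`. -/
def nextType (t : Bool) (w : List Letter) : Bool := w.foldl (fun s _ => !s) t

theorem nextType_nil (t : Bool) : nextType t [] = t := rfl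

theorem nextType_cons (t : Bool) (l : Letter) (w : List Letter) :
    nextType t (l :: w) = nextType (!t) w := rfl

theorem nextType_append (t : Bool) (u v : List Letter) :
    nextType t (u ++ v) = nextType (nextType t u) v := by
  simp [nextType]

theorem isAlt_append (t : Bool) (u v : List Letter) :
    IsAlt t (u ++ v) ↔ IsAlt t u ∧ IsAlt (nextType t u) v := by
  induction u generalizing t with
  | nil => simp [IsAlt, nextType_nil]
  | cons l u ih => simp [IsAlt, nextType_cons, ih, and_assoc]

theorem isAlt_wordInv (t : Bool) (w : List Letter) (h : IsAlt t w) :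
    IsAlt (!nextType t w) (wordInv w) ∧ nextType (!nextType t w) (wordInv w) = !t := by
  induction w generalizing t with
  | nil => simp [wordInv_nil, IsAlt, nextType_nil]
  | cons l w ih =>
    obtain ⟨h1, h2⟩ := ih _ h.2
    rw [wordInv_cons, nextType_cons, isAlt_append, nextType_append, h2]
    simp [h1, IsAlt, nextType_cons, nextType_nil, Letter.isA_inv, h.1]

theorem isNormalWord_iff (w : List Letter) : IsNormalWord w ↔ ∃ t, IsAlt t w := by
  have key : ∀ (w : List Letter) (l : Letter), IsNormalWord (l :: w) ↔ IsAlt l.isA (l :: w) := by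
    intro w
    induction w with
    | nil => intro l; simp [IsNormalWord, IsAlt]
    | cons m w ih =>
      intro l
      have := ih m
      unfold IsNormalWord at this ⊢
      rw [List.isChain_cons_cons, this]
      cases l <;> cases m <;> simp [IsAlt, Letter.isA]
  cases w with
  | nil => simp [IsNormalWord, IsAlt]
  | cons l w =>
    rw [key]
    exact ⟨fun h => ⟨_, h⟩, fun ⟨t, h⟩ => by rwa [h.1]⟩

/-! ### Uniqueness of normal words -/

theorem mk_eq_mk_iff (M N : SL(2, ℤ)) :
    (QuotientGroup.mk M : PSL2Z) = QuotientGroup.mk N ↔ N = M ∨ N = -M := by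
  rw [QuotientGroup.eq, Matrix.SpecialLinearGroup.mem_center_iff]
  constructor
  · rintro ⟨r, hr, h⟩
    have hr' : r = 1 ∨ r = -1 := by
      rw [Fintype.card_fin] at hr
      simpa using hr
    rcases hr' with rfl | rfl
    · left
      have : M⁻¹ * N = 1 := by ext i j; rw [← h]; simp
      rw [inv_mul_eq_one] at this
      exact this.symm
    · right
      have : M⁻¹ * N = -1 := by ext i j; rw [← h]; simp
      rw [inv_mul_eq_iff_eq_mul] at this
      simpa using this
  · rintro (rfl | rfl)
    · exact ⟨1, by simp, by simp⟩
    · exact ⟨-1, by simp, by simp⟩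

/-- The matrix has nonnegative entries. -/
def IsNonneg (M : SL(2, ℤ)) : Prop := ∀ i j, 0 ≤ M.1 i j

/-- A matrix is determined by its class up to sign, and neither `N` nor `-N` is nonnegative when `N`
has entries of both signs. -/
theorem IsNonneg.ne_mk {M : SL(2, ℤ)} (hM : IsNonneg M) {N : SL(2, ℤ)} (i j k l : Fin 2)
    (h1 : 0 < N.1 i j) (h2 : N.1 k l < 0) :
    (QuotientGroup.mk M : PSL2Z) ≠ QuotientGroup.mk N := by
  rw [Ne, mk_eq_mk_iff]
  rintro (rfl | rfl)
  · exact absurd (hM k l) (not_le.mpr h2)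
  · have := hM i j
    rw [Matrix.SpecialLinearGroup.coe_neg, Matrix.neg_apply] at h1
    linarith

/-- The syllables `ab` and `ab⁻¹` are the classes of [[1,1],[0,1]] and [[1,0],[1,1]]; words of odd
length leave a trailing `a`. The entry sum is 2 for the identity, so the bound 3 tells nonempty
products from it. -/
theorem exists_isNonneg_of_isAlt (w : List Letter) (h : IsAlt true w) :
    ∃ M : SL(2, ℤ), IsNonneg M ∧
      (wordVal w = QuotientGroup.mk M ∨ wordVal w = QuotientGroup.mk M * genA) ∧
      (2 ≤ w.length → 3 ≤ M.1 0 0 + M.1 0 1 + M.1 1 0 + M.1 1 1) := by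
  match w, h with
  | [], _ => exact ⟨1, by intro i j; fin_cases i <;> fin_cases j <;> simp, Or.inl rfl, by simp⟩
  | [l], h =>
    refine ⟨1, by intro i j; fin_cases i <;> fin_cases j <;> simp, Or.inr ?_, by simp⟩
    rw [(Letter.isA_iff l).1 h.1, wordVal_singleton]
    simp [Letter.val]
  | l :: m :: w, h =>
    obtain ⟨M, hM, hw, -⟩ := exists_isNonneg_of_isAlt w h.2.2
    obtain rfl := (Letter.isA_iff l).1 h.1
    have hdet : M.1 0 0 * M.1 1 1 - M.1 0 1 * M.1 1 0 = 1 := by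
      rw [← Matrix.det_fin_two]; exact M.2
    have h00 := hM 0 0
    have h01 := hM 0 1
    have h10 := hM 1 0
    have h11 := hM 1 1
    -- No row vanishes because the determinant is 1. Adding one row to the other then brings the
    -- entry sum to at least 3.
    have hr0 : 1 ≤ M.1 0 0 + M.1 0 1 := by
      by_contra hc
      have e1 : M.1 0 0 = 0 := by linarith
      have e2 : M.1 0 1 = 0 := by linarith
      rw [e1, e2] at hdet; simp at hdet
    have hr1 : 1 ≤ M.1 1 0 + M.1 1 1 := by
      by_contra hc
      have e1 : M.1 1 0 = 0 := by linarith
      have e2 : M.1 1 1 = 0 := by linarith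
      rw [e1, e2] at hdet; simp at hdet
    have step : ∀ N : SL(2, ℤ), Letter.a.val * m.val = QuotientGroup.mk N → IsNonneg (N * M) →
        (3 ≤ (N * M).1 0 0 + (N * M).1 0 1 + (N * M).1 1 0 + (N * M).1 1 1) →
        ∃ M : SL(2, ℤ), IsNonneg M ∧
      (wordVal (Letter.a :: m :: w) = QuotientGroup.mk M ∨
        wordVal (Letter.a :: m :: w) = QuotientGroup.mk M * genA) ∧
      (2 ≤ (Letter.a :: m :: w).length → 3 ≤ M.1 0 0 + M.1 0 1 + M.1 1 0 + M.1 1 1) := by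
      intro N hN h1 h2
      refine ⟨N * M, h1, ?_, fun _ => h2⟩
      rw [wordVal_cons, wordVal_cons, ← mul_assoc, hN, QuotientGroup.mk_mul]
      rcases hw with hw | hw <;> rw [hw]
      · exact Or.inl rfl
      · exact Or.inr (mul_assoc _ _ _).symm
    cases m with
    | a => exact absurd h.2.1 (by simp [Letter.isA])
    | b =>
      have e : ∀ j, (ModularGroup.T * M).1 0 j = M.1 0 j + M.1 1 j ∧
          (ModularGroup.T * M).1 1 j = M.1 1 j := by
        intro j
        simp [ModularGroup.coe_T, Matrix.mul_apply, Fin.sum_univ_two]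
      apply step ModularGroup.T
      · rw [Letter.val, Letter.val, genA, genB, ← QuotientGroup.mk_mul, mk_eq_mk_iff]
        right; decide
      · intro i j
        fin_cases i <;> fin_cases j <;> simp only [Fin.mk_zero, Fin.mk_one, e] <;>
          linarith
      · simp only [e]; linarith
    | bInv =>
      have hN : ∀ i j, (ModularGroup.S * (ModularGroup.S * ModularGroup.T)⁻¹).1 i j =
          (!![1, 0; 1, 1] : Matrix (Fin 2) (Fin 2) ℤ) i j := by
        intro i j
        fin_cases i <;> fin_cases j <;> decide
      have e : ∀ j, ((ModularGroup.S * (ModularGroup.S * ModularGroup.T)⁻¹) * M).1 0 j = M.1 0 j ∧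
          ((ModularGroup.S * (ModularGroup.S * ModularGroup.T)⁻¹) * M).1 1 j =
            M.1 0 j + M.1 1 j := by
        intro j
        rw [Matrix.SpecialLinearGroup.coe_mul _ M, Matrix.mul_apply, Matrix.mul_apply,
          Fin.sum_univ_two, Fin.sum_univ_two, hN, hN, hN, hN]
        simp
      apply step (ModularGroup.S * (ModularGroup.S * ModularGroup.T)⁻¹)
      · rfl
      · intro i j
        fin_cases i <;> fin_cases j <;> simp only [Fin.mk_zero, Fin.mk_one, e] <;>
          linarith
      · simp only [e]; linarith

/-- This is the freeness of the product of ⟨a⟩ and ⟨b⟩. For a word starting with `b` or `b⁻¹`, that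
letter moves to the other side of the equation, where a matrix with entries of both signs appears.
-/
theorem wordVal_ne_one {w : List Letter} (hw : IsNormalWord w) (hne : w ≠ []) :
    wordVal w ≠ 1 := by
  obtain ⟨t, ht⟩ := (isNormalWord_iff w).1 hw
  cases t with
  | true =>
    obtain ⟨M, hM, h, hs⟩ := exists_isNonneg_of_isAlt w ht
    rcases h with h | h
    · match w, hne, ht, hs with
      | [l], _, ht, _ =>
        obtain rfl := (Letter.isA_iff l).1 ht.1
        rw [wordVal_singleton, Letter.val, genA, ← QuotientGroup.mk_one, Ne, mk_eq_mk_iff]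
        decide
      | l :: m :: w, _, ht, hs =>
        intro h1
        rw [h, ← QuotientGroup.mk_one, mk_eq_mk_iff] at h1
        have h3 := hs (by simp)
        rcases h1 with h1 | h1
        · rw [← h1] at h3; simp at h3
        · have h4 := hM 0 0
          rw [← neg_eq_iff_eq_neg] at h1
          rw [← h1] at h4; simp at h4
    · rw [h]
      intro h1
      rw [mul_eq_one_iff_eq_inv, genA_inv] at h1
      exact hM.ne_mk (N := ModularGroup.S) 1 0 0 1 (by decide) (by decide) h1
  | false =>
    cases w with
    | nil => exact absurd rfl hne
    | cons l w =>
      obtain ⟨M, hM, h, -⟩ := exists_isNonneg_of_isAlt w ht.2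
      rw [wordVal_cons]
      intro h1
      rw [mul_eq_one_iff_inv_eq] at h1
      rcases h with h | h
      · rw [h] at h1
        cases l with
        | a => exact absurd ht.1 (by simp [Letter.isA])
        | b =>
          exact hM.ne_mk (N := (ModularGroup.S * ModularGroup.T)⁻¹) 0 0 1 0 (by decide) (by decide)
            h1.symm
        | bInv =>
          rw [Letter.val, inv_inv] at h1
          exact hM.ne_mk (N := (ModularGroup.S * ModularGroup.T)) 1 0 0 1 (by decide) (by decide)
            h1.symm
      · rw [h, ← mul_inv_eq_iff_eq_mul, genA_inv] at h1
        cases l with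
        | a => exact absurd ht.1 (by simp [Letter.isA])
        | b =>
          exact hM.ne_mk (N := (ModularGroup.S * ModularGroup.T)⁻¹ * ModularGroup.S) 0 0 0 1
            (by decide) (by decide) h1.symm
        | bInv =>
          rw [Letter.val, inv_inv] at h1
          exact hM.ne_mk (N := (ModularGroup.S * ModularGroup.T) * ModularGroup.S) 1 0 0 0
            (by decide) (by decide) h1.symm

/-- Equal last letters cancel. If the last letters l, m differ, then u l m⁻¹ v⁻¹ has value 1 but is
a nonempty normal word, after rewriting l m⁻¹ as l⁻¹ when both are powers of `b`. -/
theorem isAlt_unique {s t : Bool} (u v : List Letter) (hu : IsAlt s u) (hv : IsAlt t v)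
    (h : wordVal u = wordVal v) : u = v := by
  induction u using List.reverseRecOn generalizing s t v with
  | nil =>
    by_contra hne
    exact wordVal_ne_one ((isNormalWord_iff v).2 ⟨t, hv⟩) (Ne.symm hne) (h ▸ rfl)
  | append_singleton u l ih =>
    rcases List.eq_nil_or_concat v with rfl | ⟨v, m, rfl⟩
    · exact absurd h (wordVal_ne_one ((isNormalWord_iff _).2 ⟨s, hu⟩) (by simp))
    · rw [List.concat_eq_append] at hv h ⊢
      rw [wordVal_append, wordVal_append, wordVal_singleton, wordVal_singleton] at h
      rw [isAlt_append] at hu hv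
      obtain ⟨hu1, hu2, -⟩ := hu
      obtain ⟨hv1, hv2, -⟩ := hv
      have hvi := isAlt_wordInv t v hv1
      by_cases hlm : l = m
      · subst hlm
        rw [ih v hu1 hv1 (mul_right_cancel h)]
      · exfalso
        have hval : wordVal u * (l.val * m.inv.val) * wordVal (wordInv v) = 1 := by
          rw [wordVal_wordInv, Letter.val_inv, ← mul_assoc, h]; group
        by_cases hA : l.isA = m.isA
        · have hne : l.isA = false := by
            by_contra hc
            rw [Bool.not_eq_false] at hc
            have hm : m.isA = true := hA ▸ hc
            exact hlm (((Letter.isA_iff l).1 hc).trans ((Letter.isA_iff m).1 hm).symm)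
          have hli : l.val * m.inv.val = l.inv.val := by
            cases l <;> cases m <;> simp_all [Letter.isA, Letter.inv, Letter.val, genB_mul_self,
              genB_inv_mul_self]
          refine wordVal_ne_one (w := u ++ [l.inv] ++ wordInv v) ((isNormalWord_iff _).2 ⟨s, ?_⟩)
            (by simp) ?_
          · rw [isAlt_append, isAlt_append, nextType_append]
            refine ⟨⟨hu1, by rw [Letter.isA_inv]; exact hu2, trivial⟩, ?_⟩
            rw [nextType_cons, nextType_nil, ← hu2, hA, hv2]
            exact hvi.1
          · rw [wordVal_append, wordVal_append, wordVal_singleton, ← hli, hval]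
        · refine wordVal_ne_one (w := u ++ [l, m.inv] ++ wordInv v) ((isNormalWord_iff _).2 ⟨s, ?_⟩)
            (by simp) ?_
          · rw [isAlt_append, isAlt_append, nextType_append]
            have hm : m.isA = !l.isA := by
              cases h1 : m.isA <;> cases h2 : l.isA <;> simp_all
            refine ⟨⟨hu1, hu2, by rw [Letter.isA_inv, hm, hu2], trivial⟩, ?_⟩
            rw [nextType_cons, nextType_cons, nextType_nil, Bool.not_not, ← hu2,
              show l.isA = !m.isA by rw [hm, Bool.not_not], hv2]
            exact hvi.1
          · rw [wordVal_append, wordVal_append, wordVal_cons, wordVal_singleton, hval]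

theorem normalWord_unique {u v : List Letter} (hu : IsNormalWord u) (hv : IsNormalWord v)
    (h : wordVal u = wordVal v) : u = v := by
  obtain ⟨s, hs⟩ := (isNormalWord_iff u).1 hu
  obtain ⟨t, ht⟩ := (isNormalWord_iff v).1 hv
  exact isAlt_unique u v hs ht h

/-! ### Reading words in a graph -/

namespace ABGraph

variable {V : Type*}

/-- Crossing an edge of the graph while reading a letter. -/
def Step (Γ : ABGraph V) (x : V) : Letter → V → Prop
  | Letter.a, y => Γ.aEdge x y
  | Letter.b, y => Γ.bEdge x y
  | Letter.bInv, y => Γ.bEdge y x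

/-- The word labels a path from `x` to `y`. -/
def Reads (Γ : ABGraph V) : V → List Letter → V → Prop
  | x, [], y => x = y
  | x, l :: w, y => ∃ z, Γ.Step x l z ∧ Γ.Reads z w y

/-- The edges of the graph are folded: they form partial injections and consecutive `b`-edges
close up to triangles. -/
structure IsFolded (Γ : ABGraph V) : Prop where
  a_fun : ∀ x y z, Γ.aEdge x y → Γ.aEdge x z → y = z
  b_fun : ∀ x y z, Γ.bEdge x y → Γ.bEdge x z → y = z
  b_inj : ∀ x y z, Γ.bEdge x z → Γ.bEdge y z → x = y
  b_triangle : ∀ x y z, Γ.bEdge x y → Γ.bEdge y z → Γ.bEdge z x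

variable {Γ : ABGraph V}

theorem Step.symm {x y : V} {l : Letter} (h : Γ.Step x l y) : Γ.Step y l.inv x := by
  cases l with
  | a => exact Γ.aEdge_symm _ _ h
  | b => exact h
  | bInv => exact h

theorem reads_singleton {x y : V} {l : Letter} : Γ.Reads x [l] y ↔ Γ.Step x l y := by
  simp [Reads]

theorem reads_append {x y : V} {u v : List Letter} :
    Γ.Reads x (u ++ v) y ↔ ∃ z, Γ.Reads x u z ∧ Γ.Reads z v y := by
  induction u generalizing x with
  | nil => simp [Reads]
  | cons l u ih =>
    simp only [List.cons_append, Reads, ih]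
    constructor
    · rintro ⟨z, h1, z', h2, h3⟩; exact ⟨z', ⟨z, h1, h2⟩, h3⟩
    · rintro ⟨z', ⟨z, h1, h2⟩, h3⟩; exact ⟨z, h1, z', h2, h3⟩

theorem Reads.symm {x y : V} {w : List Letter} (h : Γ.Reads x w y) :
    Γ.Reads y (wordInv w) x := by
  induction w generalizing x with
  | nil => exact Eq.symm h
  | cons l w ih =>
    obtain ⟨z, h1, h2⟩ := h
    rw [wordInv_cons, reads_append]
    exact ⟨z, ih h2, reads_singleton.2 h1.symm⟩

namespace IsFolded

theorem step_unique (hΓ : Γ.IsFolded) {x y z : V} {l : Letter} (h1 : Γ.Step x l y)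
    (h2 : Γ.Step x l z) : y = z := by
  cases l with
  | a => exact hΓ.a_fun _ _ _ h1 h2
  | b => exact hΓ.b_fun _ _ _ h1 h2
  | bInv => exact hΓ.b_inj _ _ _ h1 h2

theorem reads_unique (hΓ : Γ.IsFolded) {x y z : V} {w : List Letter} (h1 : Γ.Reads x w y)
    (h2 : Γ.Reads x w z) : y = z := by
  induction w generalizing x with
  | nil => exact Eq.trans (Eq.symm h1) h2
  | cons l w ih =>
    obtain ⟨y', h3, h4⟩ := h1
    obtain ⟨z', h5, h6⟩ := h2
    obtain rfl := hΓ.step_unique h3 h5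
    exact ih h4 h6

theorem step_inv (hΓ : Γ.IsFolded) {x y z : V} {l : Letter} (h1 : Γ.Step x l y)
    (h2 : Γ.Step y l.inv z) : x = z := hΓ.step_unique h1.symm h2

theorem step_step (hΓ : Γ.IsFolded) {x y z : V} {l : Letter} (hl : l.isA = false)
    (h1 : Γ.Step x l y) (h2 : Γ.Step y l z) : Γ.Step x l.inv z := by
  cases l with
  | a => simp [Letter.isA] at hl
  | b => exact hΓ.b_triangle _ _ _ h1 h2
  | bInv => exact hΓ.b_triangle _ _ _ h2 h1

end IsFolded

end ABGraph

/-- Every word can be rewritten as a normal word with the same value, which labels all the paths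
labeled by the given one. -/
theorem exists_normalWord (w : List Letter) : ∃ w', IsNormalWord w' ∧ wordVal w' = wordVal w ∧
    ∀ (V : Type) (Γ : ABGraph V), Γ.IsFolded → ∀ x y, Γ.Reads x w y → Γ.Reads x w' y := by
  suffices h : ∃ t w', IsAlt t w' ∧ wordVal w' = wordVal w ∧
      ∀ (V : Type) (Γ : ABGraph V), Γ.IsFolded → ∀ x y, Γ.Reads x w y → Γ.Reads x w' y by
    obtain ⟨t, w', h1, h2⟩ := h
    exact ⟨w', (isNormalWord_iff _).2 ⟨t, h1⟩, h2⟩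
  induction w with
  | nil => exact ⟨true, [], trivial, rfl, fun _ _ _ _ _ h => h⟩
  | cons l w ih =>
    obtain ⟨t, w', halt, hval, hread⟩ := ih
    match w', halt, hval, hread with
    | [], halt, hval, hread =>
      refine ⟨l.isA, [l], ⟨rfl, trivial⟩, ?_, ?_⟩
      · rw [wordVal_cons, wordVal_cons, hval]
      · rintro V Γ hΓ x y ⟨z, h1, h2⟩
        exact ⟨z, h1, hread V Γ hΓ z y h2⟩
    | m :: w', halt, hval, hread =>
      by_cases h1 : l.isA = t
      · by_cases h2 : m = l.inv
        · subst h2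
          refine ⟨!t, w', halt.2, ?_, ?_⟩
          · rw [wordVal_cons l, ← hval, wordVal_cons, Letter.val_inv, mul_inv_cancel_left]
          · rintro V Γ hΓ x y ⟨z, h1, h2⟩
            obtain ⟨z', h3, h4⟩ := hread V Γ hΓ z y h2
            rwa [hΓ.step_inv h1 h3]
        · have hm : m = l ∧ l.isA = false := by
            have := halt.1
            rw [← h1] at this
            cases l <;> cases m <;> simp_all [Letter.isA, Letter.inv]
          obtain ⟨rfl, hl⟩ := hm
          refine ⟨t, m.inv :: w', ⟨by rw [Letter.isA_inv, h1], halt.2⟩, ?_, ?_⟩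
          · have : m.val * m.val = m.inv.val := by
              cases m <;> simp_all [Letter.isA, Letter.inv, Letter.val, genB_mul_self,
                genB_inv_mul_self]
            rw [wordVal_cons m w, ← hval, wordVal_cons, wordVal_cons, ← mul_assoc, this]
          · rintro V Γ hΓ x y ⟨z, h1, h2⟩
            obtain ⟨z', h3, h4⟩ := hread V Γ hΓ z y h2
            exact ⟨z', hΓ.step_step hl h1 h3, h4⟩
      · refine ⟨!t, l :: m :: w', ⟨by cases t <;> simp_all, by rw [Bool.not_not]; exact halt⟩, ?_, ?_⟩
        · rw [wordVal_cons, wordVal_cons l, hval]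
        · rintro V Γ hΓ x y ⟨z, h1, h2⟩
          exact ⟨z, h1, hread V Γ hΓ z y h2⟩

theorem exists_word (g : PSL2Z) : ∃ w, wordVal w = g := by
  let K : Subgroup PSL2Z :=
    { carrier := {g | ∃ w, wordVal w = g}
      mul_mem' := by
        rintro _ _ ⟨u, rfl⟩ ⟨v, rfl⟩
        exact ⟨u ++ v, wordVal_append u v⟩
      one_mem' := ⟨[], rfl⟩
      inv_mem' := by
        rintro _ ⟨u, rfl⟩
        exact ⟨wordInv u, wordVal_wordInv u⟩ }
  induction g using QuotientGroup.induction_on with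
  | H M =>
    have hM : M ∈ Subgroup.closure {ModularGroup.S, ModularGroup.T} := by
      rw [SpecialLinearGroup.SL2Z_generators]; trivial
    have hle : Subgroup.closure {ModularGroup.S, ModularGroup.T} ≤
        K.comap (QuotientGroup.mk' _) := by
      rw [Subgroup.closure_le]
      rintro _ (rfl | rfl)
      · exact ⟨[Letter.a], wordVal_singleton _⟩
      · refine ⟨[Letter.a, Letter.b], ?_⟩
        rw [wordVal_cons, wordVal_singleton]
        change genA * genB = QuotientGroup.mk _
        rw [genA, genB, ← QuotientGroup.mk_mul, mk_eq_mk_iff]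
        right; decide
    exact hle hM

theorem exists_normalWord_val (g : PSL2Z) : ∃ w, IsNormalWord w ∧ wordVal w = g := by
  obtain ⟨w, rfl⟩ := exists_word g
  obtain ⟨w', h1, h2, -⟩ := exists_normalWord w
  exact ⟨w', h1, h2⟩

/-! ### Stallings graphs are reduced -/

section Stallings

variable {H : Subgroup PSL2Z}

theorem coset_eq_iff {g k : PSL2Z} : coset H g = coset H k ↔ k * g⁻¹ ∈ H := by
  rw [coset, coset, Quotient.eq, QuotientGroup.rightRel_apply]

theorem coset_mul {g k : PSL2Z} (h : coset H g = coset H k) (x : PSL2Z) :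
    coset H (g * x) = coset H (k * x) := by
  rw [coset_eq_iff] at h ⊢
  simpa [mul_assoc] using h

theorem coset_eq_one_iff {g : PSL2Z} : coset H g = coset H 1 ↔ g ∈ H := by
  rw [coset_eq_iff]; simp

theorem wordInv_mem_normalLoops {w : List Letter} (hw : w ∈ normalLoops H) :
    wordInv w ∈ normalLoops H := by
  obtain ⟨h1, h2⟩ := hw
  obtain ⟨t, ht⟩ := (isNormalWord_iff w).1 h1
  exact ⟨(isNormalWord_iff _).2 ⟨_, (isAlt_wordInv t w ht).1⟩, by
    rw [wordVal_wordInv]; exact H.inv_mem h2⟩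

theorem coset_wordVal_prefix {u v : List Letter} (h : wordVal (u ++ v) ∈ H) :
    coset H (wordVal u) = coset H (wordVal (wordInv v)) := by
  rw [wordVal_append] at h
  rw [coset_eq_iff, wordVal_wordInv, ← mul_inv_rev]
  exact H.inv_mem h

theorem Traverses.symm {x y : Coset H} {l : Letter} (h : Traverses H x l y) :
    Traverses H y l.inv x := by
  obtain ⟨w, hw, u, ⟨v, rfl⟩, rfl, rfl⟩ := h
  refine ⟨_, wordInv_mem_normalLoops hw, wordInv v, ⟨wordInv u, ?_⟩, ?_, ?_⟩
  · simp [wordInv_append, wordInv_cons]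
  · exact coset_wordVal_prefix hw.2
  · have := hw.2
    rw [List.append_assoc] at this
    rw [coset_wordVal_prefix this]
    simp [wordInv_cons]

theorem stallings_step_iff {x y : Coset H} {l : Letter} :
    (stallings H).Step x l y ↔ Traverses H x l y := by
  cases l with
  | a => exact ⟨fun h => h.elim id Traverses.symm, Or.inl⟩
  | b => exact ⟨fun h => h.elim id Traverses.symm, Or.inl⟩
  | bInv => exact ⟨fun h => h.elim Traverses.symm id, Or.inr⟩

theorem Traverses.coset_eq {g : PSL2Z} {y : Coset H} {l : Letter}
    (h : Traverses H (coset H g) l y) : y = coset H (g * l.val) := by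
  obtain ⟨w, -, u, -, h1, rfl⟩ := h
  rw [wordVal_append, wordVal_singleton]
  exact (coset_mul h1 _).symm

theorem coset_of_reads {g : PSL2Z} {y : Coset H} {w : List Letter}
    (h : (stallings H).Reads (coset H g) w y) : y = coset H (g * wordVal w) := by
  induction w generalizing g with
  | nil => rw [wordVal_nil, mul_one]; exact Eq.symm h
  | cons l w ih =>
    obtain ⟨z, h1, h2⟩ := h
    obtain rfl := (stallings_step_iff.1 h1).coset_eq
    rw [ih h2, wordVal_cons, mul_assoc]

theorem coset_surj (x : Coset H) : ∃ g, x = coset H g := by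
  induction x using Quotient.inductionOn with
  | h g => exact ⟨g, rfl⟩

/-- Partial injectivity is inherited from the Schreier graph. For triangles the closing edge must
itself be visited: if the loops u₁ b v₁ and u₂ b v₂ cross x → y and y → z, then u₁ b⁻¹ v₂ is again a
normal loop, since b⁻¹ = b², and it steps from x to z. -/
theorem stallings_isFolded (H : Subgroup PSL2Z) : (stallings H).IsFolded := by
  have huniq : ∀ (l : Letter) (x y z : Coset H), (stallings H).Step x l y →
      (stallings H).Step x l z → y = z := by
    intro l x y z h1 h2
    obtain ⟨g, rfl⟩ := coset_surj x
    rw [(stallings_step_iff.1 h1).coset_eq, (stallings_step_iff.1 h2).coset_eq]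
  refine ⟨huniq Letter.a, huniq Letter.b, fun x y z h1 h2 => huniq Letter.bInv z x y h1 h2, ?_⟩
  intro x y z h1 h2
  have h1' : Traverses H x Letter.b y := stallings_step_iff.1 h1
  have h2' : Traverses H y Letter.b z := stallings_step_iff.1 h2
  have hxz : ∀ g, x = coset H g → z = coset H (g * genB⁻¹) := by
    rintro g rfl
    obtain rfl := h1'.coset_eq
    rw [h2'.coset_eq, Letter.val, mul_assoc, genB_mul_self]
  obtain ⟨w1, hw1, u1, ⟨v1, rfl⟩, hx, -⟩ := h1'
  obtain ⟨w2, hw2, u2, ⟨v2, rfl⟩, -, hz⟩ := h2'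
  have key : Traverses H x Letter.bInv z := by
    have hz' : z = coset H (wordVal (u1 ++ [Letter.bInv])) := by
      rw [wordVal_append, wordVal_singleton]
      exact hxz _ hx
    refine ⟨u1 ++ [Letter.bInv] ++ v2, ⟨?_, ?_⟩, u1, List.prefix_append _ _, hx, hz'⟩
    · obtain ⟨s, hs⟩ := (isNormalWord_iff _).1 hw1.1
      obtain ⟨t, ht⟩ := (isNormalWord_iff _).1 hw2.1
      rw [isAlt_append, isAlt_append] at hs ht
      refine (isNormalWord_iff _).2 ⟨s, ?_⟩
      rw [isAlt_append, isAlt_append]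
      refine ⟨⟨hs.1.1, hs.1.2⟩, ?_⟩
      have e1 := hs.1.2.1
      have e2 := ht.1.2.1
      have e3 := ht.2
      rw [nextType_append, nextType_cons, nextType_nil] at e3 ⊢
      rwa [← e1, e2]
    · have : coset H (wordVal (u2 ++ [Letter.b]) * wordVal v2) =
          coset H (wordVal (u1 ++ [Letter.bInv]) * wordVal v2) := by
        apply coset_mul; rw [← hz, hz']
      rw [← wordVal_append, ← wordVal_append, coset_eq_one_iff.2 hw2.2] at this
      exact coset_eq_one_iff.1 this.symm
  exact stallings_step_iff.2 key.symm

theorem reads_prefix {u v : List Letter} (h : u ++ v ∈ normalLoops H) :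
    (stallings H).Reads (coset H 1) u (coset H (wordVal u)) := by
  suffices hs : ∀ u' u'' : List Letter, u' ++ u'' = u →
      (stallings H).Reads (coset H (wordVal u')) u'' (coset H (wordVal u)) from
    hs [] u rfl
  intro u' u''
  induction u'' generalizing u' with
  | nil => rintro rfl; simp [ABGraph.Reads]
  | cons l u'' ih =>
    rintro rfl
    refine ⟨coset H (wordVal (u' ++ [l])), stallings_step_iff.2 ⟨_, h, u', ?_, rfl, rfl⟩, ?_⟩
    · exact ⟨u'' ++ v, by simp⟩
    · exact ih (u' ++ [l]) (by simp)

/-- Shows that H can be read off its rooted Stallings graph, normal or not being irrelevant for the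
labels of loops. -/
theorem mem_iff_reads {g : PSL2Z} : g ∈ H ↔
    ∃ w, wordVal w = g ∧ (stallings H).Reads (coset H 1) w (coset H 1) := by
  constructor
  · intro hg
    obtain ⟨w, h1, rfl⟩ := exists_normalWord_val g
    refine ⟨w, rfl, ?_⟩
    have := reads_prefix (H := H) (u := w) (v := []) ⟨by simpa using h1, by simpa using hg⟩
    rwa [coset_eq_one_iff.2 hg] at this
  · rintro ⟨w, rfl, h⟩
    have := coset_of_reads h
    rw [one_mul] at this
    exact coset_eq_one_iff.1 this.symm

theorem exists_reads_of_mem_visited {x : Coset H} (hx : x ∈ visited H) :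
    ∃ u, (stallings H).Reads (coset H 1) u x := by
  obtain ⟨w, hw, u, ⟨v, rfl⟩, rfl⟩ := hx
  exact ⟨u, reads_prefix hw⟩

theorem root_mem_visited (H : Subgroup PSL2Z) : coset H 1 ∈ visited H :=
  ⟨[], ⟨(isNormalWord_iff _).2 ⟨true, trivial⟩, H.one_mem⟩, [], List.prefix_rfl, rfl⟩

/-- A vertex other than the root is met strictly inside a normal loop, between two letters of which
exactly one is `a`. -/
theorem stallings_hasBothEdges {x : Coset H} (hx : x ∈ visited H) (hne : x ≠ coset H 1) :
    (stallings H).HasBothEdges x := by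
  obtain ⟨w, hw, u, ⟨v, rfl⟩, rfl⟩ := hx
  rcases List.eq_nil_or_concat u with rfl | ⟨u, l, rfl⟩
  · exact absurd rfl hne
  rw [List.concat_eq_append] at *
  cases v with
  | nil =>
    rw [List.append_nil] at hw
    exact absurd (coset_eq_one_iff.2 hw.2) hne
  | cons m v =>
    have h1 : (stallings H).Step (coset H (wordVal (u ++ [l]))) l.inv (coset H (wordVal u)) :=
      ABGraph.Step.symm (stallings_step_iff.2 ⟨_, hw, u, List.prefix_append _ _, rfl, rfl⟩)
    have h2 : (stallings H).Step (coset H (wordVal (u ++ [l]))) m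
        (coset H (wordVal (u ++ [l] ++ [m]))) :=
      stallings_step_iff.2 ⟨_, hw, u ++ [l], ⟨v, by simp⟩, rfl, rfl⟩
    obtain ⟨t, ht⟩ := (isNormalWord_iff _).1 hw.1
    rw [isAlt_append, isAlt_append] at ht
    have h3 := ht.1.2.1
    have h4 := ht.2.1
    rw [nextType_append, nextType_cons, nextType_nil, ← h3] at h4
    have hb : ∀ (k : Letter) (y : Coset H), k.isA = false →
        (stallings H).Step (coset H (wordVal (u ++ [l]))) k y →
        ∃ y, (stallings H).bEdge (coset H (wordVal (u ++ [l]))) y ∨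
          (stallings H).bEdge y (coset H (wordVal (u ++ [l]))) := by
      intro k y hk hs
      cases k with
      | a => simp [Letter.isA] at hk
      | b => exact ⟨y, Or.inl hs⟩
      | bInv => exact ⟨y, Or.inr hs⟩
    cases hl : l.isA with
    | true =>
      obtain rfl := (Letter.isA_iff l).1 hl
      exact ⟨⟨_, h1⟩, hb m _ h4 h2⟩
    | false =>
      rw [hl] at h4
      obtain rfl := (Letter.isA_iff m).1 h4
      exact ⟨⟨_, h2⟩, hb l.inv _ (by rw [Letter.isA_inv, hl]) h1⟩

/-! ### Parabolic elements and cycles labeled by powers of `ab` -/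

theorem genA_mul_genB_pow_ne_one {k : ℤ} (hk : k ≠ 0) : (genA * genB) ^ k ≠ 1 := by
  have h : genA * genB = QuotientGroup.mk ModularGroup.T := by
    rw [genA, genB, ← QuotientGroup.mk_mul, mk_eq_mk_iff]
    right; decide
  rw [h, ← QuotientGroup.mk_zpow, ← QuotientGroup.mk_one, Ne, mk_eq_mk_iff]
  rintro (h1 | h1)
  · have := congrArg (fun M : SL(2, ℤ) => M.1 0 1) h1
    simp [ModularGroup.coe_T_zpow] at this
    exact hk this.symm
  · have := congrArg (fun M : SL(2, ℤ) => M.1 0 1) h1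
    simp [ModularGroup.coe_T_zpow] at this
    exact hk this

/-- If the cycle starts at Hg and reads (ab)^k, then g (ab)^k g⁻¹ lies in H, and `ab`, the class of
a unipotent matrix, has infinite order. -/
theorem not_nonParabolic_of_cycle {x : Coset H}
    (h : Relation.TransGen
      (fun x y => ∃ z, (stallings H).aEdge x z ∧ (stallings H).bEdge z y) x x) :
    ¬ NonParabolic H := by
  obtain ⟨g, rfl⟩ := coset_surj x
  have hstep : ∀ (g : PSL2Z) (y : Coset H),
      (∃ z, (stallings H).aEdge (coset H g) z ∧ (stallings H).bEdge z y) →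
      y = coset H (g * (genA * genB)) := by
    rintro g y ⟨z, h1, h2⟩
    have h3 : (stallings H).Reads (coset H g) [Letter.a, Letter.b] y := ⟨z, h1, y, h2, rfl⟩
    rw [coset_of_reads h3, wordVal_cons, wordVal_singleton]
    rfl
  have hk : ∀ y, Relation.TransGen
      (fun x y => ∃ z, (stallings H).aEdge x z ∧ (stallings H).bEdge z y) (coset H g) y →
      ∃ k : ℕ, y = coset H (g * (genA * genB) ^ (k + 1)) := by
    intro y hy
    induction hy with
    | single h1 => exact ⟨0, by rw [hstep _ _ h1]; simp⟩
    | tail _ h1 ih =>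
      obtain ⟨k, rfl⟩ := ih
      exact ⟨k + 1, by rw [hstep _ _ h1, mul_assoc, ← pow_succ]⟩
  obtain ⟨k, hk⟩ := hk _ h
  rw [coset_eq_iff] at hk
  intro hnp
  refine hnp _ hk ⟨(k + 1 : ℕ), genA_mul_genB_pow_ne_one (by positivity), ?_⟩
  rw [zpow_natCast, isConj_iff]
  exact ⟨g, rfl⟩

end Stallings

/-! ### Labeled structures -/

/-- The relation `R` is the set of `b`-edges of a graph in which every vertex is adjacent to
a `b`-edge. -/
structure IsBStructure {V : Type*} (R : V → V → Prop) : Prop where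
  fun_ : ∀ {x y z}, R x y → R x z → y = z
  inj : ∀ {x y z}, R x z → R y z → x = y
  triangle : ∀ {x y z}, R x y → R y z → R z x
  total : ∀ v, ∃ y, R v y ∨ R y v

/-- The involutions of `V`. -/
abbrev Inv (V : Type*) : Type _ := {τ : V → V // Function.Involutive τ}

/-- The `b`-structures on `V`. -/
abbrev BStr (V : Type*) : Type _ := {R : V → V → Prop // IsBStructure R}

/-- A labeled rooted graph: a root, `a`-edges and `b`-edges, and two flags telling whether the
`a`-loop and the `b`-loop at the root have to be deleted. -/
structure LabeledGraph (V : Type*) where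
  root : V
  a : Inv V
  b : BStr V
  dropA : Prop
  dropB : Prop

/-- The labeled graph is the image of the Stallings graph of `H` by the labeling `e`. -/
structure LabeledGraph.Represents {V : Type*} (d : LabeledGraph V) (H : Subgroup PSL2Z)
    (e : visited H ≃ V) : Prop where
  root_eq : e ⟨coset H 1, root_mem_visited H⟩ = d.root
  a_iff : ∀ i j, (stallings H).aEdge (e.symm i) (e.symm j) ↔
    d.a.1 i = j ∧ ¬ (d.dropA ∧ i = d.root)
  b_iff : ∀ i j, (stallings H).bEdge (e.symm i) (e.symm j) ↔
    d.b.1 i j ∧ ¬ (d.dropB ∧ i = d.root)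

/-- Only the root may lack an edge; it then receives a loop, and the flag remembers that this loop
is artificial. The next lemma does the same for `b`-edges. -/
theorem exists_involutive_extension {V : Type*} (A : V → V → Prop) (r : V)
    (hsymm : ∀ x y, A x y → A y x) (hfun : ∀ x y z, A x y → A x z → y = z)
    (htot : ∀ v, v ≠ r → ∃ y, A v y) :
    ∃ τ : V → V, Function.Involutive τ ∧
      ∀ i j, A i j ↔ τ i = j ∧ ¬ ((¬ ∃ k, A r k) ∧ i = r) := by
  have h : ∀ v, ∃ w, A v w ∨ (v = r ∧ w = r ∧ ¬ ∃ k, A r k) := by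
    intro v
    by_cases hv : v = r
    · subst hv
      by_cases hr : ∃ k, A v k
      · exact ⟨hr.choose, Or.inl hr.choose_spec⟩
      · exact ⟨v, Or.inr ⟨rfl, rfl, hr⟩⟩
    · obtain ⟨y, hy⟩ := htot v hv
      exact ⟨y, Or.inl hy⟩
  choose τ hτ using h
  refine ⟨τ, ?_, ?_⟩
  · intro v
    rcases hτ v with h1 | ⟨h1, h2, h3⟩
    · rcases hτ (τ v) with h4 | ⟨h4, -, h6⟩
      · exact hfun _ _ _ h4 (hsymm _ _ h1)
      · exact absurd ⟨v, h4 ▸ hsymm _ _ h1⟩ h6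
    · rw [h2, ← h1, h2, h1]
  · intro i j
    rcases hτ i with h1 | ⟨h1, h2, h3⟩
    · constructor
      · intro h
        refine ⟨hfun _ _ _ h1 h, ?_⟩
        rintro ⟨h3, rfl⟩
        exact h3 ⟨j, h⟩
      · rintro ⟨rfl, -⟩
        exact h1
    · subst h1
      constructor
      · intro h; exact absurd ⟨j, h⟩ h3
      · rintro ⟨-, h⟩; exact absurd ⟨h3, rfl⟩ h

theorem exists_bStructure_extension {V : Type*} (B : V → V → Prop) (r : V)
    (hfun : ∀ x y z, B x y → B x z → y = z) (hinj : ∀ x y z, B x z → B y z → x = y)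
    (htri : ∀ x y z, B x y → B y z → B z x)
    (htot : ∀ v, v ≠ r → ∃ y, B v y ∨ B y v) :
    ∃ R : V → V → Prop, IsBStructure R ∧
      ∀ i j, B i j ↔ R i j ∧ ¬ ((¬ ∃ k, B r k ∨ B k r) ∧ i = r) := by
  by_cases hr : ∃ k, B r k ∨ B k r
  · refine ⟨B, ⟨hfun _ _ _, hinj _ _ _, htri _ _ _, ?_⟩, by simp [hr]⟩
    intro v
    by_cases hv : v = r
    · rw [hv]; exact hr
    · exact htot v hv
  · have hr1 : ∀ k, ¬ B r k := fun k h => hr ⟨k, Or.inl h⟩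
    have hr2 : ∀ k, ¬ B k r := fun k h => hr ⟨k, Or.inr h⟩
    refine ⟨fun i j => B i j ∨ (i = r ∧ j = r), ⟨?_, ?_, ?_, ?_⟩, ?_⟩
    · rintro x y z (h1 | ⟨h1, h2⟩) (h3 | ⟨h3, h4⟩)
      · exact hfun _ _ _ h1 h3
      · subst h3; exact absurd h1 (hr1 _)
      · subst h1; exact absurd h3 (hr1 _)
      · rw [h2, h4]
    · rintro x y z (h1 | ⟨h1, h2⟩) (h3 | ⟨h3, h4⟩)
      · exact hinj _ _ _ h1 h3
      · subst h4; exact absurd h1 (hr2 _)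
      · subst h2; exact absurd h3 (hr2 _)
      · rw [h1, h3]
    · rintro x y z (h1 | ⟨h1, h2⟩) (h3 | ⟨h3, h4⟩)
      · exact Or.inl (htri _ _ _ h1 h3)
      · subst h3; exact absurd h1 (hr2 _)
      · subst h2; exact absurd h3 (hr1 _)
      · exact Or.inr ⟨h4, h1⟩
    · intro v
      by_cases hv : v = r
      · exact ⟨v, Or.inl (Or.inr ⟨hv, hv⟩)⟩
      · obtain ⟨y, h | h⟩ := htot v hv
        · exact ⟨y, Or.inl (Or.inl h)⟩
        · exact ⟨y, Or.inr (Or.inl h)⟩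
    · intro i j
      constructor
      · intro h
        refine ⟨Or.inl h, ?_⟩
        rintro ⟨-, rfl⟩
        exact hr1 _ h
      · rintro ⟨h | ⟨h1, -⟩, h2⟩
        · exact h
        · exact absurd ⟨hr, h1⟩ h2

theorem exists_represents {V : Type*} (H : Subgroup PSL2Z) (e : visited H ≃ V) :
    ∃ d : LabeledGraph V, d.Represents H e := by
  have hF := stallings_isFolded H
  let r : V := e ⟨coset H 1, root_mem_visited H⟩
  have hboth : ∀ v, v ≠ r → (stallings H).HasBothEdges (e.symm v) := by
    intro v hv
    refine stallings_hasBothEdges (e.symm v).2 fun h => hv ?_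
    rw [← e.apply_symm_apply v]
    exact congrArg e (Subtype.ext h)
  have hlift : ∀ y : Coset H, y ∈ visited H → ∃ j, (e.symm j : Coset H) = y := fun y hy =>
    ⟨e ⟨y, hy⟩, by simp⟩
  have hinj : ∀ {i j}, (e.symm i : Coset H) = e.symm j → i = j := fun h =>
    e.symm.injective (Subtype.ext h)
  obtain ⟨τ, hτ, hA⟩ := exists_involutive_extension
    (fun i j => (stallings H).aEdge (e.symm i) (e.symm j)) r
    (fun _ _ h => (stallings H).aEdge_symm _ _ h)
    (fun _ _ _ h1 h2 => hinj (hF.a_fun _ _ _ h1 h2))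
    (fun v hv => by
      obtain ⟨⟨y, hy⟩, -⟩ := hboth v hv
      obtain ⟨j, rfl⟩ := hlift y ((stallings H).aEdge_mem _ _ hy).2
      exact ⟨j, hy⟩)
  obtain ⟨R, hR, hB⟩ := exists_bStructure_extension
    (fun i j => (stallings H).bEdge (e.symm i) (e.symm j)) r
    (fun _ _ _ h1 h2 => hinj (hF.b_fun _ _ _ h1 h2))
    (fun _ _ _ h1 h2 => hinj (hF.b_inj _ _ _ h1 h2))
    (fun _ _ _ h1 h2 => hF.b_triangle _ _ _ h1 h2)
    (fun v hv => by
      obtain ⟨-, ⟨y, hy | hy⟩⟩ := hboth v hv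
      · obtain ⟨j, rfl⟩ := hlift y ((stallings H).bEdge_mem _ _ hy).2
        exact ⟨j, Or.inl hy⟩
      · obtain ⟨j, rfl⟩ := hlift y ((stallings H).bEdge_mem _ _ hy).1
        exact ⟨j, Or.inr hy⟩)
  exact ⟨⟨r, ⟨τ, hτ⟩, ⟨R, hR⟩, _, _⟩, ⟨rfl, hA, hB⟩⟩

/-! ### Recovering a subgroup and its labeling from the labeled graph -/

namespace LabeledGraph

variable {V : Type*} {d : LabeledGraph V}

theorem Represents.reads_transfer {H H' : Subgroup PSL2Z} {e : visited H ≃ V}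
    {e' : visited H' ≃ V} (h : d.Represents H e) (h' : d.Represents H' e') {i : V}
    {w : List Letter} {y : Coset H} (hr : (stallings H).Reads (e.symm i) w y) :
    ∃ j, y = e.symm j ∧ (stallings H').Reads (e'.symm i) w (e'.symm j) := by
  induction w generalizing i with
  | nil => exact ⟨i, Eq.symm hr, rfl⟩
  | cons l w ih =>
    obtain ⟨z, h1, h2⟩ := hr
    have hz : z ∈ visited H := (stallings_step_iff.1 h1).mem.2
    obtain ⟨k, rfl⟩ : ∃ k, z = e.symm k := ⟨e ⟨z, hz⟩, by simp⟩
    obtain ⟨j, rfl, h3⟩ := ih h2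
    refine ⟨j, rfl, e'.symm k, ?_, h3⟩
    cases l with
    | a => exact (h'.a_iff _ _).2 ((h.a_iff _ _).1 h1)
    | b => exact (h'.b_iff _ _).2 ((h.b_iff _ _).1 h1)
    | bInv => exact (h'.b_iff _ _).2 ((h.b_iff _ _).1 h1)

theorem Represents.symm_root {H : Subgroup PSL2Z} {e : visited H ≃ V} (h : d.Represents H e) :
    (e.symm d.root : Coset H) = coset H 1 := by
  rw [← h.root_eq, Equiv.symm_apply_apply]

theorem Represents.le {H H' : Subgroup PSL2Z} {e : visited H ≃ V} {e' : visited H' ≃ V}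
    (h : d.Represents H e) (h' : d.Represents H' e') : H ≤ H' := by
  intro g hg
  obtain ⟨w, hw, hr⟩ := mem_iff_reads.1 hg
  rw [← h.symm_root] at hr
  obtain ⟨j, h1, h2⟩ := h.reads_transfer h' hr
  obtain rfl := e.symm.injective (Subtype.ext h1)
  rw [h'.symm_root] at h2
  exact mem_iff_reads.2 ⟨w, hw, h2⟩

/-- The subgroup is the set of values of labels of loops at the root, which the data determine. So
is the labeling, since every vertex is reached from the root by some word. -/
theorem Represents.sigma_eq {H H' : Subgroup PSL2Z} {e : visited H ≃ V} {e' : visited H' ≃ V}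
    (h : d.Represents H e) (h' : d.Represents H' e') :
    (⟨H, e⟩ : Σ H : Subgroup PSL2Z, visited H ≃ V) = ⟨H', e'⟩ := by
  obtain rfl := le_antisymm (h.le h') (h'.le h)
  congr 1
  ext x
  obtain ⟨u, hu⟩ := exists_reads_of_mem_visited x.2
  have hu' := hu
  rw [← h.symm_root] at hu
  obtain ⟨j, h1, h2⟩ := h.reads_transfer h' hu
  rw [h'.symm_root] at h2
  have h3 := (stallings_isFolded H).reads_unique hu' h2
  have h4 : e x = j := by rw [← e.apply_symm_apply j]; exact congrArg e (Subtype.ext h1)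
  have h5 : e' x = j := by rw [← e'.apply_symm_apply j]; exact congrArg e' (Subtype.ext h3)
  rw [h4, h5]

/-- The edges added to complete the graph are loops at the root, so a cycle away from the root lives
in the Stallings graph itself. -/
theorem Represents.acyclic {H : Subgroup PSL2Z} {e : visited H ≃ V} (h : d.Represents H e)
    (hH : NonParabolic H) (v : V) : ¬ Relation.TransGen
      (fun v w => d.b.1 (d.a.1 v) w ∧ d.a.1 v ≠ d.root ∧ w ≠ d.root) v v := by
  intro hc
  refine not_nonParabolic_of_cycle (x := (e.symm v : Coset H)) ?_ hH
  refine Relation.TransGen.lift (fun i => (e.symm i : Coset H)) ?_ _ _ hc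
  rintro i j ⟨h1, h2, h3⟩
  refine ⟨e.symm (d.a.1 i), ?_, (h.b_iff _ _).2 ⟨h1, fun h4 => h2 h4.2⟩⟩
  apply (stallings H).aEdge_symm
  exact (h.a_iff _ _).2 ⟨d.a.2 i, fun h4 => h2 h4.2⟩

end LabeledGraph

/-! ### The subgroup defined by a connected graph -/

section GraphOf

variable {V : Type}

/-- The graph with the given `a`-edges and `b`-edges. -/
def graphOf (τ : Inv V) (R : BStr V) : ABGraph V where
  verts := Set.univ
  aEdge i j := τ.1 i = j
  bEdge := R.1
  aEdge_symm := by rintro i _ rfl; exact τ.2 i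
  aEdge_mem _ _ _ := ⟨trivial, trivial⟩
  bEdge_mem _ _ _ := ⟨trivial, trivial⟩

theorem graphOf_isFolded (τ : Inv V) (R : BStr V) : (graphOf τ R).IsFolded where
  a_fun _ _ _ h1 h2 := Eq.trans (Eq.symm h1) h2
  b_fun _ _ _ h1 h2 := R.2.fun_ h1 h2
  b_inj _ _ _ h1 h2 := R.2.inj h1 h2
  b_triangle _ _ _ h1 h2 := R.2.triangle h1 h2

/-- The set of vertices is a union of connected components. -/
def IsInvariant (τ : Inv V) (R : BStr V) (A : Set V) : Prop :=
  (∀ v ∈ A, τ.1 v ∈ A) ∧ ∀ v w, R.1 v w → (v ∈ A ↔ w ∈ A)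

/-- The graph is connected. -/
def IsConn (τ : Inv V) (R : BStr V) : Prop :=
  ∀ A : Set V, A.Nonempty → IsInvariant τ R A → A = Set.univ

theorem IsConn.exists_reads {τ : Inv V} {R : BStr V} (h : IsConn τ R) (x y : V) :
    ∃ w, (graphOf τ R).Reads x w y := by
  have hext : ∀ (v v' : V) (l : Letter), (graphOf τ R).Step v l v' →
      (∃ w, (graphOf τ R).Reads x w v) → ∃ w, (graphOf τ R).Reads x w v' := by
    rintro v v' l hl ⟨w, hw⟩
    exact ⟨w ++ [l], ABGraph.reads_append.2 ⟨v, hw, ABGraph.reads_singleton.2 hl⟩⟩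
  have := h {v | ∃ w, (graphOf τ R).Reads x w v} ⟨x, [], rfl⟩
    ⟨fun v hv => hext v _ Letter.a rfl hv, fun v w hvw =>
      ⟨hext v w Letter.b hvw, hext w v Letter.bInv hvw⟩⟩
  exact (Set.ext_iff.1 this y).2 trivial

theorem IsBStructure.flip {R : V → V → Prop} (h : IsBStructure R) :
    IsBStructure (fun x y => R y x) where
  fun_ h1 h2 := h.inj h1 h2
  inj h1 h2 := h.fun_ h1 h2
  triangle h1 h2 := h.triangle h2 h1
  total v := (h.total v).imp fun _ => Or.symm

/-- Components are loops, isolated edges and triangles; σ follows the edges and returns from the end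
of an isolated edge to its start. -/
theorem IsBStructure.exists_successor {R : V → V → Prop} (h : IsBStructure R) :
    ∃ σ : V → V, Function.Injective σ ∧ (∀ v, R v (σ v) ∨ R (σ v) v) ∧
      ∀ v w, R v w → σ v = w := by
  have hex : ∀ v, ∃ w, R v w ∨ (R w v ∧ ∀ y, ¬ R v y) := by
    intro v
    by_cases hv : ∃ y, R v y
    · exact ⟨hv.choose, Or.inl hv.choose_spec⟩
    · obtain ⟨y, hy⟩ := h.total v
      rw [not_exists] at hv
      exact ⟨y, Or.inr ⟨hy.resolve_left (hv y), hv⟩⟩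
  choose σ hσ using hex
  refine ⟨σ, ?_, fun v => (hσ v).imp id And.left, ?_⟩
  · intro x y hxy
    rcases hσ x with h1 | ⟨h1, h2⟩ <;> rcases hσ y with h3 | ⟨h3, h4⟩ <;> rw [hxy] at h1
    · exact h.inj h1 h3
    · exact absurd (h.triangle h1 h3) (h4 _)
    · exact absurd (h.triangle h3 h1) (h2 _)
    · exact h.fun_ h1 h3
  · intro v w hvw
    rcases hσ v with h1 | ⟨-, h2⟩
    · exact h.fun_ h1 hvw
    · exact absurd hvw (h2 w)

/-- Some word alternating from type `s.2` labels a path from `s.1` to `s'.1`, and may be continued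
by a letter of type `s'.2`. -/
def AltReads (Γ : ABGraph V) (s s' : V × Bool) : Prop :=
  ∃ u, IsAlt s.2 u ∧ Γ.Reads s.1 u s'.1 ∧ nextType s.2 u = s'.2

theorem AltReads.refl (Γ : ABGraph V) (s : V × Bool) : AltReads Γ s s :=
  ⟨[], trivial, rfl, rfl⟩

theorem AltReads.trans {Γ : ABGraph V} {s s' s'' : V × Bool} (h : AltReads Γ s s')
    (h' : AltReads Γ s' s'') : AltReads Γ s s'' := by
  obtain ⟨u, h1, h2, h3⟩ := h
  obtain ⟨v, h4, h5, h6⟩ := h'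
  exact ⟨u ++ v, (isAlt_append _ _ _).2 ⟨h1, h3 ▸ h4⟩, ABGraph.reads_append.2 ⟨_, h2, h5⟩, by
    rw [nextType_append, h3, h6]⟩

theorem AltReads.single {Γ : ABGraph V} {x y : V} {l : Letter} (h : Γ.Step x l y) :
    AltReads Γ (x, l.isA) (y, !l.isA) :=
  ⟨[l], ⟨rfl, trivial⟩, ABGraph.reads_singleton.2 h, rfl⟩

/-- An injective self-map of a finite set is periodic at every point, so iterating `F` leads from `F
s` back to `s`. -/
theorem altReads_of_injective [Finite V] {Γ : ABGraph V} (F : V × Bool → V × Bool)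
    (hF : Function.Injective F) (hs : ∀ s, AltReads Γ s (F s)) (s : V × Bool) :
    AltReads Γ (F s) s := by
  obtain ⟨n, hn, hp⟩ := hF.mem_periodicPts s
  obtain ⟨m, rfl⟩ := Nat.exists_eq_succ_of_ne_zero hn.ne'
  have hiter : ∀ (k : ℕ) (s : V × Bool), AltReads Γ s (F^[k] s) := by
    intro k
    induction k with
    | zero => exact fun s => AltReads.refl Γ s
    | succ k ih =>
      intro s
      rw [Function.iterate_succ_apply]
      exact (hs s).trans (ih _)
  have := hiter m (F s)
  rwa [← Function.iterate_succ_apply, hp] at this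

theorem altReads_back [Finite V] {τ : Inv V} {R : BStr V} {x y : V} {l : Letter}
    (h : (graphOf τ R).Step x l y) : AltReads (graphOf τ R) (y, !l.isA) (x, l.isA) := by
  have key : ∀ σ : V → V, Function.Injective σ → (∀ v, R.1 v (σ v) ∨ R.1 (σ v) v) →
      ∀ v : V, AltReads (graphOf τ R) (τ.1 v, false) (v, true) ∧
        AltReads (graphOf τ R) (σ v, true) (v, false) := by
    intro σ hσ hR
    -- The Boolean tells whether the next letter is `a`. Alternating τ with σ is an injective walk
    -- on these states, so every step can be undone by alternating steps forward.
    let F : V × Bool → V × Bool := fun s => if s.2 then (τ.1 s.1, false) else (σ s.1, true)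
    have hF : Function.Injective F := by
      rintro ⟨v, _ | _⟩ ⟨w, _ | _⟩ h <;> simp [F] at h
      · rw [hσ h]
      · rw [τ.2.injective h]
    have hs : ∀ s, AltReads (graphOf τ R) s (F s) := by
      rintro ⟨v, _ | _⟩
      · rcases hR v with h | h
        · exact AltReads.single (Γ := graphOf τ R) (l := Letter.b) h
        · exact AltReads.single (Γ := graphOf τ R) (l := Letter.bInv) h
      · exact AltReads.single (Γ := graphOf τ R) (l := Letter.a) rfl
    exact fun v => ⟨altReads_of_injective F hF hs (v, true),
      altReads_of_injective F hF hs (v, false)⟩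
  obtain ⟨σ, h1, h2, h3⟩ := R.2.exists_successor
  obtain ⟨σ', h1', h2', h3'⟩ := R.2.flip.exists_successor
  cases l with
  | a =>
    have hxy : τ.1 x = y := h
    subst hxy
    exact (key σ h1 h2 x).1
  | b =>
    obtain rfl := h3 _ _ h
    exact (key σ h1 h2 x).2
  | bInv =>
    obtain rfl := h3' _ _ h
    exact (key σ' h1' (fun v => (h2' v).symm) x).2

theorem AltReads.symm [Finite V] {τ : Inv V} {R : BStr V} {s s' : V × Bool}
    (h : AltReads (graphOf τ R) s s') : AltReads (graphOf τ R) s' s := by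
  obtain ⟨u, h1, h2, h3⟩ := h
  induction u generalizing s with
  | nil =>
    have : s = s' := Prod.ext h2 h3
    rw [this]
    exact AltReads.refl _ _
  | cons l u ih =>
    obtain ⟨z, h4, h5⟩ := h2
    have h6 := ih (s := (z, !s.2)) h1.2 h5 h3
    have h7 := altReads_back h4
    rw [h1.1] at h7
    exact h6.trans h7

/-- Ensures that every edge of the graph is visited by a normal loop at the root, hence survives in
the Stallings graph. -/
theorem IsConn.exists_normal_loop [Finite V] {τ : Inv V} {R : BStr V} (h : IsConn τ R) (r : V)
    {x y : V} {l : Letter} (hl : (graphOf τ R).Step x l y) :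
    ∃ u v, IsNormalWord (u ++ [l] ++ v) ∧ (graphOf τ R).Reads r u x ∧
      (graphOf τ R).Reads y v r := by
  have hx : ∃ t, AltReads (graphOf τ R) (r, t) (x, l.isA) := by
    obtain ⟨w, hw⟩ := h.exists_reads r x
    obtain ⟨p, hp, -, hread⟩ := exists_normalWord w
    obtain ⟨t, ht⟩ := (isNormalWord_iff p).1 hp
    have hpx := hread V _ (graphOf_isFolded τ R) r x hw
    by_cases hs : nextType t p = l.isA
    · exact ⟨t, p, ht, hpx, hs⟩
    -- A path ending with the wrong type is repaired by reading it backward, which goes from x to r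
    -- with the right starting type, and then reversing that connection by `AltReads.symm`.
    · have hs' : (!nextType t p) = l.isA := by
        cases h1 : nextType t p <;> cases h2 : l.isA <;> simp_all
      have hi := isAlt_wordInv t p ht
      rw [hs'] at hi
      exact ⟨!t, AltReads.symm ⟨wordInv p, hi.1, hpx.symm, hi.2⟩⟩
  obtain ⟨t, ht⟩ := hx
  obtain ⟨v, hv1, hv2, -⟩ := (ht.trans (AltReads.single hl)).symm
  obtain ⟨u, hu1, hu2, hu3⟩ := ht
  refine ⟨u, v, (isNormalWord_iff _).2 ⟨t, ?_⟩, hu2, hv2⟩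
  rw [isAlt_append, isAlt_append, nextType_append, hu3]
  exact ⟨⟨hu1, rfl, trivial⟩, hv1⟩

/-- The subgroup of the values of the labels of the loops at `r`. -/
def loopGroup (Γ : ABGraph V) (r : V) : Subgroup PSL2Z where
  carrier := {g | ∃ w, wordVal w = g ∧ Γ.Reads r w r}
  mul_mem' := by
    rintro _ _ ⟨u, rfl, hu⟩ ⟨v, rfl, hv⟩
    exact ⟨u ++ v, wordVal_append u v, ABGraph.reads_append.2 ⟨r, hu, hv⟩⟩
  one_mem' := ⟨[], rfl, rfl⟩
  inv_mem' := by
    rintro _ ⟨u, rfl, hu⟩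
    exact ⟨wordInv u, wordVal_wordInv u, hu.symm⟩

variable {Γ : ABGraph V} {r : V}

theorem ABGraph.IsFolded.reads_of_wordVal_eq (hΓ : Γ.IsFolded) {x y : V} {u v : List Letter}
    (hu : Γ.Reads x u y) (hv : IsNormalWord v) (h : wordVal u = wordVal v) : Γ.Reads x v y := by
  obtain ⟨u', h1, h2, h3⟩ := exists_normalWord u
  rw [← normalWord_unique h1 hv (h2.trans h)]
  exact h3 V Γ hΓ x y hu

/-- Identifies the vertices with cosets of the loop group: by uniqueness of normal words, words of
equal value read from r end at the same vertex. -/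
theorem coset_loopGroup_eq_iff (hΓ : Γ.IsFolded) {x y : V} {u v : List Letter}
    (hu : Γ.Reads r u x) (hv : Γ.Reads r v y) :
    coset (loopGroup Γ r) (wordVal u) = coset (loopGroup Γ r) (wordVal v) ↔ x = y := by
  rw [coset_eq_iff]
  constructor
  · rintro ⟨w, h1, h2⟩
    obtain ⟨v', h3, h4, h5⟩ := exists_normalWord v
    have h6 : Γ.Reads r (w ++ u) x := ABGraph.reads_append.2 ⟨r, h2, hu⟩
    have h7 : wordVal (w ++ u) = wordVal v' := by
      rw [wordVal_append, h1, h4]; group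
    exact hΓ.reads_unique (hΓ.reads_of_wordVal_eq h6 h3 h7) (h5 V Γ hΓ r y hv)
  · rintro rfl
    exact ⟨v ++ wordInv u, by rw [wordVal_append, wordVal_wordInv],
      ABGraph.reads_append.2 ⟨x, hv, hu.symm⟩⟩

theorem mem_normalLoops_loopGroup_iff (hΓ : Γ.IsFolded) {w : List Letter} :
    w ∈ normalLoops (loopGroup Γ r) ↔ IsNormalWord w ∧ Γ.Reads r w r := by
  constructor
  · rintro ⟨h1, u, h2, h3⟩
    exact ⟨h1, hΓ.reads_of_wordVal_eq h3 h1 h2⟩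
  · rintro ⟨h1, h2⟩
    exact ⟨h1, w, rfl, h2⟩

instance : Finite Letter :=
  Finite.of_surjective (fun i : Fin 3 => ![Letter.a, Letter.b, Letter.bInv] i) (by
    rintro (_ | _ | _)
    · exact ⟨0, rfl⟩
    · exact ⟨1, rfl⟩
    · exact ⟨2, rfl⟩)

theorem loopGroup_fg [Finite V] (hconn : ∀ x, ∃ w, Γ.Reads r w x) : (loopGroup Γ r).FG := by
  choose p hp using hconn
  let f : V × Letter × V → PSL2Z := fun q =>
    wordVal (p q.1) * q.2.1.val * (wordVal (p q.2.2))⁻¹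
  -- Schreier generators, one per edge. The chosen path from r to itself need not be empty, so its
  -- value is adjoined.
  let S : Set PSL2Z := insert (wordVal (p r)) (f '' {q | Γ.Step q.1 q.2.1 q.2.2})
  rw [Subgroup.fg_iff]
  refine ⟨S, le_antisymm ?_ ?_, ((Set.toFinite _).image f).insert _⟩
  · rw [Subgroup.closure_le]
    rintro _ (rfl | ⟨⟨x, l, y⟩, hq, rfl⟩)
    · exact ⟨p r, rfl, hp r⟩
    · refine ⟨p x ++ [l] ++ wordInv (p y), ?_, ?_⟩
      · rw [wordVal_append, wordVal_append, wordVal_singleton, wordVal_wordInv]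
      · rw [ABGraph.reads_append]
        refine ⟨y, ABGraph.reads_append.2 ⟨x, hp x, ABGraph.reads_singleton.2 hq⟩, (hp y).symm⟩
  · have key : ∀ (w : List Letter) (x y : V), Γ.Reads x w y →
        wordVal (p x) * wordVal w * (wordVal (p y))⁻¹ ∈ Subgroup.closure S := by
      intro w
      induction w with
      | nil =>
        intro x y h
        obtain rfl : x = y := h
        rw [wordVal_nil, mul_one, mul_inv_cancel]
        exact one_mem _
      | cons l w ih =>
        rintro x y ⟨z, h1, h2⟩
        have h3 : f (x, l, z) ∈ Subgroup.closure S :=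
          Subgroup.subset_closure (Or.inr ⟨_, h1, rfl⟩)
        have h4 := mul_mem h3 (ih z y h2)
        have h5 : f (x, l, z) * (wordVal (p z) * wordVal w * (wordVal (p y))⁻¹) =
            wordVal (p x) * wordVal (l :: w) * (wordVal (p y))⁻¹ := by
          rw [wordVal_cons]; simp only [f]; group
        rwa [h5] at h4
    rintro _ ⟨w, rfl, hw⟩
    have h1 : wordVal (p r) ∈ Subgroup.closure S := Subgroup.subset_closure (Or.inl rfl)
    have h2 := mul_mem (mul_mem (inv_mem h1) (key w r r hw)) h1
    simpa [mul_assoc] using h2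

theorem IsConn.exists_subgroup [Finite V] {τ : Inv V} {R : BStr V} (h : IsConn τ R) (r : V) :
    ∃ (H : Subgroup PSL2Z) (e : visited H ≃ V), H.FG ∧ (stallings H).IsCyclicallyReduced ∧
      (⟨r, τ, R, False, False⟩ : LabeledGraph V).Represents H e := by
  have hΓ := graphOf_isFolded τ R
  let H := loopGroup (graphOf τ R) r
  choose p hp using h.exists_reads r
  let c : V → Coset H := fun v => coset H (wordVal (p v))
  have hc : ∀ {u : List Letter} {x : V}, (graphOf τ R).Reads r u x → coset H (wordVal u) = c x :=
    fun hu => (coset_loopGroup_eq_iff hΓ hu (hp _)).2 rfl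
  have hcinj : Function.Injective c := fun x y hxy =>
    (coset_loopGroup_eq_iff hΓ (hp x) (hp y)).1 hxy
  have htrav : ∀ x l y, Traverses H (c x) l (c y) ↔ (graphOf τ R).Step x l y := by
    intro x l y
    constructor
    · rintro ⟨w, hw, u, ⟨v, rfl⟩, h1, h2⟩
      obtain ⟨-, hr⟩ := (mem_normalLoops_loopGroup_iff hΓ).1 hw
      obtain ⟨y', h3, -⟩ := ABGraph.reads_append.1 hr
      rw [hc h3] at h2
      obtain ⟨x', h4, h5⟩ := ABGraph.reads_append.1 h3
      rw [hc h4] at h1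
      rw [hcinj h1, hcinj h2]
      exact ABGraph.reads_singleton.1 h5
    · intro hl
      obtain ⟨u, v, h1, h2, h3⟩ := h.exists_normal_loop r hl
      have h4 : (graphOf τ R).Reads r (u ++ [l]) y :=
        ABGraph.reads_append.2 ⟨x, h2, ABGraph.reads_singleton.2 hl⟩
      exact ⟨u ++ [l] ++ v, (mem_normalLoops_loopGroup_iff hΓ).2
        ⟨h1, ABGraph.reads_append.2 ⟨y, h4, h3⟩⟩, u, List.prefix_append _ _, (hc h2).symm,
        (hc h4).symm⟩
  have hstep : ∀ x l y, (stallings H).Step (c x) l (c y) ↔ (graphOf τ R).Step x l y :=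
    fun x l y => stallings_step_iff.trans (htrav x l y)
  have hvis : ∀ x, c x ∈ visited H := fun x =>
    ((htrav x Letter.a (τ.1 x)).2 rfl).mem.1
  have hsurj : ∀ y ∈ visited H, ∃ x, c x = y := by
    rintro _ ⟨w, hw, u, ⟨v, rfl⟩, rfl⟩
    obtain ⟨-, hr⟩ := (mem_normalLoops_loopGroup_iff hΓ).1 hw
    obtain ⟨x, h3, -⟩ := ABGraph.reads_append.1 hr
    exact ⟨x, (hc h3).symm⟩
  let e' : V ≃ visited H := Equiv.ofBijective (fun v => ⟨c v, hvis v⟩)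
    ⟨fun x y hxy => hcinj (congrArg Subtype.val hxy), fun ⟨y, hy⟩ => by
      obtain ⟨x, hx⟩ := hsurj y hy
      exact ⟨x, Subtype.ext hx⟩⟩
  have hboth : ∀ v ∈ (stallings H).verts, (stallings H).HasBothEdges v := by
    intro v hv
    obtain ⟨x, rfl⟩ := hsurj v hv
    refine ⟨⟨c (τ.1 x), (hstep x Letter.a _).2 rfl⟩, ?_⟩
    obtain ⟨y, hy⟩ := R.2.total x
    exact ⟨c y, hy.imp (hstep x Letter.b y).2 (hstep y Letter.b x).2⟩
  have hS := stallings_isFolded H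
  refine ⟨H, e'.symm, loopGroup_fg (fun x => ⟨p x, hp x⟩), ⟨fun v hv => ⟨hv, hS.a_fun, hS.b_fun,
    hS.b_inj, hS.b_triangle, fun w hw _ => hboth w hw⟩, hboth⟩, ?_, ?_, ?_⟩
  · rw [Equiv.symm_apply_eq]
    exact Subtype.ext (hc (u := []) rfl)
  · intro i j
    rw [Equiv.symm_symm]
    simp only [false_and, not_false_eq_true, and_true]
    exact hstep i Letter.a j
  · intro i j
    rw [Equiv.symm_symm]
    simp only [false_and, not_false_eq_true, and_true]
    exact hstep i Letter.b j

end GraphOf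

/-! ### Connected graphs of every size -/

/-- The graph is a path 0, 1, …, n-1 whose edges are alternately labeled `a` and `b`, with loops
supplying the missing letters at the two ends. -/
theorem exists_isConn (n : ℕ) (hn : 1 ≤ n) :
    ∃ (τ : Inv (Fin n)) (R : BStr (Fin n)), IsConn τ R := by
  let t : Fin n → Fin n := fun i =>
    if i.1 % 2 = 1 then ⟨i.1 - 1, by omega⟩ else if h : i.1 + 1 < n then ⟨i.1 + 1, h⟩ else i
  let R : Fin n → Fin n → Prop := fun i j =>
    (i.1 % 2 = 1 ∧ j.1 = i.1 + 1) ∨ (i.1 = 0 ∧ j.1 = 0) ∨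
      (i.1 % 2 = 1 ∧ i.1 + 1 = n ∧ j.1 = i.1)
  have ht : Function.Involutive t := by
    intro i
    have := i.2
    ext
    simp only [t]
    split_ifs <;> simp only [] at * <;> omega
  have hR : IsBStructure R := by
    refine ⟨?_, ?_, ?_, ?_⟩
    · intro x y z h1 h2; ext; simp only [R] at h1 h2; omega
    · intro x y z h1 h2; ext; simp only [R] at h1 h2; omega
    · intro x y z h1 h2; simp only [R] at h1 h2 ⊢; omega
    · intro v
      by_cases h0 : v.1 = 0
      · exact ⟨v, by simp only [R]; omega⟩
      · by_cases h1 : v.1 % 2 = 1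
        · by_cases h2 : v.1 + 1 < n
          · exact ⟨⟨v.1 + 1, h2⟩, Or.inl (Or.inl ⟨h1, rfl⟩)⟩
          · exact ⟨v, Or.inl (Or.inr (Or.inr ⟨h1, by omega, rfl⟩))⟩
        · obtain ⟨k, hk⟩ := Nat.exists_eq_succ_of_ne_zero h0
          exact ⟨⟨k, by omega⟩, Or.inr (Or.inl ⟨show k % 2 = 1 by omega, hk⟩)⟩
  refine ⟨⟨t, ht⟩, ⟨R, hR⟩, ?_⟩
  rintro A ⟨x, hx⟩ ⟨hA1, hA2⟩
  have hstep : ∀ (i : ℕ) (h : i + 1 < n), (⟨i, by omega⟩ : Fin n) ∈ A ↔ ⟨i + 1, h⟩ ∈ A := by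
    intro i h
    by_cases hi : i % 2 = 1
    · exact hA2 _ _ (Or.inl ⟨hi, rfl⟩)
    · have e1 : t ⟨i, by omega⟩ = ⟨i + 1, h⟩ := by simp [t, hi, h]
      constructor
      · intro h1
        rw [← e1]
        exact hA1 _ h1
      · intro h1
        rw [← ht ⟨i, by omega⟩, e1]
        exact hA1 _ h1
  have h0 : ∀ (i : ℕ) (h : i < n), (⟨i, h⟩ : Fin n) ∈ A ↔ (⟨0, hn⟩ : Fin n) ∈ A := by
    intro i
    induction i with
    | zero => exact fun h => Iff.rfl
    | succ i ih => exact fun h => (hstep i h).symm.trans (ih _)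
  ext y
  simp only [Set.mem_univ, iff_true]
  exact (h0 y.1 y.2).2 ((h0 x.1 x.2).1 hx)

/-! ### Counting involutions and `b`-structures -/

noncomputable instance {V : Type*} [Finite V] : Fintype (Inv V) := Fintype.ofFinite _

noncomputable instance {V : Type*} [Finite V] : Fintype (BStr V) := Fintype.ofFinite _

/-- The number of involutions of a set with `n` elements. -/
noncomputable def numInv (n : ℕ) : ℕ := Fintype.card (Inv (Fin n))

/-- The number of `b`-structures on a set with `n` elements. -/
noncomputable def numB (n : ℕ) : ℕ := Fintype.card (BStr (Fin n))

/-- Transport of involutions. -/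
def invCongr {V W : Type*} (e : V ≃ W) : Inv V ≃ Inv W where
  toFun τ := ⟨fun w => e (τ.1 (e.symm w)), fun w => by simp [τ.2 _]⟩
  invFun τ := ⟨fun w => e.symm (τ.1 (e w)), fun w => by simp [τ.2 _]⟩
  left_inv τ := by ext; simp
  right_inv τ := by ext; simp

/-- The pullback of a `b`-structure along a bijection. -/
theorem IsBStructure.comap {V W : Type*} {R : W → W → Prop} (h : IsBStructure R) (e : V ≃ W) :
    IsBStructure (fun x y => R (e x) (e y)) where
  fun_ h1 h2 := e.injective (h.fun_ h1 h2)
  inj h1 h2 := e.injective (h.inj h1 h2)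
  triangle h1 h2 := h.triangle h1 h2
  total v := by
    obtain ⟨y, hy⟩ := h.total (e v)
    exact ⟨e.symm y, by simpa using hy⟩

/-- Transport of `b`-structures. -/
def bStrCongr {V W : Type*} (e : V ≃ W) : BStr V ≃ BStr W where
  toFun R := ⟨_, R.2.comap e.symm⟩
  invFun R := ⟨_, R.2.comap e⟩
  left_inv R := by ext; simp
  right_inv R := by ext; simp

section Fintype

variable {V : Type*} [Fintype V]

theorem card_inv : Fintype.card (Inv V) = numInv (Fintype.card V) :=
  Fintype.card_congr (invCongr (Fintype.equivFin V))

theorem card_bStr : Fintype.card (BStr V) = numB (Fintype.card V) :=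
  Fintype.card_congr (bStrCongr (Fintype.equivFin V))

end Fintype

theorem isBStructure_eq (V : Type*) : IsBStructure (fun x y : V => x = y) where
  fun_ h1 h2 := h1.symm.trans h2
  inj h1 h2 := h1.trans h2.symm
  triangle h1 h2 := (h1.trans h2).symm
  total v := ⟨v, Or.inl rfl⟩

theorem numB_pos (n : ℕ) : 0 < numB n :=
  Fintype.card_pos_iff.2 ⟨⟨_, isBStructure_eq _⟩⟩

theorem numInv_pos (n : ℕ) : 0 < numInv n :=
  Fintype.card_pos_iff.2 ⟨⟨id, fun _ => rfl⟩⟩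

/-! ### `b`-structures with prescribed components -/

section Extends

variable {V : Type*}

/-- `R` restricted to the edges that touch `A` is `R₀`. -/
def ExtendsOn (A : Finset V) (R₀ R : V → V → Prop) : Prop :=
  ∀ v ∈ A, ∀ w, (R v w ↔ R₀ v w) ∧ (R w v ↔ R₀ w v)

/-- `R₀` is a `b`-structure on `A`. -/
structure IsBStructureOn (A : Finset V) (R₀ : V → V → Prop) : Prop where
  mem : ∀ {x y}, R₀ x y → x ∈ A ∧ y ∈ A
  fun_ : ∀ {x y z}, R₀ x y → R₀ x z → y = z
  inj : ∀ {x y z}, R₀ x z → R₀ y z → x = y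
  triangle : ∀ {x y z}, R₀ x y → R₀ y z → R₀ z x
  total : ∀ v ∈ A, ∃ y, R₀ v y ∨ R₀ y v

/-- The `b`-structures that extend a given one correspond to those on the complement. -/
def extendsOnEquiv {A : Finset V} {R₀ : V → V → Prop} (h₀ : IsBStructureOn A R₀) :
    {R : BStr V // ExtendsOn A R₀ R.1} ≃ BStr {v // v ∉ A} where
  toFun R := ⟨fun x y => R.1.1 x y, by
    refine ⟨fun h1 h2 => Subtype.ext (R.1.2.fun_ h1 h2),
      fun h1 h2 => Subtype.ext (R.1.2.inj h1 h2), fun h1 h2 => R.1.2.triangle h1 h2, ?_⟩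
    rintro ⟨v, hv⟩
    obtain ⟨y, hy⟩ := R.1.2.total v
    refine ⟨⟨y, fun hyA => hv ?_⟩, hy⟩
    rcases hy with hy | hy
    · exact (h₀.mem ((R.2 y hyA v).2.1 hy)).1
    · exact (h₀.mem ((R.2 y hyA v).1.1 hy)).2⟩
  invFun R := ⟨⟨fun x y => R₀ x y ∨ ∃ hx hy, R.1 ⟨x, hx⟩ ⟨y, hy⟩, by
    refine ⟨?_, ?_, ?_, ?_⟩
    · rintro x y z (h1 | ⟨hx, hy, h1⟩) (h2 | ⟨hx', hz, h2⟩)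
      · exact h₀.fun_ h1 h2
      · exact absurd (h₀.mem h1).1 hx'
      · exact absurd (h₀.mem h2).1 hx
      · exact congrArg Subtype.val (R.2.fun_ h1 h2)
    · rintro x y z (h1 | ⟨hx, hy, h1⟩) (h2 | ⟨hx', hz, h2⟩)
      · exact h₀.inj h1 h2
      · exact absurd (h₀.mem h1).2 hz
      · exact absurd (h₀.mem h2).2 hy
      · exact congrArg Subtype.val (R.2.inj h1 h2)
    · rintro x y z (h1 | ⟨hx, hy, h1⟩) (h2 | ⟨hx', hz, h2⟩)
      · exact Or.inl (h₀.triangle h1 h2)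
      · exact absurd (h₀.mem h1).2 hx'
      · exact absurd (h₀.mem h2).1 hy
      · exact Or.inr ⟨hz, hx, R.2.triangle h1 h2⟩
    · intro v
      by_cases hv : v ∈ A
      · exact (h₀.total v hv).imp fun y => Or.imp Or.inl Or.inl
      · obtain ⟨y, hy⟩ := R.2.total ⟨v, hv⟩
        exact ⟨y, hy.imp (fun h => Or.inr ⟨hv, y.2, h⟩) (fun h => Or.inr ⟨y.2, hv, h⟩)⟩⟩, by
    intro v hv w
    constructor
    · exact ⟨fun h => h.resolve_right fun ⟨h1, _⟩ => h1 hv, Or.inl⟩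
    · exact ⟨fun h => h.resolve_right fun ⟨_, h1, _⟩ => h1 hv, Or.inl⟩⟩
  left_inv R := by
    ext x y
    change (R₀ x y ∨ ∃ _ : x ∉ A, ∃ _ : y ∉ A, R.1.1 x y) ↔ R.1.1 x y
    constructor
    · rintro (h | ⟨-, -, h⟩)
      · exact (R.2 x (h₀.mem h).1 y).1.2 h
      · exact h
    · intro h
      by_cases hx : x ∈ A
      · exact Or.inl ((R.2 x hx y).1.1 h)
      by_cases hy : y ∈ A
      · exact Or.inl ((R.2 y hy x).2.1 h)
      exact Or.inr ⟨hx, hy, h⟩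
  right_inv R := by
    ext x y
    change (R₀ x y ∨ ∃ _ : x.1 ∉ A, ∃ _ : y.1 ∉ A, R.1 x y) ↔ R.1 x y
    constructor
    · rintro (h | ⟨-, -, h⟩)
      · exact absurd (h₀.mem h).1 x.2
      · exact h
    · intro h
      exact Or.inr ⟨x.2, y.2, h⟩

theorem isBStructureOn_loops (A : Finset V) :
    IsBStructureOn A (fun x y => x ∈ A ∧ x = y) where
  mem := by rintro x _ ⟨h, rfl⟩; exact ⟨h, h⟩
  fun_ h1 h2 := h1.2.symm.trans h2.2
  inj h1 h2 := h1.2.trans h2.2.symm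
  triangle := by rintro x _ _ ⟨h, rfl⟩ ⟨-, rfl⟩; exact ⟨h, rfl⟩
  total v hv := ⟨v, Or.inl ⟨hv, rfl⟩⟩

theorem IsBStructure.extendsOn_loops_iff {R : V → V → Prop} (h : IsBStructure R) (A : Finset V) :
    ExtendsOn A (fun x y => x ∈ A ∧ x = y) R ↔ ∀ x ∈ A, R x x := by
  constructor
  · exact fun h1 x hx => (h1 x hx x).1.2 ⟨hx, rfl⟩
  · intro h1 x hx w
    constructor
    · exact ⟨fun h2 => ⟨hx, h.fun_ (h1 x hx) h2⟩, by rintro ⟨-, rfl⟩; exact h1 x hx⟩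
    · exact ⟨fun h2 => by rw [h.inj h2 (h1 x hx)]; exact ⟨hx, rfl⟩,
        by rintro ⟨-, rfl⟩; exact h1 w hx⟩

variable [DecidableEq V]

theorem isBStructureOn_edge {u v : V} (huv : u ≠ v) :
    IsBStructureOn {u, v} (fun x y => x = u ∧ y = v) where
  mem := by rintro x y ⟨rfl, rfl⟩; simp
  fun_ h1 h2 := h1.2.trans h2.2.symm
  inj h1 h2 := h1.1.trans h2.1.symm
  triangle h1 h2 := absurd (h2.1.symm.trans h1.2) huv
  total x hx := by
    rw [Finset.mem_insert, Finset.mem_singleton] at hx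
    rcases hx with rfl | rfl
    · exact ⟨v, Or.inl ⟨rfl, rfl⟩⟩
    · exact ⟨u, Or.inr ⟨rfl, rfl⟩⟩

/-- An edge into `u` would, by the triangle condition, force an edge out of `v`; so the edge forms a
component by itself. -/
theorem IsBStructure.extendsOn_edge {R : V → V → Prop} (h : IsBStructure R) {u v : V}
    (huv : R u v) (hv : ∀ y, ¬ R v y) :
    ExtendsOn {u, v} (fun x y => x = u ∧ y = v) R := by
  have hu : ∀ y, ¬ R y u := fun y hy => hv _ (h.triangle hy huv)
  have hne : u ≠ v := by rintro rfl; exact hv _ huv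
  intro x hx w
  rw [Finset.mem_insert, Finset.mem_singleton] at hx
  rcases hx with rfl | rfl
  · refine ⟨⟨fun h1 => ⟨rfl, h.fun_ h1 huv⟩, ?_⟩, ⟨fun h1 => absurd h1 (hu _), ?_⟩⟩
    · rintro ⟨-, rfl⟩; exact huv
    · rintro ⟨-, rfl⟩; exact absurd rfl hne
  · refine ⟨⟨fun h1 => absurd h1 (hv _), ?_⟩, ⟨fun h1 => ⟨h.inj h1 huv, rfl⟩, ?_⟩⟩
    · rintro ⟨rfl, -⟩; exact absurd rfl hne
    · rintro ⟨rfl, -⟩; exact huv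

theorem isBStructureOn_triangle {x y z : V} (hxy : x ≠ y) (hyz : y ≠ z) (hzx : z ≠ x) :
    IsBStructureOn {x, y, z}
      (fun u v => (u = x ∧ v = y) ∨ (u = y ∧ v = z) ∨ (u = z ∧ v = x)) where
  mem := by rintro u v (⟨rfl, rfl⟩ | ⟨rfl, rfl⟩ | ⟨rfl, rfl⟩) <;> simp
  fun_ := by grind
  inj := by grind
  triangle := by grind
  total u hu := by
    simp only [Finset.mem_insert, Finset.mem_singleton] at hu
    rcases hu with rfl | rfl | rfl
    · exact ⟨y, by simp⟩
    · exact ⟨z, by simp⟩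
    · exact ⟨x, by simp⟩

theorem IsBStructure.extendsOn_triangle_iff {R : V → V → Prop} (h : IsBStructure R) {x y z : V} :
    ExtendsOn {x, y, z} (fun u v => (u = x ∧ v = y) ∨ (u = y ∧ v = z) ∨ (u = z ∧ v = x)) R ↔
      R x y ∧ R y z := by
  constructor
  · intro h1
    exact ⟨(h1 x (by simp) y).1.2 (by simp), (h1 y (by simp) z).1.2 (by simp)⟩
  · rintro ⟨h1, h2⟩ u hu w
    have h3 := h.triangle h1 h2
    simp only [Finset.mem_insert, Finset.mem_singleton] at hu
    have f1 := fun w (hw : R x w) => h.fun_ hw h1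
    have f2 := fun w (hw : R y w) => h.fun_ hw h2
    have f3 := fun w (hw : R z w) => h.fun_ hw h3
    have i1 := fun w (hw : R w y) => h.inj hw h1
    have i2 := fun w (hw : R w z) => h.inj hw h2
    have i3 := fun w (hw : R w x) => h.inj hw h3
    rcases hu with rfl | rfl | rfl <;> constructor <;> constructor <;> grind

variable [Fintype V]

theorem card_filter_extendsOn {A : Finset V} {R₀ : V → V → Prop} (h₀ : IsBStructureOn A R₀)
    [DecidablePred fun R : BStr V => ExtendsOn A R₀ R.1] :
    (Finset.univ.filter fun R : BStr V => ExtendsOn A R₀ R.1).card =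
      numB (Fintype.card V - A.card) := by
  rw [← Fintype.card_subtype, Fintype.card_congr (extendsOnEquiv h₀), card_bStr]
  congr 1
  rw [Fintype.card_subtype_compl, Fintype.card_coe]

theorem card_filter_loops (A : Finset V) [DecidablePred fun R : BStr V => ∀ x ∈ A, R.1 x x] :
    (Finset.univ.filter fun R : BStr V => ∀ x ∈ A, R.1 x x).card =
      numB (Fintype.card V - A.card) := by
  classical
  rw [← card_filter_extendsOn (isBStructureOn_loops A)]
  congr 1
  ext R
  simp only [Finset.mem_filter, R.2.extendsOn_loops_iff]

theorem card_filter_edge_le {u v : V} (huv : u ≠ v)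
    [DecidablePred fun R : BStr V => R.1 u v ∧ ∀ y, ¬ R.1 v y] :
    (Finset.univ.filter fun R : BStr V => R.1 u v ∧ ∀ y, ¬ R.1 v y).card ≤
      numB (Fintype.card V - 2) := by
  classical
  have h := card_filter_extendsOn (isBStructureOn_edge huv)
  rw [Finset.card_pair huv] at h
  rw [← h]
  refine Finset.card_le_card fun R hR => ?_
  simp only [Finset.mem_filter, Finset.mem_univ, true_and] at hR ⊢
  exact R.2.extendsOn_edge hR.1 hR.2

theorem card_filter_triangle {x y z : V} (hxy : x ≠ y) (hyz : y ≠ z) (hzx : z ≠ x)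
    [DecidablePred fun R : BStr V => R.1 x y ∧ R.1 y z] :
    (Finset.univ.filter fun R : BStr V => R.1 x y ∧ R.1 y z).card =
      numB (Fintype.card V - 3) := by
  classical
  have h := card_filter_extendsOn (isBStructureOn_triangle hxy hyz hzx)
  rw [Finset.card_eq_three.2 ⟨x, y, z, hxy, hzx.symm, hyz, rfl⟩] at h
  rw [← h]
  congr 1
  ext R
  simp only [Finset.mem_filter, R.2.extendsOn_triangle_iff]

end Extends

/-! ### Recursive bounds for the number of `b`-structures -/

open Classical in
theorem numB_triangle_le (n : ℕ) : (n + 1) * n * numB (n - 1) ≤ numB (n + 2) := by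
  -- Only the structures with 0 in a triangle 0 → p.1 → p.2 are counted; these families are
  -- disjoint. The truncated n - 1 stands for (n + 2) - 3, and for n = 0 the factor n vanishes.
  let P : Finset (Fin (n + 2) × Fin (n + 2)) := (Finset.univ.erase 0).offDiag
  have hP : P.card = (n + 1) * n := by
    simp [P, Finset.offDiag_card, Nat.mul_succ]
  have hmem : ∀ p ∈ P, (0 : Fin (n + 2)) ≠ p.1 ∧ p.1 ≠ p.2 ∧ p.2 ≠ 0 := by
    intro p hp
    simp only [P, Finset.mem_offDiag, Finset.mem_erase, Finset.mem_univ, and_true] at hp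
    exact ⟨hp.1.symm, hp.2.2, hp.2.1⟩
  have hcard : (P.biUnion fun p =>
      Finset.univ.filter fun R : BStr (Fin (n + 2)) => R.1 0 p.1 ∧ R.1 p.1 p.2).card =
      (n + 1) * n * numB (n - 1) := by
    rw [Finset.card_biUnion]
    · rw [Finset.sum_congr rfl fun p hp =>
        card_filter_triangle (hmem p hp).1 (hmem p hp).2.1 (hmem p hp).2.2]
      rw [Finset.sum_const, hP, Fintype.card_fin, smul_eq_mul]
      rfl
    · intro p _ q _ hpq
      rw [Function.onFun, Finset.disjoint_left]
      intro R hR hR'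
      simp only [Finset.mem_filter, Finset.mem_univ, true_and] at hR hR'
      have h1 := R.2.fun_ hR.1 hR'.1
      have h2 := hR'.2
      rw [← h1] at h2
      exact hpq (Prod.ext h1 (R.2.fun_ hR.2 h2))
  rw [← hcard]
  exact Finset.card_le_univ _

-- The vertex 0 carries a loop, starts or ends an isolated edge, or lies in a triangle; deleting its
-- component leaves a smaller structure.
open Classical in
theorem numB_le (n : ℕ) : numB (n + 2) ≤
    numB (n + 1) + 2 * (n + 1) * numB n + (n + 1) * n * numB (n - 1) := by
  let P : Finset (Fin (n + 2) × Fin (n + 2)) := (Finset.univ.erase 0).offDiag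
  have hP : P.card = (n + 1) * n := by
    simp [P, Finset.offDiag_card, Nat.mul_succ]
  let Q : Finset (Fin (n + 2)) := Finset.univ.erase 0
  have hQ : Q.card = n + 1 := by simp [Q]
  let S1 := Finset.univ.filter fun R : BStr (Fin (n + 2)) => ∀ x ∈ ({0} : Finset (Fin (n + 2))),
    R.1 x x
  let S2 := Q.biUnion fun v => Finset.univ.filter fun R : BStr (Fin (n + 2)) =>
    R.1 0 v ∧ ∀ y, ¬ R.1 v y
  let S3 := Q.biUnion fun v => Finset.univ.filter fun R : BStr (Fin (n + 2)) =>
    R.1 v 0 ∧ ∀ y, ¬ R.1 0 y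
  let S4 := P.biUnion fun p =>
    Finset.univ.filter fun R : BStr (Fin (n + 2)) => R.1 0 p.1 ∧ R.1 p.1 p.2
  have h1 : S1.card = numB (n + 1) := by
    simp only [S1]; rw [card_filter_loops]; simp
  have h2 : S2.card ≤ (n + 1) * numB n := by
    refine Finset.card_biUnion_le.trans ?_
    rw [← hQ, ← smul_eq_mul]
    refine Finset.sum_le_card_nsmul _ _ _ fun v hv => ?_
    have := card_filter_edge_le (u := 0) (v := v) (Finset.ne_of_mem_erase hv).symm
    rwa [Fintype.card_fin] at this
  have h3 : S3.card ≤ (n + 1) * numB n := by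
    refine Finset.card_biUnion_le.trans ?_
    rw [← hQ, ← smul_eq_mul]
    refine Finset.sum_le_card_nsmul _ _ _ fun v hv => ?_
    have := card_filter_edge_le (u := v) (v := 0) (Finset.ne_of_mem_erase hv)
    rwa [Fintype.card_fin] at this
  have h4 : S4.card ≤ (n + 1) * n * numB (n - 1) := by
    refine Finset.card_biUnion_le.trans ?_
    rw [← hP, ← smul_eq_mul]
    refine Finset.sum_le_card_nsmul _ _ _ fun p hp => ?_
    simp only [P, Finset.mem_offDiag, Finset.mem_erase, Finset.mem_univ, and_true] at hp
    rw [card_filter_triangle (Ne.symm hp.1) hp.2.2 hp.2.1, Fintype.card_fin]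
    rfl
  have hcover : (Finset.univ : Finset (BStr (Fin (n + 2)))) ⊆ S1 ∪ S2 ∪ S3 ∪ S4 := by
    intro R _
    simp only [S1, S2, S3, S4, P, Q, Finset.mem_union, Finset.mem_filter, Finset.mem_univ,
      true_and, Finset.mem_biUnion, Finset.mem_singleton, forall_eq, Finset.mem_erase, and_true,
      Finset.mem_offDiag, Prod.exists]
    by_cases h0 : R.1 0 0
    · exact Or.inl (Or.inl (Or.inl h0))
    by_cases hout : ∃ v, R.1 0 v
    · obtain ⟨v, hv⟩ := hout
      have hv0 : v ≠ 0 := by rintro rfl; exact h0 hv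
      by_cases hz : ∃ z, R.1 v z
      · obtain ⟨z, hz⟩ := hz
        have h5 := R.2.triangle hv hz
        refine Or.inr ⟨v, z, ⟨hv0, ?_, ?_⟩, hv, hz⟩
        · rintro rfl; exact h0 h5
        · rintro rfl; exact hv0 (R.2.inj hz hv)
      · exact Or.inl (Or.inl (Or.inr ⟨v, hv0, hv, not_exists.1 hz⟩))
    · obtain ⟨v, hv⟩ := R.2.total 0
      have hv' := hv.resolve_left fun h => hout ⟨v, h⟩
      refine Or.inl (Or.inr ⟨v, ?_, hv', not_exists.1 hout⟩)
      rintro rfl; exact h0 hv'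
  have h5 := Finset.card_le_card hcover
  rw [Finset.card_univ] at h5
  have h6 := Finset.card_union_le (S1 ∪ S2 ∪ S3) S4
  have h7 := Finset.card_union_le (S1 ∪ S2) S3
  have h8 := Finset.card_union_le S1 S2
  change numB (n + 2) ≤ _ at h5
  nlinarith

open Classical in
/-- The number of `b`-loops. -/
noncomputable def numLoops {n : ℕ} (R : BStr (Fin n)) : ℕ :=
  (Finset.univ.filter fun x => R.1 x x).card

open Classical in
/-- The number of vertices without outgoing `b`-edge. -/
noncomputable def numEnds {n : ℕ} (R : BStr (Fin n)) : ℕ :=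
  (Finset.univ.filter fun x => ∀ y, ¬ R.1 x y).card

-- Double counting of pairs formed by a structure and an injective choice of j of its loops:
-- removing the chosen loops leaves a structure on n - j points.
open Classical in
theorem sum_descFactorial_numLoops (n j : ℕ) :
    ∑ R : BStr (Fin n), (numLoops R).descFactorial j = n.descFactorial j * numB (n - j) := by
  have h1 : ∀ R : BStr (Fin n), (numLoops R).descFactorial j =
      (Finset.univ.filter fun f : Fin j ↪ Fin n => ∀ i, R.1 (f i) (f i)).card := by
    intro R
    have e : (Fin j ↪ {x // R.1 x x}) ≃ {f : Fin j ↪ Fin n // ∀ i, R.1 (f i) (f i)} :=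
      { toFun := fun f => ⟨f.trans (Function.Embedding.subtype _), fun i => (f i).2⟩
        invFun := fun f => ⟨fun i => ⟨f.1 i, f.2 i⟩, fun i j h =>
          f.1.injective (congrArg Subtype.val h)⟩
        left_inv := fun f => by ext; rfl
        right_inv := fun f => by ext; rfl }
    rw [← Fintype.card_subtype, ← Fintype.card_congr e, Fintype.card_embedding_eq,
      Fintype.card_fin, Fintype.card_subtype]
    rfl
  simp_rw [h1, Finset.card_filter]
  rw [Finset.sum_comm]
  have h2 : ∀ f : Fin j ↪ Fin n,
      ∑ R : BStr (Fin n), (if ∀ i, R.1 (f i) (f i) then 1 else 0) = numB (n - j) := by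
    intro f
    have := card_filter_loops (V := Fin n) (Finset.univ.map f)
    rw [Finset.card_map, Finset.card_univ, Fintype.card_fin, Fintype.card_fin] at this
    rw [← this, Finset.card_filter]
    simp
  rw [Finset.sum_congr rfl fun f _ => h2 f, Finset.sum_const, Finset.card_univ,
    Fintype.card_embedding_eq, Fintype.card_fin, Fintype.card_fin, smul_eq_mul]

-- A vertex without outgoing edge ends an isolated edge, and a given ordered pair is an isolated
-- edge in at most `numB (n - 2)` structures.
open Classical in
theorem sum_numEnds_le (n : ℕ) :
    ∑ R : BStr (Fin n), numEnds R ≤ n.descFactorial 2 * numB (n - 2) := by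
  have h1 : ∀ R : BStr (Fin n), numEnds R ≤ ((Finset.univ : Finset (Fin n)).offDiag.filter
      fun p => R.1 p.1 p.2 ∧ ∀ y, ¬ R.1 p.2 y).card := by
    intro R
    refine Finset.card_le_card_of_surjOn Prod.snd ?_
    intro v hv
    simp only [Finset.coe_filter, Finset.mem_univ, true_and, Set.mem_ofPred_eq] at hv
    obtain ⟨u, hu⟩ := R.2.total v
    have hu' := hu.resolve_left (hv u)
    refine ⟨(u, v), ?_, rfl⟩
    simp only [Finset.coe_filter, Finset.mem_offDiag, Finset.mem_univ, true_and, Set.mem_ofPred_eq]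
    exact ⟨by rintro rfl; exact hv _ hu', hu', hv⟩
  refine (Finset.sum_le_sum fun R _ => h1 R).trans ?_
  simp_rw [Finset.card_filter]
  rw [Finset.sum_comm]
  have h2 : ∀ p ∈ (Finset.univ : Finset (Fin n)).offDiag,
      ∑ R : BStr (Fin n), (if R.1 p.1 p.2 ∧ ∀ y, ¬ R.1 p.2 y then 1 else 0) ≤ numB (n - 2) := by
    intro p hp
    have := card_filter_edge_le (V := Fin n) (Finset.mem_offDiag.1 hp).2.2
    rwa [Fintype.card_fin, Finset.card_filter] at this
  refine (Finset.sum_le_card_nsmul _ _ _ h2).trans (le_of_eq ?_)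
  rw [Finset.offDiag_card, Finset.card_univ, Fintype.card_fin, smul_eq_mul]
  congr 1
  cases n with
  | zero => rfl
  | succ n => simp [Nat.descFactorial, Nat.mul_succ, Nat.succ_mul]

/-! ### Involutions -/

/-- Restriction of an involution to a stable set. -/
def Inv.restrict {V : Type*} (τ : Inv V) (p : V → Prop) (h : ∀ v, p v → p (τ.1 v)) :
    Inv {v // p v} :=
  ⟨fun v => ⟨τ.1 v, h v v.2⟩, fun v => Subtype.ext (τ.2 v)⟩

/-- Restriction of a `b`-structure to a union of components. -/
def BStr.restrict {V : Type*} (R : BStr V) (p : V → Prop) (h : ∀ v w, R.1 v w → (p v ↔ p w)) :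
    BStr {v // p v} :=
  ⟨fun v w => R.1 v w, by
    refine ⟨fun h1 h2 => Subtype.ext (R.2.fun_ h1 h2), fun h1 h2 => Subtype.ext (R.2.inj h1 h2),
      fun h1 h2 => R.2.triangle h1 h2, ?_⟩
    rintro ⟨v, hv⟩
    obtain ⟨y, hy | hy⟩ := R.2.total v
    · exact ⟨⟨y, (h _ _ hy).1 hv⟩, Or.inl hy⟩
    · exact ⟨⟨y, (h _ _ hy).2 hv⟩, Or.inr hy⟩⟩

theorem Inv.ne_of_fixed {V : Type*} {τ : Inv V} {x : V} (h : τ.1 x = x) (v : V) (hv : v ≠ x) :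
    τ.1 v ≠ x := fun h1 => hv (by rw [← τ.2 v, h1, h])

/-! ### Removing points from an acyclic pair of an involution and a partial injection -/

section Contraction

variable {V : Type*}

/-- Following the involution and then the relation never closes a cycle. -/
def NoCycle (b : V → V → Prop) (τ : Inv V) : Prop :=
  ∀ v, ¬ Relation.TransGen (fun v w => b (τ.1 v) w) v v

/-- The relation is a partial injection. -/
def IsPartialInj (b : V → V → Prop) : Prop :=
  (∀ x y z, b x y → b x z → y = z) ∧ ∀ x y z, b x z → b y z → x = y

/-- The partial injection obtained by bypassing a point. -/
def contract (b : V → V → Prop) (x : V) : {v // v ≠ x} → {v // v ≠ x} → Prop :=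
  fun v w => b v w ∨ (b v x ∧ b x w)

theorem IsPartialInj.contract {b : V → V → Prop} (h : IsPartialInj b) (x : V) :
    IsPartialInj (contract b x) := by
  constructor
  · rintro u v w (h1 | ⟨h1, h2⟩) (h3 | ⟨h3, h4⟩)
    · exact Subtype.ext (h.1 _ _ _ h1 h3)
    · exact absurd (h.1 _ _ _ h1 h3) v.2
    · exact absurd (h.1 _ _ _ h3 h1) w.2
    · exact Subtype.ext (h.1 _ _ _ h2 h4)
  · rintro u v w (h1 | ⟨h1, h2⟩) (h3 | ⟨h3, h4⟩)
    · exact Subtype.ext (h.2 _ _ _ h1 h3)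
    · exact absurd (h.2 _ _ _ h1 h4) u.2
    · exact absurd (h.2 _ _ _ h3 h2) v.2
    · exact Subtype.ext (h.2 _ _ _ h1 h3)

/-- The number of points where the relation is undefined. -/
noncomputable def numUndef (b : V → V → Prop) : ℕ := Nat.card {v // ∀ w, ¬ b v w}

theorem numUndef_contract_le [Finite V] {b : V → V → Prop} (h : IsPartialInj b) (x : V) :
    numUndef (contract b x) ≤ numUndef b := by
  classical
  -- A point becomes newly undefined only if it pointed at x and x was undefined. By injectivity
  -- there is at most one such point, and it takes the place of x.
  have hdef : ∀ v : {v : {v // v ≠ x} // ∀ w, ¬ contract b x v w},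
      (¬ ∀ w, ¬ b v.1.1 w) → b v.1.1 x ∧ ∀ w, ¬ b x w := by
    rintro ⟨⟨v, hv⟩, hv'⟩ h1
    rw [not_forall] at h1
    obtain ⟨w, hw⟩ := h1
    rw [not_not] at hw
    have hwx : w = x := by
      by_contra hne
      exact hv' ⟨w, hne⟩ (Or.inl hw)
    subst hwx
    refine ⟨hw, fun w' hw' => ?_⟩
    by_cases hne : w' = w
    · subst hne; exact hv (h.2 _ _ _ hw hw')
    · exact hv' ⟨w', hne⟩ (Or.inr ⟨hw, hw'⟩)
  let f : {v : {v // v ≠ x} // ∀ w, ¬ contract b x v w} → {v // ∀ w, ¬ b v w} := fun v =>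
    if h1 : ∀ w, ¬ b v.1.1 w then ⟨v.1.1, h1⟩ else ⟨x, (hdef v h1).2⟩
  refine Nat.card_le_card_of_injective f ?_
  intro u v huv
  simp only [f] at huv
  split_ifs at huv with h1 h2 h2
  · exact Subtype.ext (Subtype.ext (Subtype.mk.inj huv))
  · exact absurd (Subtype.mk.inj huv) u.1.2
  · exact absurd (Subtype.mk.inj huv).symm v.1.2
  · exact Subtype.ext (Subtype.ext (h.2 _ _ _ (hdef u h1).1 (hdef v h2).1))

theorem NoCycle.restrict {b : V → V → Prop} {τ : Inv V} (h : NoCycle b τ) {x : V}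
    (hx : τ.1 x = x) :
    NoCycle (contract b x) (τ.restrict (fun v => v ≠ x) (Inv.ne_of_fixed hx)) := by
  intro v hv
  refine h v ?_
  refine Relation.TransGen.lift' (fun v : {v // v ≠ x} => (v : V)) ?_ _ _ hv
  rintro u w (h1 | ⟨h1, h2⟩)
  · exact Relation.TransGen.single h1
  · have h3 : Relation.TransGen (fun v w => b (τ.1 v) w) u x := Relation.TransGen.single h1
    exact h3.tail (show b (τ.1 x) w by rwa [hx])

theorem Inv.restrict_injective {x : V} {τ τ' : Inv V} (h : τ.1 x = x) (h' : τ'.1 x = x)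
    (heq : τ.restrict (fun v => v ≠ x) (Inv.ne_of_fixed h) =
      τ'.restrict (fun v => v ≠ x) (Inv.ne_of_fixed h')) : τ = τ' := by
  ext v
  by_cases hv : v = x
  · rw [hv, h, h']
  · exact congrArg Subtype.val (congrFun (congrArg Subtype.val heq) ⟨v, hv⟩)

/-- A step through x in the contraction is two steps of the original, as τ fixes x, so acyclicity
passes to the restriction. The predicates `P`, `Q` carry a second fixed point along. -/
theorem card_noCycle_fixed_le [Finite V] (b : V → V → Prop) (x : V) (P : Inv V → Prop)
    (Q : Inv {v // v ≠ x} → Prop)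
    (hPQ : ∀ τ h, P τ → Q (τ.restrict (fun v => v ≠ x) (Inv.ne_of_fixed (x := x) h))) :
    Nat.card {τ : Inv V // τ.1 x = x ∧ NoCycle b τ ∧ P τ} ≤
      Nat.card {τ : Inv {v // v ≠ x} // NoCycle (contract b x) τ ∧ Q τ} := by
  refine Nat.card_le_card_of_injective
    (fun τ => ⟨τ.1.restrict (fun v => v ≠ x) (Inv.ne_of_fixed τ.2.1), τ.2.2.1.restrict τ.2.1,
      hPQ _ τ.2.1 τ.2.2.2⟩) ?_
  intro τ τ' h
  exact Subtype.ext (Inv.restrict_injective τ.2.1 τ'.2.1 (congrArg Subtype.val h))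

variable [DecidableEq V]

/-- Cutting the `a`-edge between `x` and `y` into two loops. -/
def Inv.cut (τ : Inv V) (x y : V) (h : τ.1 x = y) : Inv V :=
  ⟨fun v => Equiv.swap x y (τ.1 v), by
    have hy : τ.1 y = x := by rw [← h, τ.2]
    intro v
    by_cases hx : v = x
    · subst hx; simp [h]
    by_cases hvy : v = y
    · subst hvy; simp [hy]
    have h1 : τ.1 v ≠ x := fun h1 => hvy (by rw [← h, ← h1, τ.2])
    have h2 : τ.1 v ≠ y := fun h1 => hx (by rw [← hy, ← h1, τ.2])
    simp only
    rw [Equiv.swap_apply_of_ne_of_ne h1 h2, τ.2, Equiv.swap_apply_of_ne_of_ne hx hvy]⟩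

theorem Inv.cut_left (τ : Inv V) (x y : V) (h : τ.1 x = y) : (τ.cut x y h).1 x = x := by
  simp [Inv.cut, h]

theorem Inv.cut_right (τ : Inv V) (x y : V) (h : τ.1 x = y) : (τ.cut x y h).1 y = y := by
  have hy : τ.1 y = x := by rw [← h, τ.2]
  simp [Inv.cut, hy]

/-- Exchanging two points before applying the relation. -/
def twist (b : V → V → Prop) (x y : V) : V → V → Prop := fun v w => b (Equiv.swap x y v) w

theorem IsPartialInj.twist {b : V → V → Prop} (h : IsPartialInj b) (x y : V) :
    IsPartialInj (twist b x y) :=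
  ⟨fun _ _ _ h1 h2 => h.1 _ _ _ h1 h2,
    fun _ _ _ h1 h2 => (Equiv.swap x y).injective (h.2 _ _ _ h1 h2)⟩

theorem numUndef_twist (b : V → V → Prop) (x y : V) : numUndef (twist b x y) = numUndef b :=
  Nat.card_congr ((Equiv.swap x y).subtypeEquiv fun _ => Iff.rfl)

/-- Cutting the edge between x and y and twisting `b` by the same transposition leaves the composite
unchanged, as the two swaps cancel. Then x and y are fixed and are contracted in turn. -/
theorem card_noCycle_swapped_le [Finite V] (b : V → V → Prop) {x y : V} (hxy : y ≠ x) :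
    Nat.card {τ : Inv V // τ.1 x = y ∧ NoCycle b τ} ≤
      Nat.card {τ : Inv {v : {v // v ≠ x} // v ≠ ⟨y, hxy⟩} //
        NoCycle (contract (contract (twist b x y) x) ⟨y, hxy⟩) τ} := by
  calc Nat.card {τ : Inv V // τ.1 x = y ∧ NoCycle b τ}
      ≤ Nat.card {τ : Inv V // τ.1 x = x ∧ NoCycle (twist b x y) τ ∧ τ.1 y = y} := by
        refine Nat.card_le_card_of_injective (fun τ => ⟨τ.1.cut x y τ.2.1, Inv.cut_left _ _ _ _, ?_,
          Inv.cut_right _ _ _ _⟩) ?_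
        · have := τ.2.2
          simpa [NoCycle, twist, Inv.cut] using this
        · intro τ τ' h
          ext v
          exact (Equiv.swap x y).injective
            (congrFun (congrArg Subtype.val (congrArg Subtype.val h)) v)
    _ ≤ Nat.card {τ : Inv {v // v ≠ x} // NoCycle (contract (twist b x y) x) τ ∧
          τ.1 ⟨y, hxy⟩ = ⟨y, hxy⟩} :=
        card_noCycle_fixed_le _ x _ _ fun τ h h1 => Subtype.ext h1
    _ ≤ Nat.card {τ : Inv {v // v ≠ x} // τ.1 ⟨y, hxy⟩ = ⟨y, hxy⟩ ∧
          NoCycle (contract (twist b x y) x) τ ∧ True} :=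
        Nat.card_le_card_of_injective (fun τ => ⟨τ.1, τ.2.2, τ.2.1, trivial⟩) fun τ τ' h =>
          Subtype.ext (congrArg (fun t => t.1) h)
    _ ≤ Nat.card {τ : Inv {v : {v // v ≠ x} // v ≠ ⟨y, hxy⟩} //
          NoCycle (contract (contract (twist b x y) x) ⟨y, hxy⟩) τ ∧ True} :=
        card_noCycle_fixed_le _ _ _ _ fun τ h h1 => trivial
    _ ≤ _ := Nat.card_le_card_of_injective (fun τ => ⟨τ.1, τ.2.1⟩) fun τ τ' h =>
          Subtype.ext (congrArg (fun t => t.1) h)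

end Contraction

/-! ### Recursion for involutions, with and without the acyclicity condition -/

section Recursion

variable {V : Type*}

open Classical in
/-- Involutions fixing `x`. -/
noncomputable def invFixedEquiv (x : V) : {τ : Inv V // τ.1 x = x} ≃ Inv {v // v ≠ x} where
  toFun τ := τ.1.restrict _ (Inv.ne_of_fixed τ.2)
  invFun τ := ⟨⟨fun v => if h : v ≠ x then τ.1 ⟨v, h⟩ else x, by
    intro v
    by_cases h : v = x
    · simp [h]
    · simp [h, (τ.1 ⟨v, h⟩).2, τ.2 _]⟩, by simp⟩
  left_inv τ := Subtype.ext (Inv.restrict_injective (x := x) (by simp) τ.2 (by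
    ext v; simp [Inv.restrict, v.2]))
  right_inv τ := by ext v; simp [Inv.restrict, v.2]

open Classical in
/-- Involutions exchanging `x` and `y`, and involutions fixing both. -/
noncomputable def invSwappedEquiv {x y : V} (hxy : y ≠ x) :
    {τ : Inv V // τ.1 x = y} ≃ {τ : Inv {v // v ≠ x} // τ.1 ⟨y, hxy⟩ = ⟨y, hxy⟩} :=
  Equiv.trans
    { toFun := fun τ => (⟨⟨τ.1.cut x y τ.2, Inv.cut_left _ _ _ τ.2⟩, Inv.cut_right _ _ _ τ.2⟩ :
        {τ : {τ : Inv V // τ.1 x = x} // τ.1.1 y = y})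
      invFun := fun τ => ⟨⟨fun v => Equiv.swap x y (τ.1.1.1 v), by
        intro v
        have hx := τ.1.2
        have hy := τ.2
        by_cases h1 : v = x
        · subst h1; simp [hx, hy]
        by_cases h2 : v = y
        · subst h2; simp [hx, hy]
        have h3 := Inv.ne_of_fixed hx v h1
        have h4 := Inv.ne_of_fixed hy v h2
        simp only
        rw [Equiv.swap_apply_of_ne_of_ne h3 h4, τ.1.1.2, Equiv.swap_apply_of_ne_of_ne h1 h2]⟩, by
        simp [τ.1.2]⟩
      left_inv := fun τ => by ext v; simp [Inv.cut]
      right_inv := fun τ => by ext v; simp [Inv.cut] }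
    ((invFixedEquiv x).subtypeEquiv fun τ => by
      simp [invFixedEquiv, Inv.restrict])

variable [Fintype V]

theorem card_ne (x : V) : Nat.card {v // v ≠ x} = Fintype.card V - 1 := by
  classical
  rw [Nat.card_eq_fintype_card, Fintype.card_subtype_compl, Fintype.card_subtype_eq]

theorem natCard_inv (W : Type*) [Finite W] : Nat.card (Inv W) = numInv (Nat.card W) := by
  have := Fintype.ofFinite W
  rw [Nat.card_eq_fintype_card, Nat.card_eq_fintype_card, card_inv]

theorem natCard_bStr (W : Type*) [Finite W] : Nat.card (BStr W) = numB (Nat.card W) := by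
  have := Fintype.ofFinite W
  rw [Nat.card_eq_fintype_card, Nat.card_eq_fintype_card, card_bStr]

theorem card_inv_fixed (x : V) :
    Nat.card {τ : Inv V // τ.1 x = x} = numInv (Fintype.card V - 1) := by
  rw [Nat.card_congr (invFixedEquiv x), natCard_inv, card_ne]

theorem card_inv_swapped {x y : V} (hxy : y ≠ x) :
    Nat.card {τ : Inv V // τ.1 x = y} = numInv (Fintype.card V - 2) := by
  have := Fintype.ofFinite {v // v ≠ x}
  rw [Nat.card_congr (invSwappedEquiv hxy), card_inv_fixed, ← Nat.card_eq_fintype_card, card_ne,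
    Nat.sub_sub]

end Recursion

theorem numInv_add_two (n : ℕ) : numInv (n + 2) = numInv (n + 1) + (n + 1) * numInv n := by
  have h1 : numInv (n + 2) = ∑ y : Fin (n + 2), Nat.card {τ : Inv (Fin (n + 2)) // τ.1 0 = y} := by
    rw [← Nat.card_sigma, Nat.card_congr (Equiv.sigmaFiberEquiv fun τ : Inv (Fin (n + 2)) => τ.1 0),
      Nat.card_eq_fintype_card]
    rfl
  rw [h1, ← Finset.add_sum_erase _ _ (Finset.mem_univ 0), card_inv_fixed,
    Finset.sum_congr rfl fun y hy => card_inv_swapped (Finset.ne_of_mem_erase hy)]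
  simp

theorem numInv_zero : numInv 0 = 1 := by
  rw [numInv, Fintype.card_eq_one_iff]
  exact ⟨⟨id, fun _ => rfl⟩, fun τ => by ext v; exact v.elim0⟩

theorem numInv_one : numInv 1 = 1 := by
  rw [numInv, Fintype.card_eq_one_iff]
  exact ⟨⟨id, fun _ => rfl⟩, fun τ => by ext v; omega⟩

theorem numInv_le_succ (n : ℕ) : numInv n ≤ numInv (n + 1) := by
  cases n with
  | zero => rw [numInv_zero, numInv_one]
  | succ n => rw [numInv_add_two]; exact Nat.le_add_right _ _

/-- A bound for the number of involutions without cycle for a partial injection which is undefined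
at no more than `k` points. -/
noncomputable def noCycleBound (k : ℕ) : ℕ → ℕ
  | 0 => 1
  | 1 => 1
  | m + 2 => if m + 2 ≤ k then numInv (m + 2) else
      noCycleBound k (m + 1) + m * noCycleBound k m

theorem noCycleBound_of_le {k m : ℕ} (h : m ≤ k) : noCycleBound k m = numInv m := by
  match m with
  | 0 => rw [noCycleBound, numInv_zero]
  | 1 => rw [noCycleBound, numInv_one]
  | m + 2 => rw [noCycleBound, if_pos h]

theorem noCycleBound_add_two {k m : ℕ} (h : k < m + 2) :
    noCycleBound k (m + 2) = noCycleBound k (m + 1) + m * noCycleBound k m := by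
  rw [noCycleBound, if_neg (not_le.2 h)]

theorem noCycleBound_le_succ (k m : ℕ) : noCycleBound k m ≤ noCycleBound k (m + 1) := by
  by_cases h : m + 1 ≤ k
  · rw [noCycleBound_of_le h, noCycleBound_of_le (by omega)]
    exact numInv_le_succ m
  · cases m with
    | zero => simp [noCycleBound]
    | succ m =>
      rw [noCycleBound_add_two (by omega)]
      exact Nat.le_add_right _ _

/-- Choose an edge z → x and sort the involutions by the image of x. The value z is excluded, x
itself leaves m + 1 points, and any other value leaves m points; contraction never increases the
number of undefined points. -/
theorem card_noCycle_le (k m : ℕ) : ∀ (V : Type) [Finite V], Nat.card V = m →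
    ∀ b : V → V → Prop, IsPartialInj b → numUndef b ≤ k →
      Nat.card {τ : Inv V // NoCycle b τ} ≤ noCycleBound k m := by
  induction m using Nat.strong_induction_on with
  | _ m ih =>
  intro V _ hV b hb hk
  have htriv : Nat.card {τ : Inv V // NoCycle b τ} ≤ numInv m := by
    rw [← hV, ← natCard_inv]
    exact Nat.card_le_card_of_injective Subtype.val Subtype.val_injective
  match m, ih, hV, htriv with
  | 0, _, _, htriv => rwa [numInv_zero] at htriv
  | 1, _, _, htriv => rwa [numInv_one] at htriv
  | m + 2, ih, hV, htriv =>
    by_cases hmk : m + 2 ≤ k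
    · rwa [noCycleBound_of_le hmk]
    rw [noCycleBound_add_two (by omega)]
    classical
    have := Fintype.ofFinite V
    have hV' : Fintype.card V = m + 2 := by rw [← Nat.card_eq_fintype_card, hV]
    -- An edge exists because fewer points are undefined than there are points.
    obtain ⟨z, x, hzx⟩ : ∃ z x, b z x := by
      by_contra hno
      push Not at hno
      have : numUndef b = Nat.card V :=
        Nat.card_congr (Equiv.subtypeUnivEquiv hno)
      omega
    let F : V → ℕ := fun y => Nat.card {τ : Inv V // τ.1 x = y ∧ NoCycle b τ}
    have hsum : Nat.card {τ : Inv V // NoCycle b τ} = ∑ y, F y := by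
      rw [← Nat.card_congr (Equiv.sigmaFiberEquiv fun τ : {τ : Inv V // NoCycle b τ} => τ.1.1 x),
        Nat.card_sigma]
      refine Finset.sum_congr rfl fun y _ => Nat.card_congr ?_
      exact ⟨fun τ => ⟨τ.1.1, τ.2, τ.1.2⟩, fun τ => ⟨⟨τ.1, τ.2.2⟩, τ.2.1⟩, fun _ => rfl,
        fun _ => rfl⟩
    have hFz : F z = 0 := by
      have : IsEmpty {τ : Inv V // τ.1 x = z ∧ NoCycle b τ} :=
        ⟨fun τ => τ.2.2 x (Relation.TransGen.single (by rw [τ.2.1]; exact hzx))⟩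
      exact Nat.card_of_isEmpty
    have hFx : F x ≤ noCycleBound k (m + 1) := by
      calc F x ≤ Nat.card {τ : Inv V // τ.1 x = x ∧ NoCycle b τ ∧ True} :=
            Nat.card_le_card_of_injective (fun τ => ⟨τ.1, τ.2.1, τ.2.2, trivial⟩) fun τ τ' h =>
              Subtype.ext (congrArg (fun t => t.1) h)
        _ ≤ Nat.card {τ : Inv {v // v ≠ x} // NoCycle (contract b x) τ ∧ True} :=
            card_noCycle_fixed_le _ _ _ _ fun _ _ _ => trivial
        _ ≤ Nat.card {τ : Inv {v // v ≠ x} // NoCycle (contract b x) τ} :=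
            Nat.card_le_card_of_injective (fun τ => ⟨τ.1, τ.2.1⟩) fun τ τ' h =>
              Subtype.ext (congrArg (fun t => t.1) h)
        _ ≤ _ := ih (m + 1) (by omega) _ (by rw [card_ne, hV']; rfl) _ (hb.contract x)
            ((numUndef_contract_le hb x).trans hk)
    have hFy : ∀ y, y ≠ x → F y ≤ noCycleBound k m := by
      intro y hy
      refine (card_noCycle_swapped_le b hy).trans (ih m (by omega) _ ?_ _
        (((hb.twist x y).contract x).contract _) ?_)
      · have := Fintype.ofFinite {v // v ≠ x}
        rw [card_ne, ← Nat.card_eq_fintype_card, card_ne, hV']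
        rfl
      · refine (numUndef_contract_le ((hb.twist x y).contract x) _).trans ?_
        refine (numUndef_contract_le (hb.twist x y) _).trans ?_
        rwa [numUndef_twist]
    rw [hsum, ← Finset.add_sum_erase _ _ (Finset.mem_univ x)]
    have hcard : (Finset.univ.erase x).card = m + 1 := by
      rw [Finset.card_erase_of_mem (Finset.mem_univ x), Finset.card_univ, hV']; rfl
    -- For a loop the excluded value is x itself and m + 1 values remain; monotonicity of the bound
    -- absorbs the extra one.
    by_cases hzx' : z = x
    · rw [← hzx', hFz, zero_add, hzx']
      refine (Finset.sum_le_card_nsmul _ _ _ fun y hy => hFy y (Finset.ne_of_mem_erase hy)).trans ?_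
      rw [hcard, smul_eq_mul, add_mul, one_mul, add_comm]
      exact Nat.add_le_add_right (noCycleBound_le_succ k m) _
    · rw [← Finset.add_sum_erase _ _ (Finset.mem_erase.2 ⟨hzx', Finset.mem_univ z⟩), hFz, zero_add]
      refine Nat.add_le_add hFx ?_
      refine (Finset.sum_le_card_nsmul _ _ _ fun y hy => hFy y
        (Finset.ne_of_mem_erase (Finset.mem_of_mem_erase hy))).trans ?_
      rw [Finset.card_erase_of_mem (Finset.mem_erase.2 ⟨hzx', Finset.mem_univ z⟩), hcard,
        smul_eq_mul]
      rfl

/-! ### Disconnected graphs -/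

theorem card_isInvariant_le {V : Type} [Fintype V] (A : Finset V) :
    Nat.card {p : Inv V × BStr V // IsInvariant p.1 p.2 A} ≤
      numInv A.card * numB A.card * (numInv (Fintype.card V - A.card) *
        numB (Fintype.card V - A.card)) := by
  classical
  have h1 : Nat.card {v // v ∈ A} = A.card := by simp
  have h2 : Nat.card {v // v ∉ A} = Fintype.card V - A.card := by
    rw [Nat.card_eq_fintype_card, Fintype.card_subtype_compl, Fintype.card_coe]
  rw [← h2, ← natCard_inv, ← natCard_bStr, ← h1, ← natCard_inv, ← natCard_bStr,
    ← Nat.card_prod, ← Nat.card_prod, ← Nat.card_prod]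
  have hτ : ∀ p : {p : Inv V × BStr V // IsInvariant p.1 p.2 A}, ∀ v, v ∉ A → p.1.1.1 v ∉ A := by
    intro p v hv hv'
    have := p.2.1 _ hv'
    rw [p.1.1.2] at this
    exact hv this
  refine Nat.card_le_card_of_injective (fun p =>
    ((p.1.1.restrict (· ∈ A) p.2.1, p.1.2.restrict (· ∈ A) p.2.2),
      (p.1.1.restrict (· ∉ A) (hτ p), p.1.2.restrict (· ∉ A)
        fun v w h => not_congr (p.2.2 v w h)))) ?_
  rintro ⟨⟨τ, R⟩, h⟩ ⟨⟨τ', R'⟩, h'⟩ heq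
  simp only [Prod.mk.injEq] at heq
  obtain ⟨⟨e1, e2⟩, e3, e4⟩ := heq
  have f1 : τ = τ' := by
    ext v
    by_cases hv : v ∈ A
    · exact congrArg Subtype.val (congrFun (congrArg Subtype.val e1) ⟨v, hv⟩)
    · exact congrArg Subtype.val (congrFun (congrArg Subtype.val e3) ⟨v, hv⟩)
  have f2 : R = R' := by
    ext v w
    by_cases hv : v ∈ A <;> by_cases hw : w ∈ A
    · exact iff_of_eq (congrFun (congrFun (congrArg Subtype.val e2) ⟨v, hv⟩) ⟨w, hw⟩)
    · exact iff_of_false (fun hR => hw ((h.2 v w hR).1 hv)) (fun hR => hw ((h'.2 v w hR).1 hv))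
    · exact iff_of_false (fun hR => hv ((h.2 v w hR).2 hw)) (fun hR => hv ((h'.2 v w hR).2 hw))
    · exact iff_of_eq (congrFun (congrFun (congrArg Subtype.val e4) ⟨v, hv⟩) ⟨w, hw⟩)
  subst f1 f2
  rfl

/-- A proper union of components and its complement are both invariant, and one of them has at most
half of the points. -/
theorem exists_small_invariant {V : Type} [Fintype V] [Nonempty V] {τ : Inv V} {R : BStr V}
    (h : ¬ IsConn τ R) : ∃ A : Finset V, 1 ≤ A.card ∧ 2 * A.card ≤ Fintype.card V ∧
      IsInvariant τ R A := by
  classical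
  rw [IsConn] at h
  push Not at h
  obtain ⟨A, hne, hA, hu⟩ := h
  have hc : IsInvariant τ R Aᶜ :=
    ⟨fun v hv hv' => hv (by have := hA.1 _ hv'; rwa [τ.2] at this),
      fun v w hR => not_congr (hA.2 v w hR)⟩
  have hcard : A.toFinset.card + A.toFinsetᶜ.card = Fintype.card V :=
    Finset.card_add_card_compl _
  by_cases hle : 2 * A.toFinset.card ≤ Fintype.card V
  · refine ⟨A.toFinset, ?_, hle, by simpa using hA⟩
    rw [Nat.one_le_iff_ne_zero, Finset.card_ne_zero]
    simpa using hne
  · refine ⟨A.toFinsetᶜ, ?_, by omega, by simpa using hc⟩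
    rw [Nat.one_le_iff_ne_zero, Finset.card_ne_zero, ← Set.toFinset_compl, Set.toFinset_nonempty]
    exact Set.nonempty_compl.2 hu

theorem card_not_isConn_le (n : ℕ) (hn : 1 ≤ n) :
    Nat.card {p : Inv (Fin n) × BStr (Fin n) // ¬ IsConn p.1 p.2} ≤
      ∑ k ∈ Finset.Icc 1 (n / 2), n.choose k *
        (numInv k * numB k * (numInv (n - k) * numB (n - k))) := by
  classical
  have : Nonempty (Fin n) := ⟨⟨0, hn⟩⟩
  let P : Finset (Finset (Fin n)) :=
    Finset.univ.filter fun A => 1 ≤ A.card ∧ A.card ≤ n / 2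
  let S : Finset (Fin n) → Finset (Inv (Fin n) × BStr (Fin n)) := fun A =>
    Finset.univ.filter fun p => IsInvariant p.1 p.2 A
  have hS : ∀ A, (S A).card ≤ numInv A.card * numB A.card *
      (numInv (n - A.card) * numB (n - A.card)) := by
    intro A
    have := card_isInvariant_le A
    rwa [Nat.card_eq_fintype_card, Fintype.card_subtype, Fintype.card_fin] at this
  rw [Nat.card_eq_fintype_card, Fintype.card_subtype]
  calc _ ≤ (P.biUnion S).card := by
        refine Finset.card_le_card fun p hp => ?_
        rw [Finset.mem_filter] at hp
        obtain ⟨A, h1, h2, h3⟩ := exists_small_invariant hp.2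
        rw [Fintype.card_fin] at h2
        refine Finset.mem_biUnion.2 ⟨A, Finset.mem_filter.2 ⟨Finset.mem_univ _, h1, by omega⟩,
          Finset.mem_filter.2 ⟨Finset.mem_univ _, h3⟩⟩
    _ ≤ ∑ A ∈ P, (S A).card := Finset.card_biUnion_le
    _ ≤ ∑ A ∈ P, numInv A.card * numB A.card * (numInv (n - A.card) * numB (n - A.card)) :=
        Finset.sum_le_sum fun A _ => hS A
    _ = ∑ A ∈ (Finset.univ : Finset (Fin n)).powerset, if 1 ≤ A.card ∧ A.card ≤ n / 2 then
          numInv A.card * numB A.card * (numInv (n - A.card) * numB (n - A.card)) else 0 := by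
        rw [Finset.powerset_univ, Finset.sum_filter]
    _ = _ := by
        rw [Finset.sum_powerset_apply_card (fun k => if 1 ≤ k ∧ k ≤ n / 2 then
          numInv k * numB k * (numInv (n - k) * numB (n - k)) else 0), Finset.card_univ,
          Fintype.card_fin]
        simp_rw [smul_eq_mul, mul_ite, mul_zero]
        rw [← Finset.sum_filter]
        refine Finset.sum_congr ?_ fun _ _ => rfl
        ext k
        simp only [Finset.mem_filter, Finset.mem_range, Finset.mem_Icc]
        omega

open Filter Topology

/-! ### Growth of the number of involutions -/

/-- Both bounds are proved together: each inequality for n + 1 uses the opposite one for n in the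
recursion. -/
theorem numInv_bounds (n : ℕ) : √((n : ℝ) + 1) * numInv n ≤ numInv (n + 1) ∧
    (numInv (n + 1) : ℝ) ≤ (√((n : ℝ) + 1) + 1) * numInv n := by
  induction n with
  | zero => simp [numInv_zero, numInv_one]
  | succ n ih =>
    obtain ⟨h1, h2⟩ := ih
    have hrec : (numInv (n + 2) : ℝ) = numInv (n + 1) + ((n : ℝ) + 1) * numInv n := by
      rw [numInv_add_two]; push_cast; ring
    set s := √((n : ℝ) + 1) with hs
    have hs2 : s ^ 2 = (n : ℝ) + 1 := Real.sq_sqrt (by positivity)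
    have hs0 : 0 < s := Real.sqrt_pos.2 (by positivity)
    set x : ℝ := (numInv n : ℝ)
    set y : ℝ := (numInv (n + 1) : ℝ)
    have hy : 0 ≤ y := Nat.cast_nonneg _
    push_cast
    set t := √((n : ℝ) + 1 + 1) with ht
    have ht2 : t ^ 2 = s ^ 2 + 1 := by rw [hs2]; exact Real.sq_sqrt (by positivity)
    have ht0 : 0 < t := Real.sqrt_pos.2 (by positivity)
    have hst : s ≤ t := Real.sqrt_le_sqrt (by linarith)
    change t * y ≤ numInv (n + 2) ∧ (numInv (n + 2) : ℝ) ≤ (t + 1) * y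
    rw [hrec, ← hs2]
    constructor
    · have h3 : t * (s + 1) ≤ s ^ 2 + s + 1 := by
        have : (t * (s + 1)) ^ 2 ≤ (s ^ 2 + s + 1) ^ 2 := by
          rw [mul_pow, ht2]; nlinarith [sq_nonneg s]
        exact (abs_le_of_sq_le_sq' this (by positivity)).2
      have h4 : s ^ 2 * y ≤ (s + 1) * (s ^ 2 * x) := by nlinarith [sq_nonneg s]
      have h5 : (s + 1) * (t * y) ≤ (s + 1) * (y + s ^ 2 * x) := by nlinarith
      exact le_of_mul_le_mul_left h5 (by positivity)
    · nlinarith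

theorem noCycleBound_le_numInv (k m : ℕ) : noCycleBound k m ≤ numInv m := by
  induction m using Nat.strong_induction_on with
  | _ m ih =>
  match m, ih with
  | 0, _ => rw [noCycleBound, numInv_zero]
  | 1, _ => rw [noCycleBound, numInv_one]
  | m + 2, ih =>
    by_cases h : m + 2 ≤ k
    · rw [noCycleBound_of_le h]
    · rw [noCycleBound_add_two (by omega), numInv_add_two]
      exact Nat.add_le_add (ih _ (by omega)) (Nat.mul_le_mul (Nat.le_succ m) (ih _ (by omega)))

theorem noCycleBound_le_rpow {β : ℝ} (hβ0 : 0 < β) (hβ : β < 1 / 2) :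
    ∃ C : ℝ, 0 < C ∧ ∀ k m : ℕ, 1 ≤ k → 1 ≤ m →
      (noCycleBound k m : ℝ) ≤ C * ((k : ℝ) / m) ^ β * numInv m := by
  -- Chosen so that (1 - 2β) √(j + 1) ≥ 1 in the induction step. The constant m₀^β makes the claim
  -- trivial for m ≤ m₀ k.
  obtain ⟨m₀, hm₀⟩ := exists_nat_ge ((1 / (1 - 2 * β)) ^ 2 + 3)
  have hm₀3 : (3 : ℝ) ≤ m₀ := by nlinarith [sq_nonneg (1 / (1 - 2 * β))]
  have hm₀3' : 3 ≤ m₀ := by exact_mod_cast hm₀3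
  refine ⟨(m₀ : ℝ) ^ β, Real.rpow_pos_of_pos (by linarith) _, ?_⟩
  intro k m hk
  have hk' : (1 : ℝ) ≤ k := by exact_mod_cast hk
  induction m using Nat.strong_induction_on with
  | _ m ih =>
  intro hm
  have hm' : (1 : ℝ) ≤ m := by exact_mod_cast hm
  have hform : ∀ j : ℕ, (m₀ : ℝ) ^ β * ((k : ℝ) / j) ^ β = ((m₀ * k : ℝ) / j) ^ β := by
    intro j
    rw [← Real.mul_rpow (by positivity) (by positivity), mul_div_assoc]
  simp_rw [hform] at ih ⊢
  set K : ℝ := m₀ * k with hK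
  have hK0 : 0 < K := by positivity
  by_cases hmK : (m : ℝ) ≤ K
  · have h1 : (1 : ℝ) ≤ (K / m) ^ β :=
      Real.one_le_rpow ((one_le_div (by linarith)).2 hmK) hβ0.le
    have h2 : (noCycleBound k m : ℝ) ≤ numInv m := by exact_mod_cast noCycleBound_le_numInv k m
    have h3 : (0 : ℝ) ≤ numInv m := Nat.cast_nonneg _
    nlinarith
  · push Not at hmK
    have hkm : k < m := by
      have : (k : ℝ) < m := by nlinarith
      exact_mod_cast this
    have hm0m : m₀ < m := by
      have : (m₀ : ℝ) < m := by nlinarith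
      exact_mod_cast this
    obtain ⟨j, rfl⟩ : ∃ j, m = j + 2 := ⟨m - 2, by omega⟩
    have hj1 : 1 ≤ j := by omega
    have hj : (1 : ℝ) ≤ j := by exact_mod_cast hj1
    rw [noCycleBound_add_two hkm, numInv_add_two]
    push_cast
    have ih1 := ih (j + 1) (by omega) (by omega)
    have ih2 := ih j (by omega) hj1
    push_cast at ih1
    set P : ℝ := (K / ((j : ℝ) + 2)) ^ β with hP
    have hP0 : 0 ≤ P := Real.rpow_nonneg (by positivity) _
    -- Bernoulli's inequality for an exponent at most 1; likewise in the next bound.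
    have hP1 : (K / ((j : ℝ) + 1)) ^ β ≤ P * (1 + β / (j + 1)) := by
      have e : K / ((j : ℝ) + 1) = K / ((j : ℝ) + 2) * (1 + 1 / (j + 1)) := by
        field_simp; ring
      rw [e, Real.mul_rpow (by positivity) (by positivity)]
      refine mul_le_mul_of_nonneg_left ?_ hP0
      have := rpow_one_add_le_one_add_mul_self (s := 1 / ((j : ℝ) + 1)) (p := β)
        (by have : (0 : ℝ) ≤ 1 / ((j : ℝ) + 1) := by positivity
            linarith) hβ0.le (by linarith)
      rwa [mul_one_div] at this
    have hP2 : (K / (j : ℝ)) ^ β ≤ P * (1 + 2 * β / j) := by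
      have e : K / (j : ℝ) = K / ((j : ℝ) + 2) * (1 + 2 / j) := by
        field_simp
      rw [e, Real.mul_rpow (by positivity) (by positivity)]
      refine mul_le_mul_of_nonneg_left ?_ hP0
      have := rpow_one_add_le_one_add_mul_self (s := 2 / (j : ℝ)) (p := β)
        (by have : (0 : ℝ) ≤ 2 / (j : ℝ) := by positivity
            linarith) hβ0.le (by linarith)
      calc _ ≤ _ := this
        _ = _ := by ring
    have hb := (numInv_bounds j).2
    set x : ℝ := (numInv j : ℝ)
    set y : ℝ := (numInv (j + 1) : ℝ)
    have hx : 0 ≤ x := Nat.cast_nonneg _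
    have hy : 0 ≤ y := Nat.cast_nonneg _
    -- The recursion gains x by having j in place of j + 1, and Bernoulli costs 2βx + βy/(j + 1). As
    -- y is of order √j x, the gain wins precisely because β < 1/2.
    have key : β / (j + 1) * y ≤ (1 - 2 * β) * x := by
      set s := √((j : ℝ) + 1) with hs
      have hs2 : s ^ 2 = (j : ℝ) + 1 := Real.sq_sqrt (by positivity)
      have hs1 : 1 ≤ s := by
        rw [hs]; exact Real.one_le_sqrt.2 (by linarith)
      have hjm : (m₀ : ℝ) ≤ (j : ℝ) + 1 := by
        have : m₀ ≤ j + 1 := by omega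
        exact_mod_cast this
      have h4 : 1 / (1 - 2 * β) ≤ s := by
        rw [hs]
        exact Real.le_sqrt_of_sq_le (by linarith)
      have h5 : 1 ≤ (1 - 2 * β) * s := by
        rw [div_le_iff₀ (by linarith)] at h4
        linarith
      rw [← hs2, div_mul_eq_mul_div, div_le_iff₀ (by positivity)]
      have h6 : β * y ≤ s * x := by
        calc β * y ≤ (1 / 2) * ((s + 1) * x) :=
              mul_le_mul hβ.le hb hy (by norm_num)
          _ ≤ s * x := by nlinarith
      calc β * y ≤ s * x := h6
        _ ≤ ((1 - 2 * β) * s) * (s * x) := by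
            exact le_mul_of_one_le_left (by positivity) h5
        _ = _ := by ring
    have hj0 : (j : ℝ) ≠ 0 := by positivity
    calc (noCycleBound k (j + 1) : ℝ) + j * noCycleBound k j
        ≤ P * (1 + β / (j + 1)) * y + j * (P * (1 + 2 * β / j) * x) := by
          refine add_le_add (ih1.trans (mul_le_mul_of_nonneg_right hP1 hy)) ?_
          exact mul_le_mul_of_nonneg_left (ih2.trans (mul_le_mul_of_nonneg_right hP2 hx))
            (by linarith)
      _ = P * (y + β / (j + 1) * y + (j + 2 * β) * x) := by
          field_simp
      _ ≤ P * (y + (j + 1) * x) := by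
          refine mul_le_mul_of_nonneg_left ?_ hP0
          linarith

/-! ### Growth of the number of `b`-structures -/

/-- Interpolation of factorial moments: the first term covers k ≤ K + 2, the second covers larger k.
It bounds the second moment by the third without Hölder's inequality. -/
theorem descFactorial_two_le (k : ℕ) {K : ℝ} (hK : 0 < K) :
    (k.descFactorial 2 : ℝ) ≤ (K + 2) * (K + 1) + k.descFactorial 3 / K := by
  match k with
  | 0 => simp; positivity
  | 1 => simp; positivity
  | k + 2 =>
    have e2 : ((k + 2).descFactorial 2 : ℝ) = (k + 2) * (k + 1) := by
      simp [Nat.descFactorial]; ring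
    have e3 : ((k + 2).descFactorial 3 : ℝ) = (k + 2) * (k + 1) * k := by
      simp [Nat.descFactorial]; ring
    rw [e2, e3]
    by_cases h : (k : ℝ) ≤ K
    · have : 0 ≤ ((k : ℝ) + 2) * (k + 1) * k / K := by positivity
      have h0 : (0 : ℝ) ≤ k := Nat.cast_nonneg _
      nlinarith
    · push Not at h
      have : ((k : ℝ) + 2) * (k + 1) ≤ ((k : ℝ) + 2) * (k + 1) * k / K := by
        rw [le_div_iff₀ hK]
        exact mul_le_mul_of_nonneg_left h.le (by positivity)
      nlinarith

theorem descFactorial_one_le (k : ℕ) {K : ℝ} (hK : 0 < K) :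
    (k.descFactorial 1 : ℝ) ≤ (K + 1) + k.descFactorial 2 / K := by
  match k with
  | 0 => simp; positivity
  | k + 1 =>
    have e1 : ((k + 1).descFactorial 1 : ℝ) = k + 1 := by simp
    have e2 : ((k + 1).descFactorial 2 : ℝ) = (k + 1) * k := by
      simp [Nat.descFactorial]; ring
    rw [e1, e2]
    by_cases h : (k : ℝ) ≤ K
    · have : 0 ≤ ((k : ℝ) + 1) * k / K := by positivity
      linarith
    · push Not at h
      have : ((k : ℝ) + 1) ≤ ((k : ℝ) + 1) * k / K := by
        rw [le_div_iff₀ hK]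
        exact mul_le_mul_of_nonneg_left h.le (by positivity)
      linarith

theorem sum_descFactorial_numLoops_real (n j : ℕ) :
    ∑ R : BStr (Fin n), ((numLoops R).descFactorial j : ℝ) = n.descFactorial j * numB (n - j) := by
  exact_mod_cast sum_descFactorial_numLoops n j

/-- The third factorial moment of the number of loops is at most n, since three loops could be
replaced by a triangle through a given vertex. -/
theorem descFactorial_three_mul_numB_le (n : ℕ) :
    (n.descFactorial 3 * numB (n - 3) : ℝ) ≤ n * numB n := by
  match n with
  | 0 => simp
  | 1 => simp [Nat.descFactorial]
  | n + 2 =>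
    have h := numB_triangle_le n
    have e : (n + 2).descFactorial 3 = (n + 2) * ((n + 1) * n) := by
      simp [Nat.descFactorial]; ring
    have e2 : n + 2 - 3 = n - 1 := by omega
    rw [e, e2]
    have : (n + 2) * ((n + 1) * n) * numB (n - 1) ≤ (n + 2) * numB (n + 2) := by
      rw [mul_assoc]; exact Nat.mul_le_mul_left _ h
    exact_mod_cast this

theorem card_bStr_fin (n : ℕ) : ((Finset.univ : Finset (BStr (Fin n))).card : ℝ) = numB n := rfl

/-- Interpolating at K = n^(1/3) balances K² against the third moment n divided by K. -/
theorem descFactorial_two_mul_numB_le (n : ℕ) {K : ℝ} (hK1 : 1 ≤ K) (hK : K ^ 3 = n) :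
    (n.descFactorial 2 * numB (n - 2) : ℝ) ≤ 7 * K ^ 2 * numB n := by
  have hK0 : 0 < K := by linarith
  have hB : (0 : ℝ) ≤ numB n := Nat.cast_nonneg _
  rw [← sum_descFactorial_numLoops_real]
  calc ∑ R : BStr (Fin n), ((numLoops R).descFactorial 2 : ℝ)
      ≤ ∑ R : BStr (Fin n), ((K + 2) * (K + 1) + ((numLoops R).descFactorial 3 : ℝ) / K) :=
        Finset.sum_le_sum fun R _ => descFactorial_two_le _ hK0
    _ = numB n * ((K + 2) * (K + 1)) + (n.descFactorial 3 * numB (n - 3)) / K := by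
        rw [Finset.sum_add_distrib, Finset.sum_const, nsmul_eq_mul, card_bStr_fin,
          ← Finset.sum_div, sum_descFactorial_numLoops_real]
    _ ≤ numB n * ((K + 2) * (K + 1)) + K ^ 3 * numB n / K := by
        refine add_le_add le_rfl (div_le_div_of_nonneg_right ?_ hK0.le)
        rw [hK]
        exact descFactorial_three_mul_numB_le n
    _ = (K ^ 2 + (K + 2) * (K + 1)) * numB n := by
        field_simp; ring
    _ ≤ 7 * K ^ 2 * numB n := by
        refine mul_le_mul_of_nonneg_right ?_ hB
        nlinarith

theorem mul_numB_pred_le (n : ℕ) {K : ℝ} (hK1 : 1 ≤ K) (hK : K ^ 3 = n) :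
    (n * numB (n - 1) : ℝ) ≤ 9 * K * numB n := by
  have hK0 : 0 < K := by linarith
  have hB : (0 : ℝ) ≤ numB n := Nat.cast_nonneg _
  have e := sum_descFactorial_numLoops_real n 1
  rw [Nat.descFactorial_one] at e
  rw [← e]
  calc ∑ R : BStr (Fin n), ((numLoops R).descFactorial 1 : ℝ)
      ≤ ∑ R : BStr (Fin n), ((K + 1) + ((numLoops R).descFactorial 2 : ℝ) / K) :=
        Finset.sum_le_sum fun R _ => descFactorial_one_le _ hK0
    _ = numB n * (K + 1) + (n.descFactorial 2 * numB (n - 2)) / K := by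
        rw [Finset.sum_add_distrib, Finset.sum_const, nsmul_eq_mul, card_bStr_fin,
          ← Finset.sum_div, sum_descFactorial_numLoops_real]
    _ ≤ numB n * (K + 1) + 7 * K ^ 2 * numB n / K := by
        exact add_le_add le_rfl (div_le_div_of_nonneg_right
          (descFactorial_two_mul_numB_le n hK1 hK) hK0.le)
    _ = (8 * K + 1) * numB n := by
        field_simp; ring
    _ ≤ 9 * K * numB n := by
        refine mul_le_mul_of_nonneg_right ?_ hB
        linarith

/-! ### The exponential generating sequence -/

/-- The number of pairs of an involution and a `b`-structure on `n` points, over `n!`. -/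
noncomputable def expCount (n : ℕ) : ℝ := numInv n * numB n / n.factorial

theorem expCount_pos (n : ℕ) : 0 < expCount n := by
  have h1 : (0 : ℝ) < numInv n := by exact_mod_cast numInv_pos n
  have h2 : (0 : ℝ) < numB n := by exact_mod_cast numB_pos n
  have h3 : (0 : ℝ) < n.factorial := by exact_mod_cast n.factorial_pos
  unfold expCount
  positivity

/-- The involutions contribute x^(-3) and the `b`-structures, with the factorials, 9x². Sixth roots
keep all exponents integral. -/
theorem expCount_le_succ (n : ℕ) {x : ℝ} (hx : 1 ≤ x) (hx6 : x ^ 6 = (n : ℝ) + 1) :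
    expCount n ≤ 9 / x * expCount (n + 1) := by
  have hI := (numInv_bounds n).1
  have hx0 : 0 < x := by linarith
  have hs : √((n : ℝ) + 1) = x ^ 3 := by
    rw [← hx6, show x ^ 6 = (x ^ 3) ^ 2 by ring, Real.sqrt_sq (by positivity)]
  rw [hs] at hI
  have hB := mul_numB_pred_le (n + 1) (K := x ^ 2) (one_le_pow₀ hx)
    (by push_cast; rw [← hx6]; ring)
  rw [Nat.add_sub_cancel] at hB
  push_cast at hB
  rw [← hx6] at hB
  have h1 : (0 : ℝ) < numInv n := by exact_mod_cast numInv_pos n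
  have h2 : (0 : ℝ) < numB n := by exact_mod_cast numB_pos n
  have h3 : (0 : ℝ) < n.factorial := by exact_mod_cast n.factorial_pos
  have h4 : (0 : ℝ) < numInv (n + 1) := by exact_mod_cast numInv_pos (n + 1)
  have hprod := mul_le_mul hI hB (by positivity) (by positivity)
  unfold expCount
  rw [Nat.factorial_succ]
  push_cast
  rw [← hx6, div_mul_div_comm, div_le_div_iff₀ h3 (by positivity)]
  have h5 : x ^ 2 * (numInv n * numB n * (x * (x ^ 6 * n.factorial))) ≤
      x ^ 2 * (9 * (numInv (n + 1) * numB (n + 1)) * n.factorial) := by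
    calc x ^ 2 * (numInv n * numB n * (x * (x ^ 6 * n.factorial)))
        = (x ^ 3 * numInv n * (x ^ 6 * numB n)) * n.factorial := by ring
      _ ≤ (numInv (n + 1) * (9 * x ^ 2 * numB (n + 1))) * n.factorial :=
          mul_le_mul_of_nonneg_right hprod h3.le
      _ = _ := by ring
  exact le_of_mul_le_mul_left h5 (by positivity)

theorem exists_sixth_root (n : ℕ) (hn : 1 ≤ n) : ∃ x : ℝ, 1 ≤ x ∧ x ^ 6 = n ∧
    x = (n : ℝ) ^ ((1 : ℝ) / 6) := by
  have h1 : (1 : ℝ) ≤ n := by exact_mod_cast hn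
  refine ⟨(n : ℝ) ^ ((1 : ℝ) / 6), Real.one_le_rpow h1 (by norm_num), ?_, rfl⟩
  rw [← Real.rpow_natCast, ← Real.rpow_mul (by linarith)]
  norm_num

theorem tendsto_expCount_ratio (k : ℕ) (hk : 1 ≤ k) :
    Tendsto (fun n => expCount (n - k) / expCount n) atTop (𝓝 0) := by
  have h1 : Tendsto (fun n => expCount n / expCount (n + 1)) atTop (𝓝 0) := by
    have hlim : Tendsto (fun n : ℕ => 9 / ((n + 1 : ℕ) : ℝ) ^ ((1 : ℝ) / 6)) atTop (𝓝 0) := by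
      refine Tendsto.div_atTop tendsto_const_nhds ?_
      exact (tendsto_rpow_atTop (by norm_num)).comp
        (tendsto_natCast_atTop_atTop.comp (tendsto_add_atTop_nat 1))
    refine squeeze_zero (fun n => (div_pos (expCount_pos _) (expCount_pos _)).le) ?_ hlim
    intro n
    obtain ⟨x, hx1, hx6, hx⟩ := exists_sixth_root (n + 1) (by omega)
    rw [← hx, div_le_iff₀ (expCount_pos _)]
    exact expCount_le_succ n hx1 (by rw [hx6]; push_cast; rfl)
  have h2 : ∀ k : ℕ, Tendsto (fun n => expCount n / expCount (n + (k + 1))) atTop (𝓝 0) := by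
    intro k
    induction k with
    | zero => exact h1
    | succ k ih =>
      have h3 := ih.mul (h1.comp (tendsto_add_atTop_nat (k + 1)))
      rw [mul_zero] at h3
      refine h3.congr fun n => ?_
      have := (expCount_pos (n + (k + 1))).ne'
      have := (expCount_pos (n + (k + 1) + 1)).ne'
      simp only [Function.comp]
      rw [div_mul_div_cancel₀ (by assumption)]
      rfl
  obtain ⟨k, rfl⟩ := Nat.exists_eq_succ_of_ne_zero (Nat.one_le_iff_ne_zero.1 hk)
  rw [← tendsto_add_atTop_iff_nat (k + 1)]
  refine (h2 k).congr fun n => ?_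
  rw [Nat.succ_eq_add_one, Nat.add_sub_cancel]

theorem factorial_add_three (n : ℕ) :
    ((n + 3).factorial : ℝ) = (n + 3) * (n + 2) * (n + 1) * n.factorial := by
  rw [Nat.factorial_succ, Nat.factorial_succ, Nat.factorial_succ]; push_cast; ring

/-- Three points are added at once so that they can form a triangle. Together with
`expCount_add_three_le` this shows that such a step multiplies `expCount` by about √n. -/
theorem le_expCount_add_three (n : ℕ) :
    ((n : ℝ) + 1) / √((n : ℝ) + 3) * expCount n ≤ expCount (n + 3) := by
  have h1 := (numInv_bounds n).1
  have h2 := (numInv_bounds (n + 1)).1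
  have h3 := (numInv_bounds (n + 2)).1
  have hB := numB_triangle_le (n + 1)
  rw [Nat.add_sub_cancel] at hB
  have hB' : ((n : ℝ) + 2) * (n + 1) * numB n ≤ numB (n + 3) := by
    have : (((n + 1 + 1) * (n + 1) * numB n : ℕ) : ℝ) ≤ (numB (n + 1 + 2) : ℝ) := by
      exact_mod_cast hB
    push_cast at this
    calc _ = ((n : ℝ) + 1 + 1) * (n + 1) * numB n := by ring
      _ ≤ _ := this
  push_cast at h2 h3
  set s1 := √((n : ℝ) + 1)
  have e1 : s1 ^ 2 = (n : ℝ) + 1 := Real.sq_sqrt (by positivity)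
  have e2 : s1 ≤ √((n : ℝ) + 1 + 1) := Real.sqrt_le_sqrt (by linarith)
  rw [show (n : ℝ) + 2 + 1 = n + 3 by ring] at h3
  set s3 := √((n : ℝ) + 3)
  have e3 : s3 ^ 2 = (n : ℝ) + 3 := Real.sq_sqrt (by positivity)
  have p1 : 0 < s1 := Real.sqrt_pos.2 (by positivity)
  have p3 : 0 < s3 := Real.sqrt_pos.2 (by positivity)
  have i0 : (0 : ℝ) < numInv n := by exact_mod_cast numInv_pos n
  have i1 : (0 : ℝ) < numInv (n + 1) := by exact_mod_cast numInv_pos (n + 1)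
  have i2 : (0 : ℝ) < numInv (n + 2) := by exact_mod_cast numInv_pos (n + 2)
  have b0 : (0 : ℝ) < numB n := by exact_mod_cast numB_pos n
  have hI : s3 * ((n : ℝ) + 1) * numInv n ≤ numInv (n + 3) := by
    calc s3 * ((n : ℝ) + 1) * numInv n = s3 * (s1 * (s1 * numInv n)) := by rw [← e1]; ring
      _ ≤ s3 * (s1 * numInv (n + 1)) := by gcongr
      _ ≤ s3 * numInv (n + 2) := by
          gcongr
          exact (mul_le_mul_of_nonneg_right e2 i1.le).trans h2
      _ ≤ _ := h3
  have hprod := mul_le_mul hI hB' (by positivity) (by positivity)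
  have f0 : (0 : ℝ) < n.factorial := by exact_mod_cast n.factorial_pos
  unfold expCount
  rw [factorial_add_three, le_div_iff₀ (by positivity)]
  calc ((n : ℝ) + 1) / s3 * (numInv n * numB n / n.factorial) *
        ((n + 3) * (n + 2) * (n + 1) * n.factorial)
      = ((n : ℝ) + 1) * numInv n * (((n : ℝ) + 2) * (n + 1) * numB n) * (((n : ℝ) + 3) / s3) := by
        field_simp
    _ = s3 * ((n : ℝ) + 1) * numInv n * (((n : ℝ) + 2) * (n + 1) * numB n) := by
        rw [← e3]; field_simp
    _ ≤ _ := hprod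

theorem expCount_add_three_le (n : ℕ) {x : ℝ} (hx : 1 ≤ x) (hx6 : x ^ 6 = (n : ℝ) + 3)
    (hpos : 0 < x ^ 6 - 9 * x ^ 2 - 14 * x ^ 4) :
    expCount (n + 3) ≤ (x ^ 3 + 1) ^ 3 / (x ^ 6 - 9 * x ^ 2 - 14 * x ^ 4) * expCount n := by
  have hx0 : 0 < x := by linarith
  have hI : (numInv (n + 3) : ℝ) ≤ (x ^ 3 + 1) ^ 3 * numInv n := by
    have h1 := (numInv_bounds n).2
    have h2 := (numInv_bounds (n + 1)).2
    have h3 := (numInv_bounds (n + 2)).2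
    have e3 : √((n : ℝ) + 3) = x ^ 3 := by
      rw [← hx6, show x ^ 6 = (x ^ 3) ^ 2 by ring, Real.sqrt_sq (by positivity)]
    push_cast at h2 h3
    have e1 : √((n : ℝ) + 1) ≤ x ^ 3 := e3 ▸ Real.sqrt_le_sqrt (by linarith)
    have e2 : √((n : ℝ) + 1 + 1) ≤ x ^ 3 := e3 ▸ Real.sqrt_le_sqrt (by linarith)
    rw [show (n : ℝ) + 2 + 1 = n + 3 by ring, e3] at h3
    have i0 : (0 : ℝ) < numInv n := by exact_mod_cast numInv_pos n
    have i1 : (0 : ℝ) < numInv (n + 1) := by exact_mod_cast numInv_pos (n + 1)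
    have i2 : (0 : ℝ) < numInv (n + 2) := by exact_mod_cast numInv_pos (n + 2)
    calc (numInv (n + 3) : ℝ) ≤ (x ^ 3 + 1) * numInv (n + 2) := h3
      _ ≤ (x ^ 3 + 1) * ((x ^ 3 + 1) * numInv (n + 1)) := by
          gcongr
          exact h2.trans (by gcongr)
      _ ≤ (x ^ 3 + 1) * ((x ^ 3 + 1) * ((x ^ 3 + 1) * numInv n)) := by
          gcongr
          exact h1.trans (by gcongr)
      _ = _ := by ring
  -- In the recursion of `numB_le` multiplied by n + 3 = x^6, the loop and edge terms cost at most
  -- 9x² and 14x⁴ times `numB (n + 3)`.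
  have hB : (x ^ 6 - 9 * x ^ 2 - 14 * x ^ 4) * numB (n + 3) ≤
      ((n : ℝ) + 3) * (n + 2) * (n + 1) * numB n := by
    have hcast : x ^ 6 = ((n + 3 : ℕ) : ℝ) := by rw [hx6]; push_cast; rfl
    have g1 := mul_numB_pred_le (n + 3) (K := x ^ 2) (one_le_pow₀ hx) (by rw [← hcast]; ring)
    have g2 := descFactorial_two_mul_numB_le (n + 3) (K := x ^ 2) (one_le_pow₀ hx)
      (by rw [← hcast]; ring)
    have g3 : (numB (n + 3) : ℝ) ≤ numB (n + 2) + 2 * (n + 2) * numB (n + 1) +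
        (n + 2) * (n + 1) * numB n := by
      have h : (numB (n + 1 + 2) : ℝ) ≤ ((numB (n + 1 + 1) + 2 * (n + 1 + 1) * numB (n + 1) +
          (n + 1 + 1) * (n + 1) * numB (n + 1 - 1) : ℕ) : ℝ) := by
        exact_mod_cast numB_le (n + 1)
      rw [Nat.add_sub_cancel] at h
      push_cast at h
      calc _ ≤ _ := h
        _ = _ := by ring
    have e2 : ((n + 3).descFactorial 2 : ℝ) = (n + 3) * (n + 2) := by
      simp [Nat.descFactorial]; ring
    rw [e2] at g2
    rw [show n + 3 - 2 = n + 1 from rfl] at g2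
    rw [show n + 3 - 1 = n + 2 from rfl] at g1
    rw [← hcast] at g1
    have hn3 : (0 : ℝ) ≤ (n : ℝ) + 3 := by positivity
    have g4 := mul_le_mul_of_nonneg_left g3 hn3
    rw [← hx6] at g4 g2 ⊢
    nlinarith
  have hprod := mul_le_mul hI hB (by positivity) (by positivity)
  have f0 : (0 : ℝ) < n.factorial := by exact_mod_cast n.factorial_pos
  unfold expCount
  rw [factorial_add_three, div_mul_div_comm, div_le_div_iff₀ (by positivity) (by positivity)]
  calc _ = (numInv (n + 3) : ℝ) * ((x ^ 6 - 9 * x ^ 2 - 14 * x ^ 4) * numB (n + 3)) *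
        n.factorial := by ring
    _ ≤ (x ^ 3 + 1) ^ 3 * numInv n * (((n : ℝ) + 3) * (n + 2) * (n + 1) * numB n) *
        n.factorial := mul_le_mul_of_nonneg_right hprod f0.le
    _ = _ := by ring

/-- The two growth factors are about √k and √n with n at least about 2k, so their ratio is near 1/√2
or below, which is less than 3/4. -/
theorem expCount_ratio_le : ∃ k₀ : ℕ, ∀ k n : ℕ, k₀ ≤ k → 2 * (k + 3) ≤ n + 3 →
    expCount (k + 3) * expCount n ≤ 3 / 4 * (expCount k * expCount (n + 3)) := by
  refine ⟨1000 ^ 6, fun k n hk hn => ?_⟩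
  obtain ⟨x, hx1, hx6, -⟩ := exists_sixth_root (k + 3) (by omega)
  have hx : 1000 ≤ x := by
    by_contra hlt
    push Not at hlt
    have h1 : x ^ 6 < 1000 ^ 6 := pow_lt_pow_left₀ hlt (by linarith) (by norm_num)
    rw [hx6] at h1
    have h2 : k + 3 < 1000 ^ 6 := by exact_mod_cast h1
    omega
  have hx0 : 0 < x := by linarith
  have hx6' : x ^ 6 = (k : ℝ) + 3 := by rw [hx6]; push_cast; rfl
  have hden : 0.99 * x ^ 6 ≤ x ^ 6 - 9 * x ^ 2 - 14 * x ^ 4 := by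
    have h1 : 1000000 ≤ x ^ 2 := by nlinarith
    have h2 : 1000000 * x ^ 2 ≤ x ^ 4 := by
      calc 1000000 * x ^ 2 ≤ x ^ 2 * x ^ 2 := by gcongr
        _ = x ^ 4 := by ring
    have h3 : 1000000 * x ^ 4 ≤ x ^ 6 := by
      calc 1000000 * x ^ 4 ≤ x ^ 2 * x ^ 4 := by gcongr
        _ = x ^ 6 := by ring
    linarith
  have hden0 : 0 < x ^ 6 - 9 * x ^ 2 - 14 * x ^ 4 := lt_of_lt_of_le (by positivity) hden
  have hx3 : 1000 ≤ x ^ 3 := by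
    calc (1000 : ℝ) ≤ 1000 ^ 3 := by norm_num
      _ ≤ x ^ 3 := by gcongr
  have hup : expCount (k + 3) ≤ 1.02 * x ^ 3 * expCount k := by
    refine (expCount_add_three_le k hx1 hx6' hden0).trans ?_
    refine mul_le_mul_of_nonneg_right ?_ (expCount_pos k).le
    rw [div_le_iff₀ hden0]
    calc (x ^ 3 + 1) ^ 3 ≤ (1.001 * x ^ 3) ^ 3 := by gcongr; linarith
      _ ≤ 1.02 * x ^ 3 * (0.99 * x ^ 6) := by
          have : 0 < x ^ 9 := by positivity
          nlinarith
      _ ≤ _ := by gcongr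
  have hlow : 1.38 * x ^ 3 * expCount n ≤ expCount (n + 3) := by
    refine le_trans ?_ (le_expCount_add_three n)
    refine mul_le_mul_of_nonneg_right ?_ (expCount_pos n).le
    set s := √((n : ℝ) + 3) with hs
    have hs2 : s ^ 2 = (n : ℝ) + 3 := Real.sq_sqrt (by positivity)
    have hs0 : 0 < s := Real.sqrt_pos.2 (by positivity)
    have hns : 2 * x ^ 6 ≤ s ^ 2 := by
      rw [hs2, hx6']
      exact_mod_cast hn
    -- Here 1.4 is below √2. In the end 1.02 / 1.38 < 3/4 suffices.
    have h1 : 1.4 * x ^ 3 ≤ s := by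
      refine le_of_sq_le_sq ?_ hs0.le
      nlinarith [sq_nonneg (x ^ 3)]
    rw [le_div_iff₀ hs0, show (n : ℝ) + 1 = s ^ 2 - 2 by rw [hs2]; ring]
    nlinarith
  have p1 := expCount_pos k
  have p2 := expCount_pos n
  calc expCount (k + 3) * expCount n ≤ 1.02 * x ^ 3 * expCount k * expCount n := by gcongr
    _ ≤ 3 / 4 * (expCount k * (1.38 * x ^ 3 * expCount n)) := by
        have : 0 < x ^ 3 * expCount k * expCount n := by positivity
        nlinarith
    _ ≤ _ := by gcongr

/-! ### Most graphs are connected -/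

/-- A bound for the proportion of disconnected graphs. -/
noncomputable def discBound (n : ℕ) : ℝ :=
  ∑ k ∈ Finset.Icc 1 (n / 2), expCount k * expCount (n - k) / expCount n

/-- The finitely many terms with small k tend to 0. For the others, the shift (k, n) ↦ (k + 3, n +
3) keeps n - k and shrinks the term by 3/4. -/
theorem exists_discBound_le : ∃ ε : ℕ → ℝ, Tendsto ε atTop (𝓝 0) ∧
    ∀ n, discBound (n + 3) ≤ ε n + 3 / 4 * discBound n := by
  obtain ⟨k₀, hk₀⟩ := expCount_ratio_le
  refine ⟨fun n => ∑ k ∈ Finset.Icc 1 (k₀ + 3),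
    expCount k * (expCount (n + 3 - k) / expCount (n + 3)), ?_, ?_⟩
  · rw [← Finset.sum_const_zero (s := Finset.Icc 1 (k₀ + 3)) (ι := ℕ)]
    refine tendsto_finsetSum _ fun k hk => ?_
    have := ((tendsto_expCount_ratio k (Finset.mem_Icc.1 hk).1).comp
      (tendsto_add_atTop_nat 3)).const_mul (expCount k)
    rwa [mul_zero] at this
  · intro n
    have hpos : ∀ k m n, 0 ≤ expCount k * expCount m / expCount n := fun k m n =>
      (div_pos (mul_pos (expCount_pos _) (expCount_pos _)) (expCount_pos _)).le
    calc discBound (n + 3)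
        ≤ ∑ k ∈ Finset.Icc 1 (k₀ + 3) ∪ (Finset.Icc (k₀ + 1) ((n + 3) / 2 - 3)).map (addRightEmbedding 3),
            expCount k * expCount (n + 3 - k) / expCount (n + 3) := by
          refine Finset.sum_le_sum_of_subset_of_nonneg ?_ fun _ _ _ => hpos _ _ _
          intro k hk
          rw [Finset.mem_Icc] at hk
          rw [Finset.mem_union, Finset.mem_Icc, Finset.mem_map]
          by_cases h : k ≤ k₀ + 3
          · exact Or.inl ⟨hk.1, h⟩
          · refine Or.inr ⟨k - 3, Finset.mem_Icc.2 ⟨by omega, by omega⟩, ?_⟩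
            simp only [addRightEmbedding_apply]
            omega
      _ ≤ ∑ k ∈ Finset.Icc 1 (k₀ + 3), expCount k * expCount (n + 3 - k) / expCount (n + 3) +
          ∑ k ∈ (Finset.Icc (k₀ + 1) ((n + 3) / 2 - 3)).map (addRightEmbedding 3),
            expCount k * expCount (n + 3 - k) / expCount (n + 3) := by
          rw [← Finset.sum_union_inter]
          exact le_add_of_nonneg_right (Finset.sum_nonneg fun _ _ => hpos _ _ _)
      _ ≤ _ := by
          refine add_le_add (le_of_eq (Finset.sum_congr rfl fun k _ => mul_div_assoc _ _ _)) ?_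
          rw [Finset.sum_map, discBound, Finset.mul_sum]
          calc _ ≤ ∑ k ∈ Finset.Icc (k₀ + 1) ((n + 3) / 2 - 3),
                3 / 4 * (expCount k * expCount (n - k) / expCount n) := by
                refine Finset.sum_le_sum fun k hk => ?_
                rw [Finset.mem_Icc] at hk
                have := hk₀ k n (by omega) (by omega)
                have p1 := expCount_pos (n - k)
                have p2 := expCount_pos n
                have p3 := expCount_pos (n + 3)
                rw [addRightEmbedding_apply, show n + 3 - (k + 3) = n - k by omega,
                  ← mul_div_assoc, div_le_div_iff₀ p3 p2]
                calc _ = expCount (n - k) * (expCount (k + 3) * expCount n) := by ring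
                  _ ≤ expCount (n - k) * (3 / 4 * (expCount k * expCount (n + 3))) := by gcongr
                  _ = _ := by ring
            _ ≤ _ := by
                refine Finset.sum_le_sum_of_subset_of_nonneg ?_ fun _ _ _ =>
                  mul_nonneg (by norm_num) (hpos _ _ _)
                exact Finset.Icc_subset_Icc (by omega) (by omega)

theorem eventually_discBound_le : ∀ᶠ n in atTop, discBound n ≤ 1 / 2 := by
  obtain ⟨ε, hε, hrec⟩ := exists_discBound_le
  -- With errors at most 1/16 the recursion has fixed point 1/4; the contribution of the initial
  -- values decays geometrically in each residue class mod 3.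
  obtain ⟨N, hN⟩ := eventually_atTop.1 (hε.eventually_le_const (show (0 : ℝ) < 1 / 16 by norm_num))
  let M : ℝ := max (discBound N) (max (discBound (N + 1)) (discBound (N + 2)))
  have hM0 : 0 ≤ M := le_max_of_le_left (Finset.sum_nonneg fun _ _ =>
    (div_pos (mul_pos (expCount_pos _) (expCount_pos _)) (expCount_pos _)).le)
  have hstep : ∀ j i : ℕ, i < 3 → discBound (N + i + 3 * j) ≤ 1 / 4 + (3 / 4) ^ j * M := by
    intro j
    induction j with
    | zero =>
      intro i hi
      have : discBound (N + i) ≤ M := by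
        interval_cases i
        · exact le_max_left _ _
        · exact (le_max_left _ _).trans (le_max_right _ _)
        · exact (le_max_right _ _).trans (le_max_right _ _)
      simp only [mul_zero, add_zero, pow_zero, one_mul]
      linarith
    | succ j ih =>
      intro i hi
      have h1 := hrec (N + i + 3 * j)
      have h2 := hN (N + i + 3 * j) (by omega)
      have h3 := ih i hi
      rw [show N + i + 3 * (j + 1) = N + i + 3 * j + 3 by ring, pow_succ]
      linarith
  have hlim : Tendsto (fun j : ℕ => (3 / 4 : ℝ) ^ j * M) atTop (𝓝 0) := by
    have := (tendsto_pow_atTop_nhds_zero_of_lt_one (r := (3 / 4 : ℝ)) (by norm_num)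
      (by norm_num)).mul_const M
    rwa [zero_mul] at this
  obtain ⟨J, hJ⟩ := eventually_atTop.1
    (hlim.eventually_le_const (show (0 : ℝ) < 1 / 4 by norm_num))
  refine eventually_atTop.2 ⟨N + 3 * J, fun n hn => ?_⟩
  have h1 := hstep ((n - N) / 3) ((n - N) % 3) (Nat.mod_lt _ (by norm_num))
  rw [show N + (n - N) % 3 + 3 * ((n - N) / 3) = n by omega] at h1
  have h2 := hJ ((n - N) / 3) (by omega)
  linarith

theorem eventually_card_isConn_ge : ∀ᶠ n in atTop, (numInv n * numB n : ℝ) / 2 ≤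
    Nat.card {p : Inv (Fin n) × BStr (Fin n) // IsConn p.1 p.2} := by
  filter_upwards [eventually_discBound_le, eventually_ge_atTop 1] with n hn hn1
  classical
  have hT : (Nat.card {p : Inv (Fin n) × BStr (Fin n) // IsConn p.1 p.2} : ℝ) +
      Nat.card {p : Inv (Fin n) × BStr (Fin n) // ¬ IsConn p.1 p.2} = numInv n * numB n := by
    rw [← Nat.cast_add, ← Nat.card_sum, Nat.card_congr (Equiv.sumCompl
      (fun p : Inv (Fin n) × BStr (Fin n) => IsConn p.1 p.2)), Nat.card_prod, natCard_inv,
      natCard_bStr, Nat.card_fin, Nat.cast_mul]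
  have hD : (Nat.card {p : Inv (Fin n) × BStr (Fin n) // ¬ IsConn p.1 p.2} : ℝ) ≤
      numInv n * numB n * discBound n := by
    have h1 : (Nat.card {p : Inv (Fin n) × BStr (Fin n) // ¬ IsConn p.1 p.2} : ℝ) ≤
        ((∑ k ∈ Finset.Icc 1 (n / 2), n.choose k *
          (numInv k * numB k * (numInv (n - k) * numB (n - k))) : ℕ) : ℝ) := by
      exact_mod_cast card_not_isConn_le n hn1
    refine h1.trans (le_of_eq ?_)
    rw [discBound, Finset.mul_sum, Nat.cast_sum]
    refine Finset.sum_congr rfl fun k hk => ?_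
    have hkn : k ≤ n := by
      have := (Finset.mem_Icc.1 hk).2
      omega
    have i0 : (numInv n : ℝ) ≠ 0 := by exact_mod_cast (numInv_pos n).ne'
    have b0 : (numB n : ℝ) ≠ 0 := by exact_mod_cast (numB_pos n).ne'
    have f0 : (n.factorial : ℝ) ≠ 0 := by exact_mod_cast n.factorial_ne_zero
    have f1 : (k.factorial : ℝ) ≠ 0 := by exact_mod_cast k.factorial_ne_zero
    have f2 : ((n - k).factorial : ℝ) ≠ 0 := by exact_mod_cast (n - k).factorial_ne_zero
    push_cast
    rw [Nat.cast_choose ℝ hkn]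
    simp only [expCount]
    field_simp
  have h0 : (0 : ℝ) ≤ numInv n * numB n := by positivity
  nlinarith

/-! ### Counting labeled subgroups -/

theorem nonempty_labeling {n : ℕ} {H : Subgroup PSL2Z} (h : (visited H).encard = n) :
    Nonempty (visited H ≃ Fin n) := by
  have hfin : (visited H).Finite := Set.finite_of_encard_eq_coe h
  have : Finite (visited H) := hfin
  refine ⟨Finite.equivFinOfCardEq ?_⟩
  rw [Nat.card_coe_set_eq, Set.ncard, h]
  rfl

/-- The subgroups of the set `S` with a labeling of their Stallings graphs. -/
abbrev Labeled (S : Set (Subgroup PSL2Z)) (n : ℕ) : Type :=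
  Σ H : S, visited H.1 ≃ Fin n

theorem card_labeled {S : Set (Subgroup PSL2Z)} (hS : S.Finite) {n : ℕ}
    (h : ∀ H ∈ S, (visited H).encard = n) : Nat.card (Labeled S n) = S.ncard * n.factorial := by
  have := hS.fintype
  have hfin : ∀ H : S, Finite (visited H.1 ≃ Fin n) := fun H => by
    obtain ⟨e⟩ := nonempty_labeling (h H.1 H.2)
    exact Finite.of_equiv _ (e.equivCongr (Equiv.refl (Fin n))).symm
  rw [Nat.card_sigma]
  have hcard : ∀ H : S, Nat.card (visited H.1 ≃ Fin n) = n.factorial := fun H => by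
    obtain ⟨e⟩ := nonempty_labeling (h H.1 H.2)
    rw [Nat.card_congr (e.equivCongr (Equiv.refl (Fin n))), Nat.card_eq_fintype_card,
      Fintype.card_equiv (Equiv.refl _), Fintype.card_fin]
  rw [Finset.sum_congr rfl fun H _ => hcard H, Finset.sum_const, smul_eq_mul, Finset.card_univ,
    ← Nat.card_eq_fintype_card, Nat.card_coe_set_eq]

/-- Labeled graphs as tuples. -/
def labeledGraphEquiv (V : Type) :
    LabeledGraph V ≃ (Σ _ : V, Σ _ : BStr V, Inv V) × Prop × Prop where
  toFun d := (⟨d.root, d.b, d.a⟩, d.dropA, d.dropB)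
  invFun t := ⟨t.1.1, t.1.2.2, t.1.2.1, t.2.1, t.2.2⟩
  left_inv _ := rfl
  right_inv _ := rfl

instance (V : Type) [Finite V] : Finite (LabeledGraph V) :=
  Finite.of_equiv _ (labeledGraphEquiv V).symm

theorem exists_labeledGraph_map (S : Set (Subgroup PSL2Z)) (n : ℕ) :
    ∃ f : Labeled S n → LabeledGraph (Fin n), Function.Injective f ∧
      ∀ q, (f q).Represents q.1.1 q.2 := by
  choose f hf using fun q : Labeled S n => exists_represents q.1.1 q.2
  refine ⟨f, ?_, hf⟩
  rintro ⟨⟨H, hH⟩, e⟩ ⟨⟨H', hH'⟩, e'⟩ h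
  have h1 := hf ⟨⟨H, hH⟩, e⟩
  have h2 := hf ⟨⟨H', hH'⟩, e'⟩
  rw [← h] at h2
  have h3 := h1.sigma_eq h2
  simp only [Sigma.mk.injEq] at h3
  obtain ⟨rfl, h4⟩ := h3
  rw [eq_of_heq h4]

theorem subgroupsOfSize_finite (n : ℕ) : (subgroupsOfSize n).Finite := by
  obtain ⟨f, hf, -⟩ := exists_labeledGraph_map (subgroupsOfSize n) n
  have hfin : Finite (Labeled (subgroupsOfSize n) n) := Finite.of_injective f hf
  have hsurj : Function.Surjective (Sigma.fst : Labeled (subgroupsOfSize n) n → _) := fun H => by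
    obtain ⟨e⟩ := nonempty_labeling H.2.2
    exact ⟨⟨H, e⟩, rfl⟩
  exact (Finite.of_surjective _ hsurj : Finite (subgroupsOfSize n))

theorem cyclicallyReducedSubgroupsOfSize_subset (n : ℕ) :
    cyclicallyReducedSubgroupsOfSize n ⊆ subgroupsOfSize n := fun _ h => h.1

theorem IsConn.exists_mem_cyclicallyReduced {n : ℕ} {τ : Inv (Fin n)} {R : BStr (Fin n)}
    (h : IsConn τ R) (r : Fin n) :
    ∃ q : Labeled (cyclicallyReducedSubgroupsOfSize n) n,
      (⟨r, τ, R, False, False⟩ : LabeledGraph (Fin n)).Represents q.1.1 q.2 := by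
  obtain ⟨H, e, hfg, hcyc, hrep⟩ := h.exists_subgroup r
  refine ⟨⟨⟨H, ⟨hfg, ?_⟩, hcyc⟩, e⟩, hrep⟩
  change (visited H).encard = n
  rw [Set.encard_congr (e.trans (Equiv.Set.univ (Fin n)).symm), Set.encard_univ]
  simp

theorem cyclicallyReducedSubgroupsOfSize_nonempty (n : ℕ) (hn : 1 ≤ n) :
    (cyclicallyReducedSubgroupsOfSize n).Nonempty := by
  obtain ⟨τ, R, h⟩ := exists_isConn n hn
  obtain ⟨q, -⟩ := h.exists_mem_cyclicallyReduced ⟨0, hn⟩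
  exact ⟨q.1.1, q.1.2⟩

/-- A root and a connected pair yield a labeled cyclically reduced subgroup. No flag is set, so the
Stallings graph gives back root, τ and R. -/
theorem card_isConn_le (n : ℕ) :
    n * Nat.card {p : Inv (Fin n) × BStr (Fin n) // IsConn p.1 p.2} ≤
      (cyclicallyReducedSubgroupsOfSize n).ncard * n.factorial := by
  have hfin : (cyclicallyReducedSubgroupsOfSize n).Finite :=
    (subgroupsOfSize_finite n).subset (cyclicallyReducedSubgroupsOfSize_subset n)
  have hcard := card_labeled hfin (n := n) fun H hH => hH.1.2
  obtain ⟨f, hf, -⟩ := exists_labeledGraph_map (cyclicallyReducedSubgroupsOfSize n) n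
  have : Finite (Labeled (cyclicallyReducedSubgroupsOfSize n) n) := Finite.of_injective f hf
  rw [← hcard]
  nth_rewrite 1 [← Nat.card_fin n]
  rw [← Nat.card_prod]
  choose g hg using fun t : Fin n × {p : Inv (Fin n) × BStr (Fin n) // IsConn p.1 p.2} =>
    t.2.2.exists_mem_cyclicallyReduced t.1
  refine Nat.card_le_card_of_injective g ?_
  rintro ⟨r, ⟨⟨τ, R⟩, h⟩⟩ ⟨r', ⟨⟨τ', R'⟩, h'⟩⟩ heq
  have h1 := hg ⟨r, ⟨⟨τ, R⟩, h⟩⟩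
  have h2 := hg ⟨r', ⟨⟨τ', R'⟩, h'⟩⟩
  rw [← heq] at h2
  have e1 : r = r' := h1.root_eq.symm.trans h2.root_eq
  have e2 : τ = τ' := by
    ext i
    have h3 := (h1.a_iff i (τ.1 i)).2 ⟨rfl, fun h => h.1⟩
    rw [((h2.a_iff i (τ.1 i)).1 h3).1]
  have e3 : R = R' := by
    ext i j
    exact ⟨fun h3 => ((h2.b_iff i j).1 ((h1.b_iff i j).2 ⟨h3, fun h => h.1⟩)).1,
      fun h3 => ((h1.b_iff i j).1 ((h2.b_iff i j).2 ⟨h3, fun h => h.1⟩)).1⟩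
  subst e1 e2 e3
  rfl

/-- The `b`-edges that do not touch `r`. -/
def awayFrom {n : ℕ} (R : BStr (Fin n)) (r : Fin n) : Fin n → Fin n → Prop :=
  fun v w => R.1 v w ∧ v ≠ r ∧ w ≠ r

theorem isPartialInj_awayFrom {n : ℕ} (R : BStr (Fin n)) (r : Fin n) :
    IsPartialInj (awayFrom R r) :=
  ⟨fun _ _ _ h1 h2 => R.2.fun_ h1.1 h2.1, fun _ _ _ h1 h2 => R.2.inj h1.1 h2.1⟩

/-- Deleting the edges at r can newly undefine only r and its predecessor. -/
theorem numUndef_awayFrom_le {n : ℕ} (R : BStr (Fin n)) (r : Fin n) :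
    numUndef (awayFrom R r) ≤ numEnds R + 2 := by
  classical
  rw [numUndef, Nat.card_eq_fintype_card, Fintype.card_subtype]
  have hsub : (Finset.univ.filter fun v => ∀ w, ¬ awayFrom R r v w) ⊆
      (Finset.univ.filter fun v => ∀ w, ¬ R.1 v w) ∪
        ({r} ∪ Finset.univ.filter fun v => R.1 v r) := by
    intro v hv
    simp only [Finset.mem_filter, Finset.mem_univ, true_and, Finset.mem_union,
      Finset.mem_singleton] at hv ⊢
    by_contra hc
    push Not at hc
    obtain ⟨⟨w, hw⟩, h1, h2⟩ := hc
    exact hv w ⟨hw, h1, by rintro rfl; exact h2 hw⟩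
  refine (Finset.card_le_card hsub).trans ((Finset.card_union_le _ _).trans ?_)
  refine Nat.add_le_add (le_of_eq (by unfold numEnds; congr)) ?_
  refine (Finset.card_union_le _ _).trans ?_
  rw [Finset.card_singleton]
  have : (Finset.univ.filter fun v => R.1 v r).card ≤ 1 := by
    rw [Finset.card_le_one]
    intro x hx y hy
    simp only [Finset.mem_filter, Finset.mem_univ, true_and] at hx hy
    exact R.2.inj hx hy
  omega

theorem card_nonParabolic_le (n : ℕ) :
    {H | H ∈ subgroupsOfSize n ∧ NonParabolic H}.ncard * n.factorial ≤
      4 * (n * ∑ R : BStr (Fin n), noCycleBound (numEnds R + 2) n) := by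
  classical
  set S : Set (Subgroup PSL2Z) := {H | H ∈ subgroupsOfSize n ∧ NonParabolic H} with hS
  have hfin : S.Finite := (subgroupsOfSize_finite n).subset fun _ h => h.1
  rw [← card_labeled hfin (n := n) fun H hH => hH.1.2]
  obtain ⟨f, hf, hrep⟩ := exists_labeledGraph_map S n
  let X : Type := (Σ r : Fin n, Σ R : BStr (Fin n), {τ : Inv (Fin n) // NoCycle (awayFrom R r) τ}) ×
    Prop × Prop
  have hac : ∀ q, NoCycle (awayFrom (f q).b (f q).root) (f q).a := fun q v =>
    (hrep q).acyclic q.1.2.2 v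
  have hle : Nat.card (Labeled S n) ≤ Nat.card X := by
    refine Nat.card_le_card_of_injective (fun q =>
      ((⟨(f q).root, (f q).b, (f q).a, hac q⟩, (f q).dropA, (f q).dropB) : X)) ?_
    intro q q' h
    apply hf
    apply (labeledGraphEquiv _).injective
    exact congrArg (fun t : X => ((⟨t.1.1, t.1.2.1, t.1.2.2.1⟩, t.2.1, t.2.2) :
      (Σ _ : Fin n, Σ _ : BStr (Fin n), Inv (Fin n)) × Prop × Prop)) h
  refine hle.trans ?_
  rw [Nat.card_prod, Nat.card_prod, Nat.card_sigma]
  have hprop : Nat.card Prop = 2 := by rw [Nat.card_eq_fintype_card, Fintype.card_prop]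
  rw [hprop, mul_comm]
  -- The factor 4 counts the values of the two flags.
  refine Nat.mul_le_mul_left 4 ?_
  calc _ ≤ ∑ _r : Fin n, ∑ R : BStr (Fin n), noCycleBound (numEnds R + 2) n := by
        refine Finset.sum_le_sum fun r _ => ?_
        rw [Nat.card_sigma]
        refine Finset.sum_le_sum fun R _ => ?_
        exact card_noCycle_le _ n _ (Nat.card_fin n) _ (isPartialInj_awayFrom R r)
          (numUndef_awayFrom_le R r)
    _ = _ := by rw [Finset.sum_const, Finset.card_univ, Fintype.card_fin, smul_eq_mul]

/-- Linearizes the power, so that only the mean number of ends is needed. -/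
theorem rpow_le_one_add {x γ : ℝ} (hx : 0 ≤ x) (h0 : 0 ≤ γ) (h1 : γ ≤ 1) : x ^ γ ≤ 1 + x := by
  rcases le_total x 1 with h | h
  · have := Real.rpow_le_one hx h h0
    linarith
  · have := Real.rpow_le_rpow_of_exponent_le h h1
    rw [Real.rpow_one] at this
    linarith

theorem sum_noCycleBound_le {α : ℝ} (hα₀ : 0 < α) (hα₁ : α < 1 / 6) :
    ∃ C : ℝ, 0 < C ∧ ∀ n : ℕ, 1 ≤ n →
      ((∑ R : BStr (Fin n), noCycleBound (numEnds R + 2) n : ℕ) : ℝ) ≤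
        C * (n : ℝ) ^ (-α) * (numInv n * numB n) := by
  obtain ⟨C, hC, hbound⟩ := noCycleBound_le_rpow (β := 3 * α) (by linarith) (by linarith)
  refine ⟨10 * C, by linarith, fun n hn => ?_⟩
  have hn1 : (1 : ℝ) ≤ n := by exact_mod_cast hn
  have hn0 : (0 : ℝ) < n := by linarith
  obtain ⟨x, hx1, hx6, hx⟩ := exists_sixth_root n hn
  have hx0 : 0 < x := by linarith
  -- K = n^(2/3) is the order of the mean number of ends. Writing k/n as (K/n)(k/K) isolates the
  -- factor n^(-α); averaging 1 + k/K gives 1 + 2 + 7 = 10.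
  set K : ℝ := x ^ 4 with hK
  have hK1 : 1 ≤ K := one_le_pow₀ hx1
  have hK0 : 0 < K := by linarith
  have hKn : (K / n) ^ (3 * α) = (n : ℝ) ^ (-α) := by
    have e1 : K / n = (n : ℝ) ^ (-(1 : ℝ) / 3) := by
      have e2 : K / n = (x ^ 2)⁻¹ := by
        rw [← hx6, hK]; field_simp
      rw [e2, hx, ← Real.rpow_natCast, ← Real.rpow_mul hn0.le, ← Real.rpow_neg hn0.le]
      norm_num
    rw [e1, ← Real.rpow_mul hn0.le]
    congr 1
    ring
  have hends : ∑ R : BStr (Fin n), (numEnds R : ℝ) ≤ 7 * K * numB n := by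
    have h1 : ∑ R : BStr (Fin n), (numEnds R : ℝ) ≤ n.descFactorial 2 * numB (n - 2) := by
      exact_mod_cast sum_numEnds_le n
    have h2 := descFactorial_two_mul_numB_le n (K := x ^ 2) (one_le_pow₀ hx1)
      (by rw [← hx6]; ring)
    calc _ ≤ _ := h1.trans h2
      _ = _ := by rw [hK]; ring
  have hI : (0 : ℝ) ≤ numInv n := Nat.cast_nonneg _
  have hB : (0 : ℝ) ≤ numB n := Nat.cast_nonneg _
  have hterm : ∀ R : BStr (Fin n), (noCycleBound (numEnds R + 2) n : ℝ) ≤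
      C * (n : ℝ) ^ (-α) * numInv n * (1 + 2 / K + numEnds R / K) := by
    intro R
    have h1 := hbound (numEnds R + 2) n (by omega) hn
    have e : (((numEnds R + 2 : ℕ) : ℝ) / n) ^ (3 * α) =
        (K / n) ^ (3 * α) * (((numEnds R + 2 : ℕ) : ℝ) / K) ^ (3 * α) := by
      rw [← Real.mul_rpow (by positivity) (by positivity)]
      congr 1
      field_simp
    rw [e, hKn] at h1
    have h2 := rpow_le_one_add (x := ((numEnds R + 2 : ℕ) : ℝ) / K) (γ := 3 * α) (by positivity)
      (by linarith) (by linarith)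
    calc _ ≤ _ := h1
      _ = C * (n : ℝ) ^ (-α) * numInv n * (((numEnds R + 2 : ℕ) : ℝ) / K) ^ (3 * α) := by ring
      _ ≤ C * (n : ℝ) ^ (-α) * numInv n * (1 + ((numEnds R + 2 : ℕ) : ℝ) / K) := by gcongr
      _ = _ := by push_cast; ring
  rw [Nat.cast_sum]
  calc _ ≤ ∑ R : BStr (Fin n), C * (n : ℝ) ^ (-α) * numInv n * (1 + 2 / K + numEnds R / K) :=
        Finset.sum_le_sum fun R _ => hterm R
    _ = C * (n : ℝ) ^ (-α) * numInv n *
          (numB n * (1 + 2 / K) + (∑ R : BStr (Fin n), (numEnds R : ℝ)) / K) := by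
        rw [← Finset.mul_sum, Finset.sum_add_distrib, Finset.sum_const, nsmul_eq_mul,
          card_bStr_fin, Finset.sum_div]
    _ ≤ C * (n : ℝ) ^ (-α) * numInv n * (numB n * (1 + 2) + 7 * K * numB n / K) := by
        have h2 : 2 / K ≤ 2 := div_le_self (by norm_num) hK1
        gcongr
    _ = _ := by field_simp; ring

theorem exists_nonParabolic_bound {α : ℝ} (hα₀ : 0 < α) (hα₁ : α < 1 / 6) :
    ∃ C : ℝ, 0 < C ∧ ∀ᶠ n : ℕ in atTop,
      ({H | H ∈ subgroupsOfSize n ∧ NonParabolic H}.ncard : ℝ) ≤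
        C * (n : ℝ) ^ (-α) * (cyclicallyReducedSubgroupsOfSize n).ncard := by
  obtain ⟨C, hC, hbound⟩ := sum_noCycleBound_le hα₀ hα₁
  -- The factor 4 from the flags and the factor 2 from the proportion of connected graphs.
  refine ⟨8 * C, by linarith, ?_⟩
  filter_upwards [eventually_card_isConn_ge, eventually_ge_atTop 1] with n hconn hn
  have h1 : ({H | H ∈ subgroupsOfSize n ∧ NonParabolic H}.ncard : ℝ) * n.factorial ≤
      4 * (n * ((∑ R : BStr (Fin n), noCycleBound (numEnds R + 2) n : ℕ) : ℝ)) := by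
    exact_mod_cast card_nonParabolic_le n
  have h2 : (n : ℝ) * Nat.card {p : Inv (Fin n) × BStr (Fin n) // IsConn p.1 p.2} ≤
      (cyclicallyReducedSubgroupsOfSize n).ncard * n.factorial := by
    exact_mod_cast card_isConn_le n
  have h3 := hbound n hn
  have hf : (0 : ℝ) < n.factorial := by exact_mod_cast n.factorial_pos
  have hp : (0 : ℝ) ≤ C * (n : ℝ) ^ (-α) := by positivity
  refine le_of_mul_le_mul_right ?_ hf
  calc _ ≤ _ := h1
    _ ≤ 4 * (n * (C * (n : ℝ) ^ (-α) * (numInv n * numB n))) := by gcongr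
    _ = 8 * (C * (n : ℝ) ^ (-α)) * (n * ((numInv n * numB n : ℝ) / 2)) := by ring
    _ ≤ 8 * (C * (n : ℝ) ^ (-α)) *
          (n * Nat.card {p : Inv (Fin n) × BStr (Fin n) // IsConn p.1 p.2}) := by gcongr
    _ ≤ 8 * (C * (n : ℝ) ^ (-α)) *
          ((cyclicallyReducedSubgroupsOfSize n).ncard * n.factorial) := by gcongr
    _ = _ := by ring

/-- Handles both families at once: the numerator is bounded over all subgroups of size n, the
denominator from below by the cyclically reduced ones. -/
theorem isBigO_uniformProb {α C : ℝ} (hC : 0 < C) {S : ℕ → Set (Subgroup PSL2Z)}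
    (h1 : ∀ n, cyclicallyReducedSubgroupsOfSize n ⊆ S n) (h2 : ∀ n, S n ⊆ subgroupsOfSize n)
    (h : ∀ᶠ n : ℕ in atTop, ({H | H ∈ subgroupsOfSize n ∧ NonParabolic H}.ncard : ℝ) ≤
        C * (n : ℝ) ^ (-α) * (cyclicallyReducedSubgroupsOfSize n).ncard) :
    (fun n : ℕ => uniformProb (S n) NonParabolic) =O[atTop] (fun n : ℕ => (n : ℝ) ^ (-α)) := by
  refine Asymptotics.IsBigO.of_bound C ?_
  filter_upwards [h] with n hn
  have hp : (0 : ℝ) ≤ (n : ℝ) ^ (-α) := by positivity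
  have hprob : 0 ≤ uniformProb (S n) NonParabolic := by unfold uniformProb; positivity
  rw [Real.norm_of_nonneg hp, Real.norm_of_nonneg hprob]
  have hle1 : ((cyclicallyReducedSubgroupsOfSize n).ncard : ℝ) ≤ (S n).ncard := by
    exact_mod_cast Set.ncard_le_ncard (h1 n) ((subgroupsOfSize_finite n).subset (h2 n))
  have hle2 : ({H | H ∈ S n ∧ NonParabolic H}.ncard : ℝ) ≤
      {H | H ∈ subgroupsOfSize n ∧ NonParabolic H}.ncard := by
    have hss : {H | H ∈ S n ∧ NonParabolic H} ⊆ {H | H ∈ subgroupsOfSize n ∧ NonParabolic H} :=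
      fun H hH => ⟨h2 n hH.1, hH.2⟩
    exact_mod_cast Set.ncard_le_ncard hss ((subgroupsOfSize_finite n).subset fun _ h => h.1)
  refine div_le_of_le_mul₀ (Nat.cast_nonneg _) (by positivity) ?_
  calc _ ≤ _ := hle2.trans hn
    _ ≤ _ := by gcongr

end ModularSubgroups

theorem mainTheorem2 (α : ℝ) (hα₀ : 0 < α) (hα₁ : α < 1 / 6) :
    (∀ n : ℕ, 1 ≤ n →
      (ModularSubgroups.subgroupsOfSize n).Finite ∧
      (ModularSubgroups.subgroupsOfSize n).Nonempty ∧
      (ModularSubgroups.cyclicallyReducedSubgroupsOfSize n).Finite ∧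
      (ModularSubgroups.cyclicallyReducedSubgroupsOfSize n).Nonempty) ∧
    (fun n : ℕ => ModularSubgroups.uniformProb (ModularSubgroups.subgroupsOfSize n)
        ModularSubgroups.NonParabolic) =O[Filter.atTop] (fun n : ℕ => (n : ℝ) ^ (-α)) ∧
    (fun n : ℕ => ModularSubgroups.uniformProb
        (ModularSubgroups.cyclicallyReducedSubgroupsOfSize n)
        ModularSubgroups.NonParabolic) =O[Filter.atTop] (fun n : ℕ => (n : ℝ) ^ (-α)) := by
  obtain ⟨C, hC, h⟩ := ModularSubgroups.exists_nonParabolic_bound hα₀ hα₁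
  have hsub := ModularSubgroups.cyclicallyReducedSubgroupsOfSize_subset
  refine ⟨fun n hn => ?_, ?_, ?_⟩
  · have hne := ModularSubgroups.cyclicallyReducedSubgroupsOfSize_nonempty n hn
    have hfin := ModularSubgroups.subgroupsOfSize_finite n
    exact ⟨hfin, hne.mono (hsub n), hfin.subset (hsub n), hne⟩
  · exact ModularSubgroups.isBigO_uniformProb hC hsub (fun _ => Set.Subset.rfl) h
  · exact ModularSubgroups.isBigO_uniformProb hC (fun _ => Set.Subset.rfl) hsub h
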